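/- Setting. Let $M$ be a smooth ($C^\infty$, Hausdorff, second countable, without boundary) manifold of dimension $2n$ with a symplectic form $\sigma$, and let $\Delta\subset TM$ be a Lagrange distribution: a smooth vector subbundle whose fibers $\Delta_x\subset T_xM$ satisfy $\dim\Delta_x=n$ and $\sigma_x|_{\Delta_x\times\Delta_x}=0$. Let $\bar\Delta$ be the space of smooth sections of $\Delta$. Let $h\in C^\infty(M)$, let $\vec h$ be its Hamiltonian vector field, $dh=\sigma(\cdot,\vec h)$, assume that $\vec h$ is complete, and let $e^{t\vec h}$, $t\in\mathbb R$, be its flow. Monotonicity. The formula $g_x(v_1(x),v_2(x))=\sigma([\vec h,v_1],v_2)(x)$, $v_1,v_2\in\bar\Delta$, gives a well-defined symmetric bilinear form $g_x$ on $\Delta_x$. The field $\vec h$ is regular at $x$ if the vectors $v(x)$ and $[\vec h,v](x)$, $v\in\bar\Delta$, together span $T_xM$; it is monotone at $x$ if it is regular at $x$ and $g_x$ is (positive or negative) definite; it is monotone if it is monotone at every $x\in M$. Curvature. Put $J_x(t)=e^{-t\vec h}_*\Delta_{e^{t\vec h}(x)}\subset T_xM$. If $\vec h$ is regular, then for small $t\neq\tau$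 the subspaces $J_x(t)$ and $J_x(\tau)$ are transversal; let $P_x(t,\tau)$ be the projector of $T_xM$ onto $J_x(t)$ parallel to $J_x(\tau)$. The curvature operator at $x$ is the linear operator $R_x:\Delta_x\to\Delta_x$ determined by $$\frac{\partial^2}{\partial t\,\partial\tau}\Big(P_x(t,\tau)\big|_{\Delta_x}\Big)\Big|_{\tau=0}=t^{-2}\,\mathbf 1+\tfrac13R_x+O(t)\qquad\text{as }t\to0 .$$ The field $\vec h$ has negative curvature at $x$ if $g_x(R_x\xi,\xi)\,g_x(\xi,\xi)<0$ for all $\xi\in\Delta_x\setminus\{0\}$. Theorem 1. Let $\vec h$ be monotone and $x_0\in M$. Assume that the semi-trajectory $\{e^{t\vec h}(x_0):t\ge0\}$ has compact closure and that $\vec h$ has negative curvature at each point of this closure. Then the limit $x_\infty=\lim_{t\to+\infty}e^{t\vec h}(x_0)$ exists in $M$, $\vec h(x_\infty)=0$, and the linearization $D_{x_\infty}\vec h:T_{x_\infty}M\to T_{x_\infty}M$ of $\vec h$ at $x_\infty$ is hyperbolic, i.e. it has no (complex) eigenvalues on the imaginary axis. -/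

import Mathlib

open Set Filter Topology Manifold
open scoped ContDiff

namespace HamiltonianCurvature

noncomputable section

variable {E : Type*} [NormedAddCommGroup E] [NormedSpace ℝ E]
  {M : Type*} [TopologicalSpace M] [ChartedSpace E M]

/-- A vector field on `M` is smooth if it is a `C^∞` section of the tangent bundle. -/
def IsSmoothField [IsManifold 𝓘(ℝ, E) ∞ M] (v : (x : M) → TangentSpace 𝓘(ℝ, E) x) : Prop :=
  ContMDiff 𝓘(ℝ, E) (𝓘(ℝ, E)).tangent ∞
    (fun x => (⟨x, v x⟩ : TangentBundle 𝓘(ℝ, E) M))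

/-- The model space `E` is, as a vector space, the tangent space `T_xM`; this identity map lets one
use the norm of `E` on the fixed finite-dimensional space `T_xM`. -/
def toModel {x : M} (ξ : TangentSpace 𝓘(ℝ, E) x) : E := ξ

/-! ### Symplectic forms -/

/-- The expression of a field of alternating 2-forms on `M` in the preferred chart at `x₀`:
the pullback of the form under the inverse of the chart. -/
def formInChart (α : (x : M) → (TangentSpace 𝓘(ℝ, E) x) [⋀^Fin 2]→L[ℝ] ℝ) (x₀ : M) (y : E) :
    E [⋀^Fin 2]→L[ℝ] ℝ :=
  (α ((extChartAt 𝓘(ℝ, E) x₀).symm y)).compContinuousLinearMap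
    (mfderiv 𝓘(ℝ, E) 𝓘(ℝ, E) (extChartAt 𝓘(ℝ, E) x₀).symm y)

variable (E M) in
/-- A symplectic form on `M`: a smooth, closed, nondegenerate differential 2-form. Smoothness and
closedness are expressed in the charts of an atlas. -/
structure SymplecticForm where
  /-- the value of the form at a point -/
  toForm : (x : M) → (TangentSpace 𝓘(ℝ, E) x) [⋀^Fin 2]→L[ℝ] ℝ
  smooth : ∀ x₀ : M,
    ContDiffOn ℝ ∞ (formInChart toForm x₀) (extChartAt 𝓘(ℝ, E) x₀).target
  closed : ∀ x₀ : M, ∀ y ∈ (extChartAt 𝓘(ℝ, E) x₀).target,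
    extDeriv (formInChart toForm x₀) y = 0
  nondegenerate : ∀ (x : M) (ξ : TangentSpace 𝓘(ℝ, E) x),
    (∀ η : TangentSpace 𝓘(ℝ, E) x, toForm x ![ξ, η] = 0) → ξ = 0

/-- `σ.pair x ξ η` is `σ_x(ξ, η)`. -/
def SymplecticForm.pair (σ : SymplecticForm E M) (x : M) (ξ η : TangentSpace 𝓘(ℝ, E) x) : ℝ :=
  σ.toForm x ![ξ, η]

theorem SymplecticForm.exists_pair_eq [FiniteDimensional ℝ E] (σ : SymplecticForm E M) (x : M)
    (l : TangentSpace 𝓘(ℝ, E) x →L[ℝ] ℝ) :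
    ∃ X : TangentSpace 𝓘(ℝ, E) x, ∀ ξ, l ξ = σ.pair x ξ X := by
  have : FiniteDimensional ℝ (TangentSpace 𝓘(ℝ, E) x) := inferInstanceAs (FiniteDimensional ℝ E)
  have hupd1 : ∀ a b c : TangentSpace 𝓘(ℝ, E) x, Function.update ![a, c] 0 b = ![b, c] := by
    intro a b c; ext i; fin_cases i <;> rfl
  have hupd2 : ∀ a b c : TangentSpace 𝓘(ℝ, E) x, Function.update ![c, a] 1 b = ![c, b] := by
    intro a b c; ext i; fin_cases i <;> rfl
  let f := σ.toForm x
  have a1 : ∀ a b c, f ![a + b, c] = f ![a, c] + f ![b, c] := by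
    intro a b c
    simpa only [hupd1] using f.map_update_add ![a, c] 0 a b
  have s1 : ∀ (r : ℝ) a c, f ![r • a, c] = r • f ![a, c] := by
    intro r a c
    simpa only [hupd1] using f.map_update_smul ![a, c] 0 r a
  have a2 : ∀ a b c, f ![c, a + b] = f ![c, a] + f ![c, b] := by
    intro a b c
    simpa only [hupd2] using f.map_update_add ![c, a] 1 a b
  have s2 : ∀ (r : ℝ) a c, f ![c, r • a] = r • f ![c, a] := by
    intro r a c
    simpa only [hupd2] using f.map_update_smul ![c, a] 1 r a
  let L : TangentSpace 𝓘(ℝ, E) x →ₗ[ℝ] Module.Dual ℝ (TangentSpace 𝓘(ℝ, E) x) :=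
    LinearMap.mk₂ ℝ (fun ξ η => f ![ξ, η]) a1 s1 (fun c a b => a2 a b c) (fun r c a => s2 r a c)
  have hL : Function.Injective L := by
    rw [← LinearMap.ker_eq_bot, LinearMap.ker_eq_bot']
    intro ξ hξ
    exact σ.nondegenerate x ξ fun η => LinearMap.congr_fun hξ η
  have hs : Function.Surjective L :=
    (LinearMap.injective_iff_surjective_of_finrank_eq_finrank
      (Subspace.dual_finrank_eq).symm).1 hL
  obtain ⟨Y, hY⟩ := hs l.toLinearMap
  refine ⟨-Y, fun ξ => ?_⟩
  have h1 : f ![Y, ξ] = l ξ := LinearMap.congr_fun hY ξ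
  have h2 : f ![ξ, -Y] = - f ![ξ, Y] := by
    have := s2 (-1) Y ξ
    simpa using this
  have h3 : f ![ξ, Y] = - f ![Y, ξ] := by
    have hswap : f (![Y, ξ] ∘ Equiv.swap 0 1) = - f ![Y, ξ] :=
      f.toAlternatingMap.map_swap ![Y, ξ] (i := 0) (j := 1) (by decide)
    rw [← hswap]
    congr 1
    ext i; fin_cases i <;> rfl
  change l ξ = f ![ξ, -Y]
  rw [h2, h3, h1, neg_neg]

/-- The Hamiltonian vector field of `h`: the field with `dh = σ(·, X)`. -/
def hamiltonianField [FiniteDimensional ℝ E] (σ : SymplecticForm E M) (h : M → ℝ) (x : M) :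
    TangentSpace 𝓘(ℝ, E) x :=
  (σ.exists_pair_eq x (mfderiv 𝓘(ℝ, E) 𝓘(ℝ, ℝ) h x)).choose

theorem hamiltonianField_spec [FiniteDimensional ℝ E] (σ : SymplecticForm E M) (h : M → ℝ) (x : M)
    (ξ : TangentSpace 𝓘(ℝ, E) x) :
    mfderiv 𝓘(ℝ, E) 𝓘(ℝ, ℝ) h x ξ = σ.pair x ξ (hamiltonianField σ h x) :=
  (σ.exists_pair_eq x (mfderiv 𝓘(ℝ, E) 𝓘(ℝ, ℝ) h x)).choose_spec ξ

/-- `φ` is the flow of the (complete) vector field `X`: for every `x`, the curve `t ↦ φ t x` is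
defined on the whole time axis, starts at `x` and is an integral curve of `X`. -/
def IsFlow (X : (x : M) → TangentSpace 𝓘(ℝ, E) x) (φ : ℝ → M → M) : Prop :=
  ∀ x : M, φ 0 x = x ∧ IsMIntegralCurve (fun t => φ t x) X

/-! ### Lagrange distributions -/

/-- A Lagrange distribution on the `2n`-dimensional symplectic manifold `(M, σ)`: a smooth vector
subbundle of `TM` whose fibers are `n`-dimensional and isotropic. -/
structure LagrangeDistribution [IsManifold 𝓘(ℝ, E) ∞ M] (n : ℕ) (σ : SymplecticForm E M) where
  /-- the fiber at a point -/
  fiber : (x : M) → Submodule ℝ (TangentSpace 𝓘(ℝ, E) x)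
  finrank_fiber : ∀ x, Module.finrank ℝ (fiber x) = n
  isotropic : ∀ x, ∀ ξ ∈ fiber x, ∀ η ∈ fiber x, σ.pair x ξ η = 0
  exists_frame : ∀ x : M, ∃ U : Set M, IsOpen U ∧ x ∈ U ∧
    ∃ v : Fin n → (y : M) → TangentSpace 𝓘(ℝ, E) y,
      (∀ i, ContMDiffOn 𝓘(ℝ, E) (𝓘(ℝ, E)).tangent ∞
        (fun y => (⟨y, v i y⟩ : TangentBundle 𝓘(ℝ, E) M)) U) ∧
      ∀ y ∈ U, Submodule.span ℝ (range fun i => v i y) = fiber y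

section Distribution

variable [IsManifold 𝓘(ℝ, E) ∞ M] {n : ℕ} {σ : SymplecticForm E M}

/-- `v` is a (global, smooth) section of the distribution `Δ`. -/
def LagrangeDistribution.IsSection (Δ : LagrangeDistribution n σ)
    (v : (x : M) → TangentSpace 𝓘(ℝ, E) x) : Prop :=
  IsSmoothField v ∧ ∀ x, v x ∈ Δ.fiber x

/-- Every vector of `Δ_x` is the value at `x` of a section of `Δ`. -/
theorem LagrangeDistribution.exists_section [FiniteDimensional ℝ E] [T2Space M]
    (Δ : LagrangeDistribution n σ) (x : M) (ξ : Δ.fiber x) :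
    ∃ v, Δ.IsSection v ∧ v x = ξ := by
  obtain ⟨U, hU, hxU, v, hv, hspan⟩ := Δ.exists_frame x
  have hξ : (ξ : TangentSpace 𝓘(ℝ, E) x) ∈ Submodule.span ℝ (range fun i => v i x) := by
    rw [hspan x hxU]; exact ξ.2
  obtain ⟨c, hc⟩ := (Submodule.mem_span_range_iff_exists_fun ℝ).1 hξ
  obtain ⟨b, -, hb⟩ := (SmoothBumpFunction.nhds_basis_tsupport (I := 𝓘(ℝ, E)) x).mem_iff.1
    (hU.mem_nhds hxU)
  let w : (y : M) → TangentSpace 𝓘(ℝ, E) y := fun y => ∑ i, c i • v i y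
  have hw : ContMDiffOn 𝓘(ℝ, E) (𝓘(ℝ, E)).tangent ∞
      (fun y => (⟨y, w y⟩ : TangentBundle 𝓘(ℝ, E) M)) U := by
    refine ContMDiffOn.sum_section (fun i _ => ?_)
    exact ContMDiffOn.smul_section contMDiffOn_const (hv i)
  refine ⟨fun y => b y • w y, ⟨?_, fun y => ?_⟩, ?_⟩
  · exact ContMDiffOn.smul_section_of_tsupport (b.contMDiff.contMDiffOn) hU hb hw
  · by_cases hy : y ∈ U
    · refine Submodule.smul_mem _ _ (Submodule.sum_mem _ fun i _ => Submodule.smul_mem _ _ ?_)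
      rw [← hspan y hy]
      exact Submodule.subset_span ⟨i, rfl⟩
    · have : b y = 0 := by
        by_contra hne
        exact hy (hb (subset_tsupport _ hne))
      simp [this]
  · simp [w, hc]

/-- `g(v₁, v₂) = σ([X, v₁], v₂)`, as a function on `M`. -/
def bracketForm (σ : SymplecticForm E M) (X v₁ v₂ : (x : M) → TangentSpace 𝓘(ℝ, E) x) (x : M) :
    ℝ :=
  σ.pair x (VectorField.mlieBracket 𝓘(ℝ, E) X v₁ x) (v₂ x)

/-- The form `g_x` on `Δ_x`: `g_x(ξ₁, ξ₂) = σ([X, v₁], v₂)(x)`, where `v₁, v₂` are sections of `Δ`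
with `v₁(x) = ξ₁` and `v₂(x) = ξ₂` (for Hamiltonian `X` the choice of sections is immaterial). -/
def fiberForm [FiniteDimensional ℝ E] [T2Space M] (Δ : LagrangeDistribution n σ)
    (X : (x : M) → TangentSpace 𝓘(ℝ, E) x) (x : M) (ξ₁ ξ₂ : Δ.fiber x) : ℝ :=
  bracketForm σ X (Δ.exists_section x ξ₁).choose (Δ.exists_section x ξ₂).choose x

/-- `X` is regular at `x`: the values at `x` of the sections `v` of `Δ` and of their brackets
`[X, v]` span `T_xM`. -/
def IsRegularAt (Δ : LagrangeDistribution n σ) (X : (x : M) → TangentSpace 𝓘(ℝ, E) x) (x : M) :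
    Prop :=
  Δ.fiber x ⊔ Submodule.span ℝ
    {ζ | ∃ v, Δ.IsSection v ∧ ζ = VectorField.mlieBracket 𝓘(ℝ, E) X v x} = ⊤

/-- `X` is monotone at `x`: it is regular at `x` and `g_x` is sign-definite. -/
def IsMonotoneAt [FiniteDimensional ℝ E] [T2Space M] (Δ : LagrangeDistribution n σ)
    (X : (x : M) → TangentSpace 𝓘(ℝ, E) x) (x : M) : Prop :=
  IsRegularAt Δ X x ∧
    ((∀ ξ : Δ.fiber x, ξ ≠ 0 → 0 < fiberForm Δ X x ξ ξ) ∨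
      (∀ ξ : Δ.fiber x, ξ ≠ 0 → fiberForm Δ X x ξ ξ < 0))

/-! ### Curvature -/

/-- The curve of Lagrange subspaces `J_x(t) = (e^{-tX})_* Δ_{e^{tX}(x)}` of `T_xM`, that is, the
set of all tangent vectors at `x` that the differential of `φ t = e^{tX}` sends into `Δ`. -/
def jacobiCurve (Δ : LagrangeDistribution n σ) (φ : ℝ → M → M) (x : M) (t : ℝ) :
    Submodule ℝ (TangentSpace 𝓘(ℝ, E) x) :=
  (Δ.fiber (φ t x)).comap
    (mfderiv 𝓘(ℝ, E) 𝓘(ℝ, E) (φ t) x : TangentSpace 𝓘(ℝ, E) x →ₗ[ℝ] TangentSpace 𝓘(ℝ, E) (φ t x))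

open Classical in
/-- The projector onto `X₂` parallel to `X₁` for a pair of complementary subspaces
(`0` if they are not complementary). -/
def projector {V : Type*} [AddCommGroup V] [Module ℝ V] (X₁ X₂ : Submodule ℝ V) : V →ₗ[ℝ] V :=
  if hX : IsCompl X₂ X₁ then X₂.projection X₁ hX else 0

/-- `∂²/∂t∂τ`, at `τ = 0`, of the projector onto `J_x(t)` parallel to `J_x(τ)`, applied to `ξ`. -/
def projectorMixedDeriv (Δ : LagrangeDistribution n σ) (φ : ℝ → M → M) (x : M)
    (ξ : TangentSpace 𝓘(ℝ, E) x) (t : ℝ) : E :=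
  deriv (fun s : ℝ => deriv (fun τ : ℝ =>
    toModel (projector (jacobiCurve Δ φ x τ) (jacobiCurve Δ φ x s) ξ)) 0) t

/-- `R` is the operator on `Δ_x` in the expansion
`∂²/∂t∂τ (projector onto J_x(t) parallel to J_x(τ)) |_{Δ_x} |_{τ = 0} = t⁻² + R / 3 + O(t)`
as `t → 0`. -/
def IsCurvatureOperator (Δ : LagrangeDistribution n σ) (φ : ℝ → M → M) (x : M)
    (R : Δ.fiber x →ₗ[ℝ] Δ.fiber x) : Prop :=
  ∀ ξ : Δ.fiber x,
    (fun t : ℝ => projectorMixedDeriv Δ φ x (ξ : TangentSpace 𝓘(ℝ, E) x) t -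
        toModel ((t ^ 2)⁻¹ • (ξ : TangentSpace 𝓘(ℝ, E) x) + (3 : ℝ)⁻¹ • (R ξ : TangentSpace 𝓘(ℝ, E) x)))
      =O[𝓝[≠] (0 : ℝ)] (fun t : ℝ => t)

/-- The curvature operator `R_x` on `Δ_x`: the operator determined by `IsCurvatureOperator`. -/
def curvatureOperator (Δ : LagrangeDistribution n σ) (φ : ℝ → M → M) (x : M) :
    Δ.fiber x →ₗ[ℝ] Δ.fiber x :=
  Classical.epsilon (IsCurvatureOperator Δ φ x)

/-- Negative curvature at `x`: `g_x(R_x ξ, ξ) g_x(ξ, ξ) < 0` for all nonzero `ξ ∈ Δ_x`. Here `φ` is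
the flow of `X`. -/
def HasNegativeCurvatureAt [FiniteDimensional ℝ E] [T2Space M] (Δ : LagrangeDistribution n σ)
    (X : (x : M) → TangentSpace 𝓘(ℝ, E) x) (φ : ℝ → M → M) (x : M) : Prop :=
  ∀ ξ : Δ.fiber x, ξ ≠ 0 →
    fiberForm Δ X x (curvatureOperator Δ φ x ξ) ξ * fiberForm Δ X x ξ ξ < 0

end Distribution

/-! ### Linearization at an equilibrium -/

/-- The linearization at `x` of the vector field `X` with `X x = 0`: the derivative at `x` of `X`
written in the preferred chart at `x`. -/
def linearization (X : (x : M) → TangentSpace 𝓘(ℝ, E) x) (x : M) : E →L[ℝ] E :=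
  fderiv ℝ
    (fun y : E => (VectorField.mpullback 𝓘(ℝ, E) 𝓘(ℝ, E) (extChartAt 𝓘(ℝ, E) x).symm X y : E))
    (extChartAt 𝓘(ℝ, E) x x)

/-- A linear operator on a real vector space is hyperbolic if (its complexification) has no
eigenvalues on the imaginary axis. -/
def IsHyperbolic (A : E →L[ℝ] E) : Prop :=
  ∀ μ : ℂ, Module.End.HasEigenvalue ((A : E →ₗ[ℝ] E).baseChange ℂ) μ → μ.re ≠ 0

end

end HamiltonianCurvature

open HamiltonianCurvature

/-! The proof rests on a Lyapunov function whose rate of decay is comparable with the square of the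
speed. Write X for the Hamiltonian field and let v be a local frame of the distribution, w = [X, v]
and [X, w] = v a + w b with matrices a, b. Definiteness of g makes (v, w) a basis of the tangent
space, so every vector has the form ξ = v p + (w − ½ v b) q; here q is the component along a
canonical complement of the distribution. Expanding the projectors shows that the curvature operator
has the matrix ρ = −a + ½ b' − ¼ b², the prime being the derivative along X
(`IsJacobiFrame.isBigO_mixedDeriv`, `IsModelCurve.isBigO_mixedDeriv`).

In these coordinates the bracket with X acts by (p, q) ↦ (∇p − ρ q, ∇q + p), where ∇ is the
derivative along X plus ½ b (`coord_bracket`), and ∇ is compatible with g (`fderiv_gram`). Hence the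
quadratic form Q(ξ) = s g(q, p), with s = ±1 the sign of g, has the Lie derivative s (g(q, ρ q) −
g(p, p)) along X (`fderiv_lyapunov`), which is negative definite when the curvature is negative. The
value of Q on X can be computed from sections of the Jacobi curve without charts or frames
(`lyapunovValue_congr`), so the local formulas glue to a continuous function on M.

Since [X, X] = 0, the function F = Q(X) satisfies dF/dt ≤ −c |X|² along trajectories, and |F| ≤ C
|X|² (`exists_lyapunov_estimate`). Therefore F is constant along the orbit of a cluster point of the
trajectory, so X and F vanish there. Moreover −d√F/dt is at least a positive multiple of |X|, so the
length still to be travelled is at most a multiple of √F, which tends to 0: a trajectory that has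
come close to its cluster point cannot leave (`norm_sub_le_mul_sqrt`,
`tendsto_of_mapClusterPt_of_estimate`). If F reaches 0, the trajectory is at rest.

At an equilibrium the same Lie derivative says that Q strictly decreases along the linearized flow.
An imaginary eigenvalue would make the derivatives of Q on the real and imaginary parts of an
eigenvector cancel, which is impossible (`isHyperbolic_fderiv`). -/

/-! ### Taylor expansions of smooth germs of curves. -/

section SmoothGerms

variable {G : Type*} [NormedAddCommGroup G] [NormedSpace ℝ G]

theorem ContDiffAt.deriv_infty {f : ℝ → G} {t : ℝ} (hf : ContDiffAt ℝ ∞ f t) :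
    ContDiffAt ℝ ∞ (deriv f) t := by
  have h1 : ContDiffAt ℝ ∞ (fderiv ℝ f) t := hf.fderiv_right (m := ∞) (by simp)
  exact h1.clm_apply contDiffAt_const

theorem ContDiffAt.eventually_hasDerivAt {f : ℝ → G} {t : ℝ} (hf : ContDiffAt ℝ ∞ f t) :
    ∀ᶠ s in 𝓝 t, HasDerivAt f (deriv f s) s := by
  have h1 : ContDiffAt ℝ 1 f t := hf.of_le (by simp)
  filter_upwards [h1.eventually (by simp)] with s hs
  exact (hs.differentiableAt (by simp)).hasDerivAt

theorem ContDiffAt.hasDerivAt_deriv {f : ℝ → G} {t : ℝ} (hf : ContDiffAt ℝ ∞ f t) :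
    HasDerivAt f (deriv f t) t :=
  hf.eventually_hasDerivAt.self_of_nhds

/-- A function whose derivative is `O(t ^ k)` deviates from its value at `0` by `O(t ^ (k + 1))`. -/
theorem isBigO_sub_of_hasDerivAt {f f' : ℝ → G} {k : ℕ}
    (hf : ∀ᶠ t in 𝓝 0, HasDerivAt f (f' t) t) (hf' : f' =O[𝓝 0] fun t : ℝ => t ^ k) :
    (fun t => f t - f 0) =O[𝓝 0] fun t : ℝ => t ^ (k + 1) := by
  obtain ⟨C, hC⟩ := hf'.bound
  obtain ⟨r, hr, h⟩ := Metric.eventually_nhds_iff_ball.1 (hf.and hC)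
  refine Asymptotics.IsBigO.of_bound C ?_
  filter_upwards [Metric.ball_mem_nhds (0 : ℝ) hr] with t ht
  have hsub : ∀ s ∈ Metric.closedBall (0 : ℝ) |t|, s ∈ Metric.ball (0 : ℝ) r := by
    intro s hs
    simp only [Metric.mem_closedBall, Metric.mem_ball, dist_zero_right, Real.norm_eq_abs] at *
    linarith
  have hb : ∀ s ∈ Metric.closedBall (0 : ℝ) |t|, ‖f' s‖ ≤ |C| * |t| ^ k := by
    intro s hs
    refine ((h s (hsub s hs)).2).trans ?_
    rw [norm_pow]
    have : ‖s‖ ≤ |t| := by simpa using hs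
    exact mul_le_mul (le_abs_self C) (pow_le_pow_left₀ (norm_nonneg _) this k) (by positivity)
      (by positivity)
  have hC0 : ‖f t - f 0‖ ≤ |C| * |t| ^ k * ‖t - 0‖ :=
    (convex_closedBall (0 : ℝ) |t|).norm_image_sub_le_of_norm_hasDerivWithin_le
      (fun s hs => (h s (hsub s hs)).1.hasDerivWithinAt) hb (by simp) (by simp)
  by_cases hCn : 0 ≤ C
  · rw [abs_of_nonneg hCn] at hC0
    simpa [pow_succ, mul_assoc] using hC0
  -- A negative constant is compatible with the bound only where `t ^ k` vanishes, and there both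
  -- sides of the claim are zero.
  · have h0 := (h 0 (by simpa using hr)).2
    have h1 := (h t ht).2
    push Not at hCn
    have ht0 : ‖t ^ k‖ = 0 := by
      by_contra hne
      have : 0 < ‖t ^ k‖ := lt_of_le_of_ne (norm_nonneg _) (Ne.symm hne)
      nlinarith [norm_nonneg (f' t)]
    have ht0' : |t| ^ k = 0 := by simpa using ht0
    rw [ht0'] at hC0
    have : t ^ (k + 1) = 0 := by
      rw [pow_succ, norm_eq_zero.1 ht0, zero_mul]
    rw [this]; simpa using hC0

theorem ContDiffAt.isBigO_sub {f : ℝ → G} (hf : ContDiffAt ℝ ∞ f 0) :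
    (fun t => f t - f 0) =O[𝓝 0] fun t : ℝ => t := by
  have h := isBigO_sub_of_hasDerivAt (k := 0) hf.eventually_hasDerivAt
    (by simpa using hf.deriv_infty.continuousAt.norm.isBoundedUnder_le.isBigO_one ℝ)
  simpa using h

theorem ContDiffAt.isBigO_taylor_one {f : ℝ → G} (hf : ContDiffAt ℝ ∞ f 0) :
    (fun t => f t - (f 0 + t • deriv f 0)) =O[𝓝 0] fun t : ℝ => t ^ 2 := by
  have h := isBigO_sub_of_hasDerivAt (k := 1) (f := fun t => f t - t • deriv f 0)
    (f' := fun t => deriv f t - deriv f 0) ?_ (by simpa using hf.deriv_infty.isBigO_sub)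
  · refine h.congr_left fun t => ?_
    simp only [zero_smul, sub_zero]; abel
  · filter_upwards [hf.eventually_hasDerivAt] with t ht
    simpa using ht.fun_sub ((hasDerivAt_id t).smul_const (deriv f 0))

theorem ContDiffAt.isBigO_taylor_two {f : ℝ → G} (hf : ContDiffAt ℝ ∞ f 0) :
    (fun t => f t - (f 0 + t • deriv f 0 + (t ^ 2 / 2) • deriv (deriv f) 0))
      =O[𝓝 0] fun t : ℝ => t ^ 3 := by
  have h := isBigO_sub_of_hasDerivAt (k := 2)
    (f := fun t => f t - (t • deriv f 0 + (t ^ 2 / 2) • deriv (deriv f) 0))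
    (f' := fun t => deriv f t - (deriv f 0 + t • deriv (deriv f) 0)) ?_
    hf.deriv_infty.isBigO_taylor_one
  · refine h.congr_left fun t => ?_
    simp only [zero_smul, ne_eq, OfNat.ofNat_ne_zero, not_false_eq_true, zero_pow, zero_div]; abel
  · filter_upwards [hf.eventually_hasDerivAt] with t ht
    have h2 : HasDerivAt (fun t : ℝ => t ^ 2 / 2) t t := by
      simpa using (hasDerivAt_pow 2 t).div_const 2
    simpa using ht.fun_sub (((hasDerivAt_id t).smul_const (deriv f 0)).fun_add
      (h2.smul_const (deriv (deriv f) 0)))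

theorem ContDiffAt.isBigO_taylor_three {f : ℝ → G} (hf : ContDiffAt ℝ ∞ f 0) :
    (fun t => f t - (f 0 + t • deriv f 0 + (t ^ 2 / 2) • deriv (deriv f) 0 +
      (t ^ 3 / 6) • deriv (deriv (deriv f)) 0)) =O[𝓝 0] fun t : ℝ => t ^ 4 := by
  have h := isBigO_sub_of_hasDerivAt (k := 3)
    (f := fun t => f t - (t • deriv f 0 + (t ^ 2 / 2) • deriv (deriv f) 0 +
      (t ^ 3 / 6) • deriv (deriv (deriv f)) 0))
    (f' := fun t => deriv f t - (deriv f 0 + t • deriv (deriv f) 0 +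
      (t ^ 2 / 2) • deriv (deriv (deriv f)) 0)) ?_
    hf.deriv_infty.isBigO_taylor_two
  · refine h.congr_left fun t => ?_
    simp only [zero_smul, ne_eq, OfNat.ofNat_ne_zero, not_false_eq_true, zero_pow, zero_div]; abel
  · filter_upwards [hf.eventually_hasDerivAt] with t ht
    have h2 : HasDerivAt (fun t : ℝ => t ^ 2 / 2) t t := by
      simpa using (hasDerivAt_pow 2 t).div_const 2
    have h3 : HasDerivAt (fun t : ℝ => t ^ 3 / 6) (t ^ 2 / 2) t := by
      have h3 := (hasDerivAt_pow 3 t).div_const 6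
      rwa [show ((3 : ℕ) : ℝ) * t ^ (3 - 1) / 6 = t ^ 2 / 2 by norm_num; ring] at h3
    simpa using ht.fun_sub ((((hasDerivAt_id t).smul_const (deriv f 0)).fun_add
      (h2.smul_const (deriv (deriv f) 0))).fun_add (h3.smul_const (deriv (deriv (deriv f)) 0)))

end SmoothGerms

/-! ### Sections of isotropic curves of subspaces and the intrinsic Lyapunov value. -/

section SectionsOfCurves

variable {V : Type*} [NormedAddCommGroup V] [NormedSpace ℝ V]

/-- A smooth germ at time `0` of a curve of vectors with values in a curve of subspaces. -/
structure IsCurveSection (J : ℝ → Submodule ℝ V) (e : ℝ → V) : Prop where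
  contDiffAt : ContDiffAt ℝ ∞ e 0
  eventually_mem : ∀ᶠ t in 𝓝 0, e t ∈ J t

theorem HasDerivAt.bilin {B : V →L[ℝ] V →L[ℝ] ℝ} {e₁ e₂ : ℝ → V} {d₁ d₂ : V} {t : ℝ}
    (h₁ : HasDerivAt e₁ d₁ t) (h₂ : HasDerivAt e₂ d₂ t) :
    HasDerivAt (fun t => B (e₁ t) (e₂ t)) (B d₁ (e₂ t) + B (e₁ t) d₂) t := by
  have := (B.hasFDerivAt.comp_hasDerivAt t h₁).clm_apply h₂
  simpa [Function.comp_def] using this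

theorem IsCurveSection.sub {J : ℝ → Submodule ℝ V} {e₁ e₂ : ℝ → V} (h₁ : IsCurveSection J e₁)
    (h₂ : IsCurveSection J e₂) : IsCurveSection J (fun t => e₁ t - e₂ t) :=
  ⟨h₁.contDiffAt.sub h₂.contDiffAt, by
    filter_upwards [h₁.eventually_mem, h₂.eventually_mem] with t ha hb using sub_mem ha hb⟩

/-- The curve of subspaces is isotropic near time `0`. -/
def IsIsotropicCurve (B : V →L[ℝ] V →L[ℝ] ℝ) (J : ℝ → Submodule ℝ V) : Prop :=
  ∀ᶠ t in 𝓝 0, ∀ ξ ∈ J t, ∀ η ∈ J t, B ξ η = 0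

variable {B : V →L[ℝ] V →L[ℝ] ℝ} {J : ℝ → Submodule ℝ V} {e₁ e₂ : ℝ → V}

theorem IsCurveSection.eventually_deriv_pairing (hJ : IsIsotropicCurve B J)
    (h₁ : IsCurveSection J e₁) (h₂ : IsCurveSection J e₂) :
    ∀ᶠ t in 𝓝 0, B (deriv e₁ t) (e₂ t) + B (e₁ t) (deriv e₂ t) = 0 := by
  have hz : ∀ᶠ t in 𝓝 (0 : ℝ), (fun t => B (e₁ t) (e₂ t)) t = (fun _ => (0 : ℝ)) t := by
    filter_upwards [hJ, h₁.eventually_mem, h₂.eventually_mem] with t ht ha hb using ht _ ha _ hb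
  filter_upwards [hz.eventually_nhds, h₁.contDiffAt.eventually_hasDerivAt,
    h₂.contDiffAt.eventually_hasDerivAt] with t ht ha hb
  exact (ha.bilin hb).unique ((hasDerivAt_const t (0 : ℝ)).congr_of_eventuallyEq ht)

theorem IsCurveSection.deriv_pairing (hJ : IsIsotropicCurve B J)
    (h₁ : IsCurveSection J e₁) (h₂ : IsCurveSection J e₂) :
    B (deriv e₁ 0) (e₂ 0) + B (e₁ 0) (deriv e₂ 0) = 0 :=
  (h₁.eventually_deriv_pairing hJ h₂).self_of_nhds

theorem IsCurveSection.deriv_deriv_pairing (hJ : IsIsotropicCurve B J)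
    (h₁ : IsCurveSection J e₁) (h₂ : IsCurveSection J e₂) :
    B (deriv (deriv e₁) 0) (e₂ 0) + 2 * B (deriv e₁ 0) (deriv e₂ 0) +
      B (e₁ 0) (deriv (deriv e₂) 0) = 0 := by
  have hz := h₁.eventually_deriv_pairing hJ h₂
  have d1 := (h₁.contDiffAt.deriv_infty.hasDerivAt_deriv.bilin (B := B)
    h₂.contDiffAt.hasDerivAt_deriv).add
    (h₁.contDiffAt.hasDerivAt_deriv.bilin (B := B) h₂.contDiffAt.deriv_infty.hasDerivAt_deriv)
  have := d1.unique ((hasDerivAt_const (0 : ℝ) (0 : ℝ)).congr_of_eventuallyEq hz)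
  linarith

/-- The derivative pairing of two sections depends only on their values at time `0`. -/
theorem IsCurveSection.deriv_pairing_congr (hJ : IsIsotropicCurve B J)
    {e₁' e₂' : ℝ → V} (h₁ : IsCurveSection J e₁)
    (h₁' : IsCurveSection J e₁') (h₂' : IsCurveSection J e₂') (h : e₁ 0 = e₁' 0)
    (h' : e₂ 0 = e₂' 0) : B (deriv e₁ 0) (e₂ 0) = B (deriv e₁' 0) (e₂' 0) := by
  have a := h₁.deriv_pairing hJ h₂'
  have b := h₁'.deriv_pairing hJ h₂'
  rw [h', ← sub_eq_zero]
  rw [h] at a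
  linarith

variable (B) in
/-- The value of the Lyapunov quadratic form on `X`, computed by means of a section `e` with
`X - e'(0)` in the fiber at time `0`. -/
noncomputable def lyapunovValue (X : V) (e : ℝ → V) : ℝ :=
  Real.sign (B (deriv e 0) (e 0)) *
    (B (deriv e 0) X + 2⁻¹ * B (deriv (deriv e) 0) (e 0))

/-- The difference of the two sections has its derivative at 0 in the isotropic fiber, so
definiteness forces it to vanish at 0. Then the change of `B (e') X` is `B (e₁') (e₂')`, and the
second derivative of `B (e₁) (e₂) = 0` shows that the half of `B (e'') e` changes by exactly the
opposite amount. This is what makes the Lyapunov function independent of charts and frames. -/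
theorem lyapunovValue_congr (hB : ∀ ξ η, B ξ η = -B η ξ) (hJ : IsIsotropicCurve B J)
    (hdef : ∀ e, IsCurveSection J e → B (deriv e 0) (e 0) = 0 → e 0 = 0) {X : V}
    (h₁ : IsCurveSection J e₁) (h₂ : IsCurveSection J e₂)
    (hX₁ : X - deriv e₁ 0 ∈ J 0) (hX₂ : X - deriv e₂ 0 ∈ J 0) :
    lyapunovValue B X e₁ = lyapunovValue B X e₂ := by
  have iso := hJ.self_of_nhds
  have hδ := h₁.sub h₂
  have dδ : deriv (fun t => e₁ t - e₂ t) 0 = deriv e₁ 0 - deriv e₂ 0 :=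
    (h₁.contDiffAt.hasDerivAt_deriv.sub h₂.contDiffAt.hasDerivAt_deriv).deriv
  have hmem : deriv e₁ 0 - deriv e₂ 0 ∈ J 0 := by
    have := sub_mem hX₂ hX₁
    simpa using this
  have hval : e₁ 0 = e₂ 0 := by
    refine sub_eq_zero.1 (hdef _ hδ ?_)
    rw [dδ]
    exact iso _ hmem _ (sub_mem h₁.eventually_mem.self_of_nhds h₂.eventually_mem.self_of_nhds)
  have hs : B (deriv e₁ 0) (e₁ 0) = B (deriv e₂ 0) (e₂ 0) :=
    h₁.deriv_pairing_congr hJ h₂ h₂ hval hval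
  have q := h₁.deriv_deriv_pairing hJ h₁
  have q1 := h₁.deriv_deriv_pairing hJ h₂
  have q2 := h₂.deriv_deriv_pairing hJ h₂
  have r : B (deriv e₁ 0 - deriv e₂ 0) (X - deriv e₂ 0) = 0 := iso _ hmem _ hX₂
  have s1 := hB (e₁ 0) (deriv (deriv e₂) 0)
  have s2 := hB (e₂ 0) (deriv (deriv e₂) 0)
  have z1 := hB (deriv e₁ 0) (deriv e₁ 0)
  have z2 := hB (deriv e₂ 0) (deriv e₂ 0)
  unfold lyapunovValue
  rw [hs]
  congr 1
  simp only [map_sub, sub_apply] at r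
  rw [hval] at *
  linarith

end SectionsOfCurves

/-! ### Two-jets in a Banach algebra and the expansion behind the curvature. -/

section Jets

variable {A : Type*} [NormedRing A] [NormedAlgebra ℝ A]

/-- Equality of `f` with `a + t b + t² c` up to `O(t³)` as `t → 0`, `t ≠ 0`. -/
def HasTwoJet (f : ℝ → A) (a b c : A) : Prop :=
  (fun t => f t - (a + t • b + t ^ 2 • c)) =O[𝓝[≠] 0] fun t : ℝ => t ^ 3

theorem isBigO_const_of_continuousAt {B : Type*} [SeminormedAddCommGroup B] {f : ℝ → B} (hf : ContinuousAt f 0) :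
    f =O[𝓝[≠] 0] fun _ : ℝ => (1 : ℝ) :=
  (hf.tendsto.mono_left nhdsWithin_le_nhds).isBigO_one ℝ

theorem isBigO_quadratic (a b c : A) :
    (fun t : ℝ => a + t • b + t ^ 2 • c) =O[𝓝[≠] 0] fun _ : ℝ => (1 : ℝ) := by
  have : Continuous fun t : ℝ => a + t • b + t ^ 2 • c := by fun_prop
  exact isBigO_const_of_continuousAt this.continuousAt

theorem HasTwoJet.isBigO_one {f : ℝ → A} {a b c : A} (h : HasTwoJet f a b c) :
    f =O[𝓝[≠] 0] fun _ : ℝ => (1 : ℝ) := by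
  have h3 : (fun t : ℝ => t ^ 3) =O[𝓝[≠] 0] fun _ : ℝ => (1 : ℝ) :=
    isBigO_const_of_continuousAt (continuous_pow 3).continuousAt
  exact ((h.trans h3).add (isBigO_quadratic a b c)).congr_left fun t => by abel

theorem HasTwoJet.sub {f g : ℝ → A} {a b c a' b' c' : A} (hf : HasTwoJet f a b c)
    (hg : HasTwoJet g a' b' c') : HasTwoJet (fun t => f t - g t) (a - a') (b - b') (c - c') := by
  refine (Asymptotics.IsBigO.sub hf hg).congr_left fun t => ?_
  simp only [smul_sub]; abel

theorem HasTwoJet.mul {f g : ℝ → A} {a b c a' b' c' : A} (hf : HasTwoJet f a b c)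
    (hg : HasTwoJet g a' b' c') :
    HasTwoJet (fun t => f t * g t) (a * a') (a * b' + b * a') (a * c' + b * b' + c * a') := by
  have h1 := Asymptotics.IsBigO.mul hf hg.isBigO_one
  have h2 := (isBigO_quadratic a b c).mul hg
  have h3 : (fun t : ℝ => t ^ 3 • ((b * c' + c * b') + t • (c * c') + t ^ 2 • (0 : A)))
      =O[𝓝[≠] 0] fun t : ℝ => t ^ 3 • (1 : ℝ) :=
    (Asymptotics.isBigO_refl _ _).smul (isBigO_quadratic _ _ _)
  simp only [mul_one, one_mul, smul_eq_mul] at h1 h2 h3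
  refine ((h1.add h2).add h3).congr_left fun t => ?_
  simp only [sub_mul, mul_sub, add_mul, mul_add, smul_add, smul_mul_assoc, mul_smul_comm, smul_smul,
    smul_zero, add_zero]
  module

/-- The expansion of the derivative of `C S⁻¹` when `S` vanishes at `0` with `S'(0) = 1`. -/
theorem isBigO_deriv_mul_inverse [CompleteSpace A] {C S : ℝ → A} {a b g : A}
    (hC : ContDiffAt ℝ ∞ C 0) (hS : ContDiffAt ℝ ∞ S 0)
    (hC0 : C 0 = 1) (hC1 : deriv C 0 = 0) (hC2 : deriv (deriv C) 0 = a)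
    (hS0 : S 0 = 0) (hS1 : deriv S 0 = 1) (hS2 : deriv (deriv S) 0 = b)
    (hS3 : deriv (deriv (deriv S)) 0 = g) :
    (∀ᶠ t in 𝓝[≠] 0, IsUnit (S t)) ∧
    (fun t => (C t * Ring.inverse (S t) * (deriv S t * Ring.inverse (S t))
        - deriv C t * Ring.inverse (S t))
      - ((t ^ 2)⁻¹ • (1 : A) + ((6 : ℝ)⁻¹ • g - (4 : ℝ)⁻¹ • (b * b) - (2 : ℝ)⁻¹ • a)))
      =O[𝓝[≠] 0] fun t : ℝ => t := by
  have hne : ∀ᶠ t : ℝ in 𝓝[≠] 0, t ≠ 0 := eventually_mem_nhdsWithin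
  -- the difference quotient of `S`
  have jU : HasTwoJet (fun t => t⁻¹ • S t) 1 ((2 : ℝ)⁻¹ • b) ((6 : ℝ)⁻¹ • g) := by
    have h := hS.isBigO_taylor_three.mono (nhdsWithin_le_nhds (s := {0}ᶜ))
    rw [hS0, hS1, hS2, hS3] at h
    have h' := (Asymptotics.isBigO_refl (fun t : ℝ => t⁻¹) (𝓝[≠] 0)).smul h
    refine h'.congr' ?_ ?_
    · filter_upwards [hne] with t ht
      match_scalars <;> field_simp
    · filter_upwards [hne] with t ht
      simp only [smul_eq_mul]; field_simp
  have tU : Tendsto (fun t => t⁻¹ • S t) (𝓝[≠] 0) (𝓝 1) := by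
    have h1 : Tendsto (fun t : ℝ => (1 : A) + t • ((2 : ℝ)⁻¹ • b) + t ^ 2 • ((6 : ℝ)⁻¹ • g))
        (𝓝[≠] 0) (𝓝 1) := by
      have : Continuous fun t : ℝ => (1 : A) + t • ((2 : ℝ)⁻¹ • b) + t ^ 2 • ((6 : ℝ)⁻¹ • g) := by
        fun_prop
      have h2 := this.tendsto 0
      simp only [zero_smul, add_zero, ne_eq, OfNat.ofNat_ne_zero, not_false_eq_true,
        zero_pow] at h2
      exact h2.mono_left nhdsWithin_le_nhds
    have h2 : Tendsto (fun t : ℝ => t ^ 3) (𝓝[≠] 0) (𝓝 0) := by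
      have := (continuous_pow 3 : Continuous fun t : ℝ => t ^ 3).tendsto 0
      simp only [ne_eq, OfNat.ofNat_ne_zero, not_false_eq_true, zero_pow] at this
      exact this.mono_left nhdsWithin_le_nhds
    have h3 := (jU.trans_tendsto h2).add h1
    simpa using h3
  have hunit : ∀ᶠ t in 𝓝[≠] (0 : ℝ), IsUnit (t⁻¹ • S t) :=
    tU.eventually (Units.isOpen.mem_nhds isUnit_one)
  have tI : Tendsto (fun t => Ring.inverse (t⁻¹ • S t)) (𝓝[≠] 0) (𝓝 1) := by
    have := (NormedRing.inverse_continuousAt (1 : Aˣ)).tendsto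
    simp only [Units.val_one, Ring.inverse_one] at this
    exact this.comp tU
  -- The formal inverse of 1 + t b/2 + t² g/6 up to second order. The true inverse `I` of `U = t⁻¹ •
  -- S t` differs from this polynomial `D` by `I (1 - U D)`, a bounded factor times O(t³).
  have jD : HasTwoJet (fun t : ℝ => 1 + t • (-((2 : ℝ)⁻¹ • b)) +
      t ^ 2 • ((4 : ℝ)⁻¹ • (b * b) - (6 : ℝ)⁻¹ • g)) 1 (-((2 : ℝ)⁻¹ • b))
      ((4 : ℝ)⁻¹ • (b * b) - (6 : ℝ)⁻¹ • g) := by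
    unfold HasTwoJet
    simpa using Asymptotics.isBigO_zero _ _
  have jI : HasTwoJet (fun t => Ring.inverse (t⁻¹ • S t)) 1 (-((2 : ℝ)⁻¹ • b))
      ((4 : ℝ)⁻¹ • (b * b) - (6 : ℝ)⁻¹ • g) := by
    have h1 := (tI.isBigO_one ℝ).mul (jU.mul jD)
    simp only [one_mul] at h1
    refine h1.neg_left.congr' ?_ EventuallyEq.rfl
    filter_upwards [hunit] with t ht
    obtain ⟨u, hu⟩ := ht
    rw [← hu, Ring.inverse_unit]
    have e1 : -((2 : ℝ)⁻¹ • b) + (2 : ℝ)⁻¹ • b * 1 = 0 := by simp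
    have e2 : (4 : ℝ)⁻¹ • (b * b) - (6 : ℝ)⁻¹ • g +
        (2 : ℝ)⁻¹ • b * -((2 : ℝ)⁻¹ • b) + (6 : ℝ)⁻¹ • g * 1 = 0 := by
      simp only [mul_one, mul_neg, smul_mul_assoc, mul_smul_comm, smul_smul]
      module
    rw [e1, e2]
    simp only [smul_zero, add_zero, mul_one, mul_sub, ← mul_assoc, Units.inv_mul, one_mul]
    abel
  have jC : HasTwoJet C 1 0 ((2 : ℝ)⁻¹ • a) := by
    have h := hC.isBigO_taylor_two.mono (nhdsWithin_le_nhds (s := {0}ᶜ))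
    rw [hC0, hC1, hC2] at h
    refine h.congr_left fun t => ?_
    match_scalars <;> ring
  have jS' : HasTwoJet (deriv S) 1 b ((2 : ℝ)⁻¹ • g) := by
    have h := hS.deriv_infty.isBigO_taylor_two.mono (nhdsWithin_le_nhds (s := {0}ᶜ))
    rw [hS1, hS2, hS3] at h
    refine h.congr_left fun t => ?_
    match_scalars <;> ring
  have jC' : HasTwoJet (fun t => t • deriv C t) 0 0 a := by
    have h := hC.deriv_infty.isBigO_taylor_one.mono (nhdsWithin_le_nhds (s := {0}ᶜ))
    rw [hC1, hC2] at h
    have h' := (Asymptotics.isBigO_refl (fun t : ℝ => t) (𝓝[≠] 0)).smul h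
    refine h'.congr (fun t => ?_) fun t => ?_
    · module
    · simp only [smul_eq_mul]; ring
  -- Since the inverse of `S` is `t⁻¹ I`, this is the wanted expression multiplied by `t²`. An error
  -- O(t³) here becomes O(t) after the division.
  have jK := ((jC.mul jI).mul (jS'.mul jI)).sub (jC'.mul jI)
  have hinv : ∀ᶠ t in 𝓝[≠] (0 : ℝ), IsUnit (S t) ∧
      Ring.inverse (S t) = t⁻¹ • Ring.inverse (t⁻¹ • S t) := by
    filter_upwards [hunit, hne] with t ht h0
    obtain ⟨u, hu⟩ := ht
    have hS' : S t = t • (u : A) := by rw [hu, smul_smul, mul_inv_cancel₀ h0, one_smul]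
    have hmul : S t * (t⁻¹ • (↑u⁻¹ : A)) = 1 := by
      rw [hS', smul_mul_smul_comm, mul_inv_cancel₀ h0, Units.mul_inv, one_smul]
    have hmul' : (t⁻¹ • (↑u⁻¹ : A)) * S t = 1 := by
      rw [hS', smul_mul_smul_comm, inv_mul_cancel₀ h0, Units.inv_mul, one_smul]
    let w : Aˣ := ⟨S t, t⁻¹ • (↑u⁻¹ : A), hmul, hmul'⟩
    refine ⟨⟨w, rfl⟩, ?_⟩
    rw [← hu, Ring.inverse_unit, show S t = (w : A) from rfl, Ring.inverse_unit]
    rfl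
  refine ⟨hinv.mono fun t ht => ht.1, ?_⟩
  have h' := (Asymptotics.isBigO_refl (fun t : ℝ => (t ^ 2)⁻¹) (𝓝[≠] 0)).smul jK
  refine h'.congr' ?_ ?_
  · filter_upwards [hinv, hne] with t ht h0
    rw [ht.2]
    generalize Ring.inverse (t⁻¹ • S t) = I
    simp only [one_mul, mul_one, mul_neg, neg_mul, smul_mul_assoc, mul_smul_comm, smul_smul, zero_mul,
      smul_zero, smul_sub, mul_add, smul_add, mul_sub, smul_neg,
      add_zero, zero_add, neg_neg, sub_zero]
    match_scalars <;> field_simp <;> ring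
  · filter_upwards [hne] with t h0
    simp only [smul_eq_mul]; field_simp

end Jets

/-! ### Projectors onto ranges of frames and their first derivative. -/

section Invertibility

variable {N V : Type*} [NormedAddCommGroup N] [NormedSpace ℝ N] [NormedAddCommGroup V]
  [NormedSpace ℝ V]

theorem ContinuousLinearMap.isInvertible_of_injective {F : Type*} [NormedAddCommGroup F]
    [NormedSpace ℝ F] [FiniteDimensional ℝ F] [FiniteDimensional ℝ V]
    (h : Module.finrank ℝ F = Module.finrank ℝ V) {T : F →L[ℝ] V} (hT : Function.Injective T) :
    T.IsInvertible :=
  ⟨(LinearEquiv.ofInjectiveOfFinrankEq T.toLinearMap hT h).toContinuousLinearEquiv, by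
    ext x; rfl⟩

theorem ContinuousLinearMap.IsInvertible.eventually [CompleteSpace N] {T : N →L[ℝ] V}
    (hT : T.IsInvertible) : ∀ᶠ T' in 𝓝 T, ContinuousLinearMap.IsInvertible T' := by
  obtain ⟨e, rfl⟩ := hT
  exact ContinuousLinearEquiv.nhds e

theorem ContinuousLinearMap.IsInvertible.apply_inverse {T : N →L[ℝ] V}
    (hT : T.IsInvertible) (y : V) : T (T.inverse y) = y :=
  (hT.inverse_apply_eq.1 rfl).symm

theorem ContinuousLinearMap.IsInvertible.contDiffAt_inverse [CompleteSpace N] {T : N →L[ℝ] V}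
    (hT : T.IsInvertible) : ContDiffAt ℝ ∞ ContinuousLinearMap.inverse T := by
  exact hT.contDiffAt_map_inverse

variable {F G : N →L[ℝ] V}

theorem isCompl_range_of_isInvertible_coprod (h : (F.coprod G).IsInvertible) :
    IsCompl F.range G.range := by
  refine ⟨Submodule.disjoint_def.2 ?_, Submodule.codisjoint_iff_exists_add_eq.2 fun z => ?_⟩
  · rintro _ ⟨x, rfl⟩ ⟨y, hy⟩
    have h0 : F.coprod G (x, -y) = F.coprod G 0 := by
      have hy' : G y = F x := hy
      simp [hy']
    have h1 := congrArg (F.coprod G).inverse h0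
    rw [h.inverse_apply_self, h.inverse_apply_self] at h1
    have : x = 0 := congrArg Prod.fst h1
    simp [this]
  · refine ⟨F ((F.coprod G).inverse z).1, G ((F.coprod G).inverse z).2, ⟨_, rfl⟩, ⟨_, rfl⟩, ?_⟩
    exact h.apply_inverse z

theorem projector_range_apply (h : (F.coprod G).IsInvertible) (z : V) :
    projector G.range F.range z = F ((F.coprod G).inverse z).1 := by
  have hc := isCompl_range_of_isInvertible_coprod h
  unfold projector
  rw [dif_pos hc]
  conv_lhs => rw [← h.apply_inverse z]
  simp only [ContinuousLinearMap.coprod_apply, map_add]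
  rw [Submodule.projection_apply_of_mem_left hc (x := F _) ⟨_, rfl⟩,
    (Submodule.projection_apply_eq_zero_iff hc (x := G _)).2 ⟨_, rfl⟩, add_zero]

/-- The projector kills `e τ c`, so `e 0 c` may be replaced by `e 0 c - e τ c`. That vector vanishes
at `τ = 0`, and the derivative of the inverse drops out of the product rule. -/
theorem hasDerivAt_projector [CompleteSpace N] {J : ℝ → Submodule ℝ V} {e : ℝ → N →L[ℝ] V}
    {e' : N →L[ℝ] V}
    (he : HasDerivAt e e' 0) (hJ : ∀ᶠ t in 𝓝 0, J t = (e t).range)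
    (h : (F.coprod (e 0)).IsInvertible) (c : N) :
    HasDerivAt (fun τ => projector (J τ) F.range (e 0 c))
      (-F ((F.coprod (e 0)).inverse (e' c)).1) 0 := by
  have hcop : HasDerivAt (fun τ => F.coprod (e τ))
      (e'.comp (ContinuousLinearMap.snd ℝ N N)) 0 := by
    have h1 : (fun τ => F.coprod (e τ)) = fun τ => F.comp (ContinuousLinearMap.fst ℝ N N) +
        (e τ).comp (ContinuousLinearMap.snd ℝ N N) := by
      ext τ x <;> simp
    rw [h1]
    exact ((((ContinuousLinearMap.compL ℝ (N × N) N V).flip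
      (ContinuousLinearMap.snd ℝ N N)).hasFDerivAt).comp_hasDerivAt 0 he).const_add _
  have hinv : DifferentiableAt ℝ (fun τ => (F.coprod (e τ)).inverse) 0 :=
    (h.contDiffAt_inverse.differentiableAt (by simp)).comp
      (f := fun τ => F.coprod (e τ)) (0 : ℝ) hcop.differentiableAt
  have hu : HasDerivAt (fun τ => e 0 c - e τ c) (-e' c) 0 := by
    have := (he.clm_apply (hasDerivAt_const (0 : ℝ) c)).const_sub (e 0 c)
    simpa using this
  have hprod := hinv.hasDerivAt.clm_apply hu
  have hF := (F.comp (ContinuousLinearMap.fst ℝ N N)).hasFDerivAt.comp_hasDerivAt 0 hprod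
  refine HasDerivAt.congr_of_eventuallyEq (f := fun τ =>
    F ((F.coprod (e τ)).inverse (e 0 c - e τ c)).1) ?_ ?_
  · simpa [Function.comp_def] using hF
  · filter_upwards [hJ, hcop.continuousAt.eventually h.eventually] with τ hτ hi
    rw [hτ, ← projector_range_apply hi, map_sub, projector_range_apply hi (e τ c)]
    have : (F.coprod (e τ)).inverse (e τ c) = (0, c) := by
      rw [hi.inverse_apply_eq]; simp
    simp [this]

end Invertibility

/-! ### Curvature of a curve of subspaces in terms of a frame. -/

section CurvatureOfFrame

variable {N V : Type*} [NormedAddCommGroup N] [NormedSpace ℝ N] [NormedAddCommGroup V]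
  [NormedSpace ℝ V]

theorem ContDiffAt.deriv_clm_comp {G H : Type*} [NormedAddCommGroup G] [NormedSpace ℝ G]
    [NormedAddCommGroup H] [NormedSpace ℝ H] (L : G →L[ℝ] H) {f : ℝ → G}
    (hf : ContDiffAt ℝ ∞ f 0) :
    deriv (fun t => L (f t)) =ᶠ[𝓝 0] fun t => L (deriv f t) := by
  filter_upwards [hf.eventually_hasDerivAt] with t ht
  exact (L.hasFDerivAt.comp_hasDerivAt t ht).deriv

theorem ContDiffAt.deriv_deriv_clm_comp {G H : Type*} [NormedAddCommGroup G] [NormedSpace ℝ G]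
    [NormedAddCommGroup H] [NormedSpace ℝ H] (L : G →L[ℝ] H) {f : ℝ → G}
    (hf : ContDiffAt ℝ ∞ f 0) :
    deriv (deriv (fun t => L (f t))) =ᶠ[𝓝 0] fun t => L (deriv (deriv f) t) :=
  (hf.deriv_clm_comp L).deriv.trans (hf.deriv_infty.deriv_clm_comp L)

/-- A smooth frame of a curve of subspaces which together with its derivative spans the space. -/
structure IsJacobiFrame (J : ℝ → Submodule ℝ V) (e : ℝ → N →L[ℝ] V) : Prop where
  contDiffAt : ContDiffAt ℝ ∞ e 0
  eventually_range : ∀ᶠ t in 𝓝 0, J t = (e t).range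
  isInvertible : ((e 0).coprod (deriv e 0)).IsInvertible

/-- The expansion of the mixed derivative of the projectors of a Jacobi curve. -/
theorem IsJacobiFrame.isBigO_mixedDeriv [CompleteSpace N] {J : ℝ → Submodule ℝ V}
    {e : ℝ → N →L[ℝ] V}
    (h : IsJacobiFrame J e) {a b c g : N →L[ℝ] N}
    (h2 : deriv (deriv e) 0 = (e 0).comp a + (deriv e 0).comp b)
    (h3 : deriv (deriv (deriv e)) 0 = (e 0).comp c + (deriv e 0).comp g) (ξ : N) :
    (fun t => deriv (fun s => deriv (fun τ => projector (J τ) (J s) (e 0 ξ)) 0) t -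
      ((t ^ 2)⁻¹ • e 0 ξ +
        e 0 (((6 : ℝ)⁻¹ • g - (4 : ℝ)⁻¹ • (b * b) - (2 : ℝ)⁻¹ • a) ξ)))
      =O[𝓝[≠] 0] fun t : ℝ => t := by
  set T := (e 0).coprod (deriv e 0) with hT
  have hTi : T.IsInvertible := h.isInvertible
  let P₁ : (N →L[ℝ] V) →L[ℝ] (N →L[ℝ] N) :=
    ContinuousLinearMap.compL ℝ N V N ((ContinuousLinearMap.fst ℝ N N).comp T.inverse)
  let P₂ : (N →L[ℝ] V) →L[ℝ] (N →L[ℝ] N) :=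
    ContinuousLinearMap.compL ℝ N V N ((ContinuousLinearMap.snd ℝ N N).comp T.inverse)
  have hTe : ∀ x y : N, T.inverse (e 0 x + deriv e 0 y) = (x, y) := fun x y => by
    rw [hTi.inverse_apply_eq]; simp [hT]
  have hP₁ : ∀ x y : N →L[ℝ] N, P₁ ((e 0).comp x + (deriv e 0).comp y) = x := fun x y => by
    ext v
    change (T.inverse (e 0 (x v) + deriv e 0 (y v))).1 = _
    rw [hTe]
  have hP₂ : ∀ x y : N →L[ℝ] N, P₂ ((e 0).comp x + (deriv e 0).comp y) = y := fun x y => by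
    ext v
    change (T.inverse (e 0 (x v) + deriv e 0 (y v))).2 = _
    rw [hTe]
  have hdec : ∀ f : N →L[ℝ] V, (e 0).comp (P₁ f) + (deriv e 0).comp (P₂ f) = f := fun f => by
    ext v
    have := hTi.apply_inverse (f v)
    rw [hT, ContinuousLinearMap.coprod_apply] at this
    exact this
  -- The frame is written as `e t = e 0 ∘ C t + e' 0 ∘ S t`; `S` vanishes at 0 with derivative 1 and
  -- is therefore invertible for small nonzero times.
  let C : ℝ → N →L[ℝ] N := fun t => P₁ (e t)
  let S : ℝ → N →L[ℝ] N := fun t => P₂ (e t)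
  have he := h.contDiffAt
  have hC : ContDiffAt ℝ ∞ C 0 := P₁.contDiff.contDiffAt.comp 0 he
  have hS : ContDiffAt ℝ ∞ S 0 := P₂.contDiff.contDiffAt.comp 0 he
  have e0 : e 0 = (e 0).comp (1 : N →L[ℝ] N) + (deriv e 0).comp (0 : N →L[ℝ] N) := by
    ext; simp
  have e1 : deriv e 0 = (e 0).comp (0 : N →L[ℝ] N) + (deriv e 0).comp (1 : N →L[ℝ] N) := by
    ext; simp
  obtain ⟨hunit, hO⟩ := isBigO_deriv_mul_inverse (a := a) (b := b) (g := g) hC hS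
    (by change P₁ (e 0) = 1; rw [e0, hP₁])
    (by rw [(he.deriv_clm_comp P₁).self_of_nhds]; beta_reduce; rw [e1, hP₁])
    (by rw [(he.deriv_deriv_clm_comp P₁).self_of_nhds]; beta_reduce; rw [h2, hP₁])
    (by change P₂ (e 0) = 0; rw [e0, hP₂])
    (by rw [(he.deriv_clm_comp P₂).self_of_nhds]; beta_reduce; rw [e1, hP₂])
    (by rw [(he.deriv_deriv_clm_comp P₂).self_of_nhds]; beta_reduce; rw [h2, hP₂])
    (by rw [(he.deriv_deriv_clm_comp P₂).deriv.self_of_nhds,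
      (he.deriv_infty.deriv_infty.deriv_clm_comp P₂).self_of_nhds]; beta_reduce; rw [h3, hP₂])
  -- the first derivative of the projectors
  have hinner : ∀ᶠ s in 𝓝[≠] (0 : ℝ), deriv (fun τ => projector (J τ) (J s) (e 0 ξ)) 0 =
      -(e 0 (C s (Ring.inverse (S s) ξ)) + deriv e 0 ξ) := by
    filter_upwards [hunit, h.eventually_range.filter_mono nhdsWithin_le_nhds] with s hs hr
    obtain ⟨u, hu⟩ := hs
    have hdecs : ∀ x, e s x = e 0 (C s x) + deriv e 0 (S s x) := fun x =>
      (DFunLike.congr_fun (hdec (e s)) x).symm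
    have hSu : ∀ x, S s ((↑u⁻¹ : N →L[ℝ] N) x) = x := fun x => by
      rw [← hu]; exact DFunLike.congr_fun u.mul_inv x
    have huS : ∀ x, (↑u⁻¹ : N →L[ℝ] N) (S s x) = x := fun x => by
      rw [← hu]; exact DFunLike.congr_fun u.inv_mul x
    -- For `z = e 0 x + e' 0 y` the component along `e s` must be `S⁻¹ y`, because only `e s`
    -- contributes to `e' 0`; the rest along `e 0` is then `x - C S⁻¹ y`.
    have hcop : ((e s).coprod (e 0)).IsInvertible := by
      refine ContinuousLinearMap.IsInvertible.of_inverse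
        (g := ((↑u⁻¹ : N →L[ℝ] N).comp ((ContinuousLinearMap.snd ℝ N N).comp T.inverse)).prod
          (((ContinuousLinearMap.fst ℝ N N).comp T.inverse) - (C s).comp
            ((↑u⁻¹ : N →L[ℝ] N).comp ((ContinuousLinearMap.snd ℝ N N).comp T.inverse)))) ?_ ?_
      · ext z
        have hz := hTi.apply_inverse z
        rw [hT, ContinuousLinearMap.coprod_apply] at hz
        simp only [ContinuousLinearMap.coe_comp, Function.comp_apply, ContinuousLinearMap.prod_apply,
          ContinuousLinearMap.coprod_apply, hdecs, hSu, sub_apply, ContinuousLinearMap.coe_snd',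
          ContinuousLinearMap.coe_fst', map_sub, ContinuousLinearMap.id_apply]
        conv_rhs => rw [← hz]
        abel
      · refine ContinuousLinearMap.ext fun z => ?_
        have hz : T.inverse (e s z.1 + e 0 z.2) = (C s z.1 + z.2, S s z.1) := by
          rw [← hTe, hdecs, map_add (e 0)]; congr 1; abel
        simp [hz, huS]
    have hd := hasDerivAt_projector (J := J) he.hasDerivAt_deriv h.eventually_range hcop ξ
    rw [hr, hd.deriv]
    have hi : ((e s).coprod (e 0)).inverse (deriv e 0 ξ) =
        ((↑u⁻¹ : N →L[ℝ] N) ξ, -C s ((↑u⁻¹ : N →L[ℝ] N) ξ)) := by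
      rw [hcop.inverse_apply_eq]
      simp [hdecs, hSu]
    rw [hi, ← hu, Ring.inverse_unit]
    simp only [hdecs, hSu]
  -- the second derivative
  have houter : ∀ᶠ t in 𝓝[≠] (0 : ℝ),
      deriv (fun s => deriv (fun τ => projector (J τ) (J s) (e 0 ξ)) 0) t =
      e 0 ((C t * Ring.inverse (S t) * (deriv S t * Ring.inverse (S t))
        - deriv C t * Ring.inverse (S t)) ξ) := by
    have hn : ∀ᶠ t in 𝓝[≠] (0 : ℝ), ∀ᶠ s in 𝓝 t,
        deriv (fun τ => projector (J τ) (J s) (e 0 ξ)) 0 =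
      -(e 0 (C s (Ring.inverse (S s) ξ)) + deriv e 0 ξ) := by
      have h1 := eventually_eventually_nhdsWithin.2 hinner
      filter_upwards [h1, eventually_mem_nhdsWithin] with t ht h0
      rwa [IsOpen.nhdsWithin_eq isOpen_compl_singleton h0] at ht
    filter_upwards [hn, hunit, hC.eventually_hasDerivAt.filter_mono nhdsWithin_le_nhds,
      hS.eventually_hasDerivAt.filter_mono nhdsWithin_le_nhds] with t ht hu dC dS
    rw [EventuallyEq.deriv_eq ht]
    obtain ⟨u, hu⟩ := hu
    have dI : HasDerivAt (fun s => Ring.inverse (S s))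
        (-(Ring.inverse (S t) * deriv S t * Ring.inverse (S t))) t := by
      have h1 : HasFDerivAt Ring.inverse _ (S t) := hu ▸ hasFDerivAt_ringInverse (𝕜 := ℝ) u
      have h2 := h1.comp_hasDerivAt t dS
      rw [← hu, Ring.inverse_unit]
      simpa [Function.comp_def] using h2
    have dCI := dC.mul dI
    have d1 := (e 0).hasFDerivAt.comp_hasDerivAt t (dCI.clm_apply (hasDerivAt_const t ξ))
    have d2 := (d1.add_const (deriv e 0 ξ)).neg
    refine (HasDerivAt.deriv (f' := _) ?_)
    have hv : -(e 0) ((deriv C t * Ring.inverse (S t) +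
        C t * -(Ring.inverse (S t) * deriv S t * Ring.inverse (S t))) ξ +
          ((C * fun s => Ring.inverse (S s)) t) 0) =
        e 0 ((C t * Ring.inverse (S t) * (deriv S t * Ring.inverse (S t))
          - deriv C t * Ring.inverse (S t)) ξ) := by
      rw [← map_neg]
      congr 1
      simp [mul_assoc, sub_eq_add_neg]
    rw [← hv]
    exact d2
  -- conclusion
  let Ev : (N →L[ℝ] N) →L[ℝ] V := (e 0).comp (ContinuousLinearMap.apply ℝ N ξ)
  have hfin := (Ev.isBigO_comp _ (𝓝[≠] (0 : ℝ))).trans hO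
  refine hfin.congr' ?_ EventuallyEq.rfl
  filter_upwards [houter] with t ht
  rw [ht]
  simp [Ev]

end CurvatureOfFrame

/-! ### Local flows and Grönwall's estimate for their differentials. -/

section LocalFlow

variable {E : Type*} [NormedAddCommGroup E] [NormedSpace ℝ E] [CompleteSpace E]

/-- A `C¹` field has a local flow, defined for a uniform time and staying in a given
neighborhood. -/
theorem exists_localFlow {X : E → E} {x₀ : E} (hX : ContDiffAt ℝ 1 X x₀) {U : Set E}
    (hU : U ∈ 𝓝 x₀) :
    ∃ (Ψ : ℝ → E → E) (ε r : ℝ), 0 < ε ∧ 0 < r ∧ ContinuousAt (fun p : ℝ × E => Ψ p.1 p.2) (0, x₀) ∧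
      ∀ x ∈ Metric.ball x₀ r, Ψ 0 x = x ∧ ∀ t ∈ Ioo (-ε) ε,
        HasDerivAt (fun s => Ψ s x) (X (Ψ t x)) t ∧ Ψ t x ∈ U := by
  obtain ⟨ε, hε, a, r, L, K, hr, hpl⟩ := IsPicardLindelof.of_contDiffAt_one hX
  obtain ⟨α, hα, hcont⟩ := (hpl 0).exists_forall_mem_closedBall_eq_hasDerivWithinAt_continuousOn
  have hr' : (0 : ℝ) < r := hr
  have hnhds : Metric.closedBall x₀ (r : ℝ) ×ˢ Icc (0 - ε) (0 + ε) ∈ 𝓝 (x₀, (0 : ℝ)) :=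
    prod_mem_nhds (Metric.closedBall_mem_nhds _ hr') (Icc_mem_nhds (by linarith) (by linarith))
  have hα0 : α (x₀, 0) = x₀ := (hα x₀ (Metric.mem_closedBall_self hr'.le)).1
  have hc : ContinuousAt α (x₀, 0) := hcont.continuousAt hnhds
  have hev : ∀ᶠ p in 𝓝 (x₀, (0 : ℝ)), α p ∈ U := hc (by rwa [hα0])
  rw [nhds_prod_eq] at hev
  obtain ⟨s, hs, t, ht, hst⟩ := Filter.eventually_prod_iff.1 hev
  obtain ⟨r₁, hr₁, hs⟩ := Metric.eventually_nhds_iff_ball.1 hs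
  obtain ⟨ε₁, hε₁, ht⟩ := Metric.eventually_nhds_iff_ball.1 ht
  refine ⟨fun t x => α (x, t), min ε ε₁, min r r₁, lt_min hε hε₁, lt_min hr' hr₁, ?_, ?_⟩
  · exact ContinuousAt.comp (f := fun p : ℝ × E => (p.2, p.1)) (g := α) hc
      (continuous_swap.continuousAt)
  · intro x hx
    have hxr : x ∈ Metric.closedBall x₀ (r : ℝ) :=
      Metric.ball_subset_closedBall (Metric.ball_subset_ball (min_le_left _ _) hx)
    refine ⟨(hα x hxr).1, fun τ hτ => ⟨?_, ?_⟩⟩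
    · have h1 : -ε < τ := lt_of_le_of_lt (neg_le_neg (min_le_left _ _)) hτ.1
      have h2 : τ < ε := lt_of_lt_of_le hτ.2 (min_le_left _ _)
      exact ((hα x hxr).2 τ ⟨by linarith, by linarith⟩).hasDerivAt
        (Icc_mem_nhds (by linarith) (by linarith))
    · refine hst (hs x (Metric.ball_subset_ball (min_le_right _ _) hx)) (ht τ ?_)
      have h1 : -ε₁ < τ := lt_of_le_of_lt (neg_le_neg (min_le_right _ _)) hτ.1
      have h2 : τ < ε₁ := lt_of_lt_of_le hτ.2 (min_le_right _ _)
      rw [Metric.mem_ball, dist_zero_right, Real.norm_eq_abs, abs_lt]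
      exact ⟨h1, h2⟩

omit [CompleteSpace E] in
theorem gronwallBound_zero_eq_mul (K ε x : ℝ) :
    gronwallBound 0 K ε x = ε * gronwallBound 0 K 1 x := by
  by_cases hK : K = 0
  · simp [hK, gronwallBound_K0]
  · simp only [gronwallBound_of_K_ne_0 hK, zero_mul, zero_add]; ring

omit [CompleteSpace E] in
/-- Differentiability in the initial condition of the solutions of an ODE, in forward time. -/
theorem hasFDerivAt_flow_of_nonneg {X : E → E} {x₀ : E} {Φ : ℝ → E → E} {A : ℝ → E →L[ℝ] E}
    {ε r ρ C M : ℝ} {K : NNReal} (hr : 0 < r) (hρ : 0 < ρ)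
    (hK : LipschitzOnWith K X (Metric.ball x₀ ρ))
    (hC : ∀ y ∈ Metric.ball x₀ ρ, ∀ z ∈ Metric.ball x₀ ρ,
      ‖X z - X y - fderiv ℝ X y (z - y)‖ ≤ C * ‖z - y‖ ^ 2)
    (hC0 : 0 ≤ C)
    (hΦ : ∀ x ∈ Metric.ball x₀ r, Φ 0 x = x ∧ ∀ t ∈ Ico 0 ε,
        HasDerivAt (fun s => Φ s x) (X (Φ t x)) t ∧ Φ t x ∈ Metric.ball x₀ ρ)
    (hΦ₀ : ∀ t ∈ Ico 0 ε, Φ t x₀ ∈ Metric.ball x₀ (ρ / 2))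
    (hA0 : A 0 = 1)
    (hA : ∀ t ∈ Ico 0 ε, HasDerivAt A ((fderiv ℝ X (Φ t x₀)).comp (A t)) t)
    (hM : ∀ t ∈ Ico 0 ε, ‖A t‖ ≤ M) :
    ∀ t ∈ Ico 0 ε, HasFDerivAt (Φ t) (A t) x₀ := by
  intro T hT
  have hε : 0 < ε := lt_of_le_of_lt hT.1 hT.2
  have hM0 : 0 ≤ M := (norm_nonneg _).trans (hM T hT)
  have hsub : Metric.ball x₀ (ρ / 2) ⊆ Metric.ball x₀ ρ :=
    Metric.ball_subset_ball (by linarith)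
  have hIco : ∀ t ∈ Icc 0 T, t ∈ Ico 0 ε := fun t ht => ⟨ht.1, lt_of_le_of_lt ht.2 hT.2⟩
  -- The curve `Φ t x₀ + A t (x - x₀)` starts at `x` and solves the equation up to an error `C M² ‖x
  -- - x₀‖²`. Grönwall's inequality with zero initial distance keeps it that close to `Φ t x`, up to
  -- a constant factor.
  have key : ∀ᶠ x in 𝓝 x₀, ‖Φ T x - Φ T x₀ - A T (x - x₀)‖ ≤
      (C * M ^ 2 * gronwallBound 0 K 1 T) * ‖x - x₀‖ ^ 2 := by
    have hsmall : ∀ᶠ x in 𝓝 x₀, M * ‖x - x₀‖ < ρ / 2 := by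
      have : ContinuousAt (fun x => M * ‖x - x₀‖) x₀ := by fun_prop
      have h0 : (fun x => M * ‖x - x₀‖) x₀ < ρ / 2 := by simp; linarith
      exact this.eventually_lt continuousAt_const h0
    filter_upwards [hsmall, Metric.ball_mem_nhds x₀ hr] with x hx hxr
    have hf : ∀ t ∈ Icc 0 T, HasDerivAt (fun t => Φ t x₀ + A t (x - x₀))
        (X (Φ t x₀) + fderiv ℝ X (Φ t x₀) (A t (x - x₀))) t := fun t ht => by
      have h1 := ((hΦ x₀ (Metric.mem_ball_self hr)).2 t (hIco t ht)).1
      have h2 := (hA t (hIco t ht)).clm_apply (hasDerivAt_const t (x - x₀))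
      simpa using h1.fun_add h2
    have hAx : ∀ t ∈ Icc 0 T, ‖A t (x - x₀)‖ ≤ M * ‖x - x₀‖ := fun t ht =>
      ((A t).le_opNorm _).trans (mul_le_mul_of_nonneg_right (hM t (hIco t ht)) (norm_nonneg _))
    have hfs : ∀ t ∈ Icc 0 T, Φ t x₀ + A t (x - x₀) ∈ Metric.ball x₀ ρ := fun t ht => by
      have h1 := hΦ₀ t (hIco t ht)
      rw [Metric.mem_ball, dist_eq_norm] at h1 ⊢
      calc ‖Φ t x₀ + A t (x - x₀) - x₀‖ = ‖(Φ t x₀ - x₀) + A t (x - x₀)‖ := by congr 1; abel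
        _ ≤ ‖Φ t x₀ - x₀‖ + ‖A t (x - x₀)‖ := norm_add_le _ _
        _ < ρ := by linarith [hAx t ht]
    have hbound : ∀ t ∈ Ico 0 T, dist (X (Φ t x₀) + fderiv ℝ X (Φ t x₀) (A t (x - x₀)))
        (X (Φ t x₀ + A t (x - x₀))) ≤ C * M ^ 2 * ‖x - x₀‖ ^ 2 := fun t ht => by
      have ht' := Ico_subset_Icc_self ht
      have h1 := hC _ (hsub (hΦ₀ t (hIco t ht'))) _ (hfs t ht')
      rw [add_sub_cancel_left] at h1
      rw [dist_comm, dist_eq_norm, ← sub_sub]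
      refine h1.trans ?_
      rw [mul_assoc, ← mul_pow]
      exact mul_le_mul_of_nonneg_left
        (pow_le_pow_left₀ (norm_nonneg _) (hAx t ht') 2) hC0
    have hg : ∀ t ∈ Icc 0 T, HasDerivAt (fun t => Φ t x) (X (Φ t x)) t := fun t ht =>
      ((hΦ x hxr).2 t (hIco t ht)).1
    have := dist_le_of_approx_trajectories_ODE_of_mem (v := fun _ => X)
      (s := fun _ => Metric.ball x₀ ρ) (K := K) (a := 0) (b := T) (δ := 0) (εg := 0)
      (fun _ _ => hK)
      (fun t ht => (hf t ht).continuousAt.continuousWithinAt)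
      (fun t ht => (hf t (Ico_subset_Icc_self ht)).hasDerivWithinAt) hbound
      (fun t ht => hfs t (Ico_subset_Icc_self ht))
      (fun t ht => (hg t ht).continuousAt.continuousWithinAt)
      (fun t ht => (hg t (Ico_subset_Icc_self ht)).hasDerivWithinAt) (by simp)
      (fun t ht => ((hΦ x hxr).2 t (hIco t (Ico_subset_Icc_self ht))).2)
      (by simp [hA0, (hΦ x hxr).1, (hΦ x₀ (Metric.mem_ball_self hr)).1]) T ⟨hT.1, le_rfl⟩
    rw [dist_comm, dist_eq_norm, add_zero, sub_zero, gronwallBound_zero_eq_mul, ← sub_sub] at this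
    refine this.trans (le_of_eq ?_)
    ring
  refine HasFDerivAt.of_isLittleO ?_
  have h0 : (fun x => Φ T x - Φ T x₀ - A T (x - x₀)) =O[𝓝 x₀] fun x => ‖x - x₀‖ ^ 2 := by
    refine Asymptotics.IsBigO.of_bound (C * M ^ 2 * gronwallBound 0 K 1 T) ?_
    filter_upwards [key] with x hx
    simpa using hx
  have h1 : (fun x => ‖x - x₀‖ ^ 2) =o[𝓝 x₀] fun x => ‖x - x₀‖ ^ 1 := by
    have h2 : Tendsto (fun x => ‖x - x₀‖) (𝓝 x₀) (𝓝 0) := by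
      have : Continuous fun x => ‖x - x₀‖ := by fun_prop
      simpa using this.tendsto x₀
    exact (Asymptotics.isLittleO_pow_pow (by norm_num)).comp_tendsto h2
  refine h0.trans_isLittleO ?_
  simp only [pow_one] at h1
  exact h1.of_norm_right

end LocalFlow

/-! ### Differentiability of the flow in the initial condition. -/

section VariationalEquation

variable {E : Type*} [NormedAddCommGroup E] [NormedSpace ℝ E]

/-- The derivative of `X` is itself Lipschitz near `x₀`, so the mean value inequality on a segment
gives a quadratic remainder, uniformly in the base point. Grönwall's argument needs this uniformity
along a whole trajectory. -/
theorem ContDiffAt.exists_ball_lipschitz_quadratic {X : E → E} {x₀ : E}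
    (hX : ContDiffAt ℝ ∞ X x₀) :
    ∃ (ρ : ℝ) (K : NNReal) (C : ℝ), 0 < ρ ∧ 0 ≤ C ∧ LipschitzOnWith K X (Metric.ball x₀ ρ) ∧
      ∀ y ∈ Metric.ball x₀ ρ, ∀ z ∈ Metric.ball x₀ ρ,
      ‖X z - X y - fderiv ℝ X y (z - y)‖ ≤ C * ‖z - y‖ ^ 2 := by
  obtain ⟨K, t, ht, hK⟩ := (hX.of_le (by simp) : ContDiffAt ℝ 1 X x₀).exists_lipschitzOnWith
  have hX' : ContDiffAt ℝ ∞ (fderiv ℝ X) x₀ := hX.fderiv_right (by simp)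
  obtain ⟨K', t', ht', hK'⟩ :=
    (hX'.of_le (by simp) : ContDiffAt ℝ 1 (fderiv ℝ X) x₀).exists_lipschitzOnWith
  have hd : ∀ᶠ x in 𝓝 x₀, DifferentiableAt ℝ X x := by
    filter_upwards [(hX.of_le (by simp) : ContDiffAt ℝ 1 X x₀).eventually (by simp)] with x hx
    exact hx.differentiableAt (by simp)
  obtain ⟨ρ, hρ, h⟩ := Metric.mem_nhds_iff.1 (inter_mem ht (inter_mem ht' hd))
  refine ⟨ρ, K, K', hρ, K'.2, hK.mono fun x hx => (h hx).1, fun y hy z hz => ?_⟩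
  have hseg : segment ℝ y z ⊆ Metric.ball x₀ ρ := (convex_ball x₀ ρ).segment_subset hy hz
  have := Convex.norm_image_sub_le_of_norm_fderiv_le' (𝕜 := ℝ) (f := X) (C := K' * ‖z - y‖)
    (φ := fderiv ℝ X y) (s := segment ℝ y z) (x := y) (y := z)
    (fun x hx => (h (hseg hx)).2.2) (fun x hx => ?_) (convex_segment y z)
    (left_mem_segment ℝ y z) (right_mem_segment ℝ y z)
  · rw [pow_two, ← mul_assoc]; exact this
  · have h1 := hK'.dist_le_mul x (h (hseg hx)).2.1 y (h hy).2.1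
    rw [dist_eq_norm, dist_eq_norm] at h1
    refine h1.trans (mul_le_mul_of_nonneg_left ?_ K'.2)
    obtain ⟨θ, hθ, rfl⟩ := (segment_eq_image' ℝ y z ▸ hx : x ∈ (fun θ : ℝ => y + θ • (z - y)) '' Icc 0 1)
    rw [add_sub_cancel_left, norm_smul, Real.norm_eq_abs, abs_of_nonneg hθ.1]
    exact mul_le_of_le_one_left (norm_nonneg _) hθ.2

/-- The differential of the flow at `x₀` exists for small times and solves the variational
equation. -/
theorem exists_hasFDerivAt_flow [CompleteSpace E] {X : E → E} {x₀ : E}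
    (hX : ContDiffAt ℝ ∞ X x₀) {Φ : ℝ → E → E} {ε r : ℝ} (hε : 0 < ε) (hr : 0 < r)
    (hcont : ContinuousAt (fun p : ℝ × E => Φ p.1 p.2) (0, x₀))
    (hΦ : ∀ x ∈ Metric.ball x₀ r, Φ 0 x = x ∧ ∀ t ∈ Ioo (-ε) ε,
        HasDerivAt (fun s => Φ s x) (X (Φ t x)) t) :
    ∃ A : ℝ → E →L[ℝ] E, A 0 = 1 ∧ ∀ᶠ t in 𝓝 0,
      HasDerivAt A ((fderiv ℝ X (Φ t x₀)).comp (A t)) t ∧ HasFDerivAt (Φ t) (A t) x₀ := by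
  obtain ⟨ρ, K, C, hρ, hC0, hK, hC⟩ := hX.exists_ball_lipschitz_quadratic
  have hX' : ContDiffAt ℝ ∞ (fderiv ℝ X) x₀ := hX.fderiv_right (by simp)
  have hx₀ : x₀ ∈ Metric.ball x₀ r := Metric.mem_ball_self hr
  have hΦ00 : Φ 0 x₀ = x₀ := (hΦ x₀ hx₀).1
  have hΦc : ContinuousAt (fun t => Φ t x₀) 0 := ((hΦ x₀ hx₀).2 0 ⟨by linarith, hε⟩).continuousAt
  -- the joint system
  let F : E × (E →L[ℝ] E) → E × (E →L[ℝ] E) := fun p => (X p.1, (fderiv ℝ X p.1).comp p.2)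
  have hF : ContDiffAt ℝ ∞ F (x₀, 1) := by
    refine ContDiffAt.prodMk (hX.comp (x₀, (1 : E →L[ℝ] E)) contDiffAt_fst) ?_
    exact (hX'.comp (x₀, (1 : E →L[ℝ] E)) contDiffAt_fst).clm_comp contDiffAt_snd
  obtain ⟨α, hα0, δ, hδ, hα⟩ :=
    (hF.of_le (by simp) : ContDiffAt ℝ 1 F _).exists_forall_mem_closedBall_exists_eq_forall_mem_Ioo_hasDerivAt₀ 0
  simp only [zero_sub, zero_add] at hα
  have hα1 : ∀ t ∈ Ioo (-δ) δ, HasDerivAt (fun t => (α t).1) (X (α t).1) t := fun t ht =>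
    (ContinuousLinearMap.fst ℝ E (E →L[ℝ] E)).hasFDerivAt.comp_hasDerivAt t (hα t ht)
  have hα2 : ∀ t ∈ Ioo (-δ) δ,
      HasDerivAt (fun t => (α t).2) ((fderiv ℝ X (α t).1).comp (α t).2) t := fun t ht =>
    (ContinuousLinearMap.snd ℝ E (E →L[ℝ] E)).hasFDerivAt.comp_hasDerivAt t (hα t ht)
  have hδ0 : Ioo (-δ) δ ∈ 𝓝 (0 : ℝ) := Ioo_mem_nhds (by linarith) hδ
  have hε0 : Ioo (-ε) ε ∈ 𝓝 (0 : ℝ) := Ioo_mem_nhds (by linarith) hε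
  have hα1c : ContinuousAt (fun t => (α t).1) 0 := (hα1 0 (mem_of_mem_nhds hδ0)).continuousAt
  have hα2c : ContinuousAt (fun t => (α t).2) 0 := (hα2 0 (mem_of_mem_nhds hδ0)).continuousAt
  have hα10 : (α 0).1 = x₀ := by rw [hα0]
  have hα20 : (α 0).2 = 1 := by rw [hα0]
  -- The first component of the joint solution must be the given trajectory, so that the second one
  -- solves the variational equation along `Φ t x₀`.
  have heq : (fun t => Φ t x₀) =ᶠ[𝓝 0] fun t => (α t).1 := by
    refine ODE_solution_unique_of_eventually (v := fun _ => X) (s := fun _ => Metric.ball x₀ ρ)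
      (K := K) (Eventually.of_forall fun _ => hK) ?_ ?_ (by rw [hΦ00, hα10])
    · filter_upwards [hε0, hΦc.eventually (by
        rw [hΦ00]; exact Metric.ball_mem_nhds x₀ hρ : ∀ᶠ y in 𝓝 (Φ 0 x₀), y ∈ Metric.ball x₀ ρ)]
        with t ht ht'
      exact ⟨(hΦ x₀ hx₀).2 t ht, ht'⟩
    · filter_upwards [hδ0, hα1c.eventually (by
        rw [hα10]; exact Metric.ball_mem_nhds x₀ hρ : ∀ᶠ y in 𝓝 (α 0).1, y ∈ Metric.ball x₀ ρ)]
        with t ht ht'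
      exact ⟨hα1 t ht, ht'⟩
  have hAeq : ∀ᶠ t in 𝓝 (0 : ℝ),
      HasDerivAt (fun t => (α t).2) ((fderiv ℝ X (Φ t x₀)).comp (α t).2) t := by
    filter_upwards [hδ0, heq] with t ht ht'
    rw [ht']
    exact hα2 t ht
  have hM : ∀ᶠ t in 𝓝 (0 : ℝ), ‖(α t).2‖ ≤ ‖(α 0).2‖ + 1 :=
    (hα2c.norm.eventually_lt continuousAt_const (lt_add_one _)).mono fun t ht => ht.le
  have hΦ₀ : ∀ᶠ t in 𝓝 (0 : ℝ), Φ t x₀ ∈ Metric.ball x₀ (ρ / 2) :=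
    hΦc.eventually (by beta_reduce; rw [hΦ00]; exact Metric.ball_mem_nhds x₀ (by linarith))
  have hin : ∀ᶠ p in 𝓝 ((0 : ℝ), x₀), Φ p.1 p.2 ∈ Metric.ball x₀ ρ :=
    hcont.eventually (by
      simp only [hΦ00]; exact Metric.ball_mem_nhds x₀ hρ)
  rw [nhds_prod_eq] at hin
  obtain ⟨P, hP, Q, hQ, hPQ⟩ := Filter.eventually_prod_iff.1 hin
  obtain ⟨r₁, hr₁, hQ⟩ := Metric.eventually_nhds_iff_ball.1 hQ
  obtain ⟨η, hη, hall⟩ := Metric.eventually_nhds_iff_ball.1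
    (((hAeq.and hM).and (hΦ₀.and hP)).and hε0)
  have hball : ∀ t : ℝ, |t| < η → t ∈ Metric.ball (0 : ℝ) η := fun t ht => by
    rwa [Metric.mem_ball, dist_zero_right]
  have habs : ∀ t ∈ Ico 0 η, |t| < η := fun t ht => by rw [abs_of_nonneg ht.1]; exact ht.2
  have hfwd := hasFDerivAt_flow_of_nonneg (Φ := Φ) (A := fun t => (α t).2) (ε := η)
    (lt_min hr hr₁) hρ hK hC hC0
    (fun x hx => ⟨(hΦ x (Metric.ball_subset_ball (min_le_left _ _) hx)).1, fun t ht =>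
      ⟨(hΦ x (Metric.ball_subset_ball (min_le_left _ _) hx)).2 t (hall t (hball t (habs t ht))).2,
        hPQ (hall t (hball t (habs t ht))).1.2.2
          (hQ x (Metric.ball_subset_ball (min_le_right _ _) hx))⟩⟩)
    (fun t ht => (hall t (hball t (habs t ht))).1.2.1) hα20
    (fun t ht => (hall t (hball t (habs t ht))).1.1.1)
    (fun t ht => (hall t (hball t (habs t ht))).1.1.2)
  have habs' : ∀ t ∈ Ico 0 η, |-t| < η := fun t ht => by rw [abs_neg]; exact habs t ht
  -- Negative times are the positive times of the field `-X`, whose flow and fundamental solution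
  -- are obtained by reversing time.
  have hbwd := hasFDerivAt_flow_of_nonneg (X := fun x => -X x) (Φ := fun t => Φ (-t))
    (A := fun t => (α (-t)).2) (ε := η) (K := K) (C := C)
    (M := ‖(α 0).2‖ + 1)
    (lt_min hr hr₁) hρ hK.neg (fun y hy z hz => by
      have := hC y hy z hz
      rw [← norm_neg] at this
      rw [fderiv_fun_neg]
      refine le_trans (le_of_eq ?_) this
      congr 1
      simp only [neg_apply]; abel) hC0
    (fun x hx => ⟨by
      rw [neg_zero]; exact (hΦ x (Metric.ball_subset_ball (min_le_left _ _) hx)).1, fun t ht =>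
      ⟨by
        have h1 := (hΦ x (Metric.ball_subset_ball (min_le_left _ _) hx)).2 (-t)
          (hall (-t) (hball (-t) (habs' t ht))).2
        have h2 := HasDerivAt.scomp t h1 (hasDerivAt_neg t)
        simpa [Function.comp_def] using h2,
        hPQ (hall (-t) (hball (-t) (habs' t ht))).1.2.2
          (hQ x (Metric.ball_subset_ball (min_le_right _ _) hx))⟩⟩)
    (fun t ht => (hall (-t) (hball (-t) (habs' t ht))).1.2.1) (by simp [hα20])
    (fun t ht => by
      have h1 := (hall (-t) (hball (-t) (habs' t ht))).1.1.1
      have h2 := HasDerivAt.scomp t h1 (hasDerivAt_neg t)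
      rw [fderiv_fun_neg, ContinuousLinearMap.neg_comp]
      simpa [Function.comp_def] using h2)
    (fun t ht => (hall (-t) (hball (-t) (habs' t ht))).1.1.2)
  refine ⟨fun t => (α t).2, hα20, ?_⟩
  filter_upwards [hAeq, Metric.ball_mem_nhds (0 : ℝ) hη] with t ht htη
  refine ⟨ht, ?_⟩
  rw [Metric.mem_ball, dist_zero_right, Real.norm_eq_abs] at htη
  rcases le_or_gt 0 t with h0 | h0
  · exact hfwd t ⟨h0, by rwa [abs_of_nonneg h0] at htη⟩
  · have := hbwd (-t) ⟨by linarith, by rwa [abs_of_neg h0] at htη⟩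
    simpa using this

end VariationalEquation

/-! ### Pullback along an integral curve turns Lie brackets into time derivatives. -/

section Transport

variable {E N : Type*} [NormedAddCommGroup E] [NormedSpace ℝ E] [NormedAddCommGroup N]
  [NormedSpace ℝ N]

/-- The Lie bracket `[X, V]`, for a family `V` of vector fields depending linearly on a
parameter. -/
noncomputable def adField (X : E → E) (V : E → N →L[ℝ] E) (x : E) : N →L[ℝ] E :=
  fderiv ℝ V x (X x) - (fderiv ℝ X x).comp (V x)

theorem ContDiffAt.adField {X : E → E} {V : E → N →L[ℝ] E} {x : E} (hX : ContDiffAt ℝ ∞ X x)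
    (hV : ContDiffAt ℝ ∞ V x) : ContDiffAt ℝ ∞ (adField X V) x :=
  ((hV.fderiv_right (m := ∞) (by simp)).clm_apply hX).sub
    ((hX.fderiv_right (m := ∞) (by simp)).clm_comp hV)

theorem ContDiffAt.eventually_differentiableAt {F : Type*} [NormedAddCommGroup F] [NormedSpace ℝ F]
    {f : E → F} {x : E} (hf : ContDiffAt ℝ ∞ f x) : ∀ᶠ y in 𝓝 x, DifferentiableAt ℝ f y := by
  filter_upwards [(hf.of_le (by simp) : ContDiffAt ℝ 1 f x).eventually (by simp)] with y hy
  exact hy.differentiableAt (by simp)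

/-- An integral curve `y` of `X` together with the inverse `B` of the fundamental solution of the
variational equation along `y`. -/
structure IsVariationalPair (X : E → E) (y : ℝ → E) (B : ℝ → E →L[ℝ] E) : Prop where
  hasDerivAt_curve : ∀ᶠ t in 𝓝 0, HasDerivAt y (X (y t)) t
  hasDerivAt_inverse : ∀ᶠ t in 𝓝 0, HasDerivAt B (-(B t).comp (fderiv ℝ X (y t))) t

/-- The pullback of the values of `V` along an integral curve to its starting point. -/
def transport (B : ℝ → E →L[ℝ] E) (y : ℝ → E) (V : E → N →L[ℝ] E) (t : ℝ) : N →L[ℝ] E :=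
  (B t).comp (V (y t))

variable {X : E → E} {y : ℝ → E} {B : ℝ → E →L[ℝ] E}

theorem IsVariationalPair.continuousAt (h : IsVariationalPair X y B) : ContinuousAt y 0 :=
  h.hasDerivAt_curve.self_of_nhds.continuousAt

theorem IsVariationalPair.hasDerivAt_transport (h : IsVariationalPair X y B) {V : E → N →L[ℝ] E}
    (hV : ∀ᶠ x in 𝓝 (y 0), DifferentiableAt ℝ V x) :
    ∀ᶠ t in 𝓝 0, HasDerivAt (transport B y V) (transport B y (adField X V) t) t := by
  filter_upwards [h.hasDerivAt_curve, h.hasDerivAt_inverse, h.continuousAt.eventually hV]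
    with t h1 h2 h3
  have := h2.clm_comp (h3.hasFDerivAt.comp_hasDerivAt t h1)
  have e : transport B y (_root_.adField X V) t = (-(B t).comp (fderiv ℝ X (y t))).comp
      ((V ∘ y) t) + (B t).comp ((fderiv ℝ V (y t)) (X (y t))) := by
    ext c
    simp [transport, _root_.adField, sub_eq_neg_add]
  rw [e]
  exact this

/-- A bootstrap: the derivative of a transport is the transport of a bracket, which is as smooth as
the original family. The induction therefore has to run over all `V` at once, and needs nothing
about `B` beyond its differential equation. -/
theorem IsVariationalPair.contDiffAt_transport (h : IsVariationalPair X y B)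
    (hX : ContDiffAt ℝ ∞ X (y 0)) {V : E → N →L[ℝ] E} (hV : ContDiffAt ℝ ∞ V (y 0)) :
    ContDiffAt ℝ ∞ (transport B y V) 0 := by
  rw [contDiffAt_infty]
  intro k
  induction k generalizing V with
  | zero =>
    have h1 := h.hasDerivAt_transport hV.eventually_differentiableAt
    rw [Nat.cast_zero, contDiffAt_zero]
    obtain ⟨u, hu, hu'⟩ := h1.exists_mem
    exact ⟨u, hu, fun t ht => (hu' t ht).continuousAt.continuousWithinAt⟩
  | succ k ih =>
    rw [Nat.cast_succ, contDiffAt_succ_iff_hasFDerivAt]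
    refine ⟨fun t => ContinuousLinearMap.smulRight (1 : ℝ →L[ℝ] ℝ)
      (transport B y (_root_.adField X V) t), ?_, ?_⟩
    · obtain ⟨u, hu, hu'⟩ :=
        (h.hasDerivAt_transport hV.eventually_differentiableAt).exists_mem
      refine ⟨u, hu, fun t ht => ?_⟩
      exact (hu' t ht).hasFDerivAt
    · exact contDiffAt_const.smulRight (ih (hX.adField hV))

/-- Differentiating the inverse gives −A⁻¹ A' A⁻¹, and the variational equation for `A` cancels one
factor. -/
theorem exists_isVariationalPair [CompleteSpace E] {A : ℝ → E →L[ℝ] E}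
    (hy : ∀ᶠ t in 𝓝 0, HasDerivAt y (X (y t)) t) (hA0 : A 0 = 1)
    (hA : ∀ᶠ t in 𝓝 0, HasDerivAt A ((fderiv ℝ X (y t)).comp (A t)) t) :
    ∃ B : ℝ → E →L[ℝ] E, IsVariationalPair X y B ∧ B 0 = 1 ∧
      ∀ᶠ t in 𝓝 0, (A t).comp (B t) = 1 ∧ (B t).comp (A t) = 1 := by
  have hc : ContinuousAt A 0 := hA.self_of_nhds.continuousAt
  have hu : ∀ᶠ t in 𝓝 (0 : ℝ), IsUnit (A t) :=
    hc.eventually (by rw [hA0]; exact Units.isOpen.mem_nhds isUnit_one)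
  refine ⟨fun t => Ring.inverse (A t), ⟨hy, ?_⟩, by simp [hA0], ?_⟩
  · filter_upwards [hA, hu] with t ht hut
    obtain ⟨u, hu⟩ := hut
    have h1 : HasFDerivAt Ring.inverse _ (A t) := hu ▸ hasFDerivAt_ringInverse (𝕜 := ℝ) u
    have h2 := h1.comp_hasDerivAt t ht
    rw [← hu, Ring.inverse_unit]
    rw [← hu] at h2
    have h3 : (-(ContinuousLinearMap.mulLeftRight ℝ (E →L[ℝ] E)) ↑u⁻¹ ↑u⁻¹)
        ((fderiv ℝ X (y t)).comp (u : E →L[ℝ] E)) =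
        -(↑u⁻¹ : E →L[ℝ] E).comp (fderiv ℝ X (y t)) := by
      change -((↑u⁻¹ : E →L[ℝ] E) * ((fderiv ℝ X (y t)) * ↑u) * ↑u⁻¹) =
        -((↑u⁻¹ : E →L[ℝ] E) * (fderiv ℝ X (y t)))
      rw [mul_assoc, mul_assoc, Units.mul_inv, mul_one]
    rw [h3] at h2
    exact h2
  · filter_upwards [hu] with t hut
    exact ⟨Ring.mul_inverse_cancel _ hut, Ring.inverse_mul_cancel _ hut⟩

end Transport

/-! ### The structure equations of a Lagrange distribution in a vector space. -/

section LagrangeModel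

variable {E N : Type*} [NormedAddCommGroup E] [NormedSpace ℝ E] [NormedAddCommGroup N]
  [NormedSpace ℝ N]

/-- On the open set `Ω` of a vector space, `X` is a field preserving the field of skew-symmetric
forms `B`, and `v` is a frame of an isotropic distribution of half dimension, on which the form
`B([X, v], v)` has the definite sign `s`. -/
structure IsLagrangeModel (X : E → E) (B : E → E →L[ℝ] E →L[ℝ] ℝ) (v : E → N →L[ℝ] E) (s : ℝ)
    (Ω : Set E) : Prop where
  isOpen : IsOpen Ω
  contDiffOn_field : ContDiffOn ℝ ∞ X Ω
  contDiffOn_form : ContDiffOn ℝ ∞ B Ω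
  contDiffOn_frame : ContDiffOn ℝ ∞ v Ω
  skew : ∀ x ∈ Ω, ∀ ξ η, B x ξ η = -B x η ξ
  invariant : ∀ x ∈ Ω, ∀ ξ η, fderiv ℝ B x (X x) ξ η + B x (fderiv ℝ X x ξ) η +
    B x ξ (fderiv ℝ X x η) = 0
  isotropic : ∀ x ∈ Ω, ∀ c d, B x (v x c) (v x d) = 0
  finrank_eq : Module.finrank ℝ (N × N) = Module.finrank ℝ E
  sign_eq : s = 1 ∨ s = -1
  definite : ∀ x ∈ Ω, ∀ c, c ≠ 0 → 0 < s * B x (adField X v x c) (v x c)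

namespace IsLagrangeModel

section Definitions

variable (X : E → E) (B : E → E →L[ℝ] E →L[ℝ] ℝ) (v : E → N →L[ℝ] E)

/-- The trivialization of the space given by the frame and its bracket with the field. -/
noncomputable def triv (x : E) : N × N →L[ℝ] E := (v x).coprod (adField X v x)

/-- The first coefficient of the second bracket. -/
noncomputable def coeffA (x : E) : N →L[ℝ] N :=
  (ContinuousLinearMap.fst ℝ N N).comp
    ((triv X v x).inverse.comp (adField X (adField X v) x))

/-- The second coefficient of the second bracket. -/
noncomputable def coeffB (x : E) : N →L[ℝ] N :=
  (ContinuousLinearMap.snd ℝ N N).comp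
    ((triv X v x).inverse.comp (adField X (adField X v) x))

/-- The curvature matrix in the frame. -/
noncomputable def curvatureMatrix (x : E) : N →L[ℝ] N :=
  -coeffA X v x + (2 : ℝ)⁻¹ • fderiv ℝ (coeffB X v) x (X x)
    - (4 : ℝ)⁻¹ • (coeffB X v x).comp (coeffB X v x)

/-- The component of a vector along the canonical complement. -/
noncomputable def coordQ (x ξ : E) : N := ((triv X v x).inverse ξ).2

/-- The component of a vector along the distribution, parallel to the canonical complement. -/
noncomputable def coordP (x ξ : E) : N :=
  ((triv X v x).inverse ξ).1 + (2 : ℝ)⁻¹ • coeffB X v x (coordQ X v x ξ)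

/-- The matrix of the form `g` in the frame. -/
noncomputable def gram (x : E) (c d : N) : ℝ := B x (adField X v x c) (v x d)

end Definitions

variable {X : E → E} {B : E → E →L[ℝ] E →L[ℝ] ℝ} {v : E → N →L[ℝ] E} {s : ℝ} {Ω : Set E}

theorem contDiffAt_field (h : IsLagrangeModel X B v s Ω) {x : E} (hx : x ∈ Ω) :
    ContDiffAt ℝ ∞ X x := h.contDiffOn_field.contDiffAt (h.isOpen.mem_nhds hx)

theorem contDiffAt_form (h : IsLagrangeModel X B v s Ω) {x : E} (hx : x ∈ Ω) :
    ContDiffAt ℝ ∞ B x := h.contDiffOn_form.contDiffAt (h.isOpen.mem_nhds hx)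

theorem contDiffAt_frame (h : IsLagrangeModel X B v s Ω) {x : E} (hx : x ∈ Ω) :
    ContDiffAt ℝ ∞ v x := h.contDiffOn_frame.contDiffAt (h.isOpen.mem_nhds hx)

theorem contDiffAt_bracket (h : IsLagrangeModel X B v s Ω) {x : E} (hx : x ∈ Ω) :
    ContDiffAt ℝ ∞ (adField X v) x := (h.contDiffAt_field hx).adField (h.contDiffAt_frame hx)

theorem contDiffAt_bracket_bracket (h : IsLagrangeModel X B v s Ω) {x : E} (hx : x ∈ Ω) :
    ContDiffAt ℝ ∞ (adField X (adField X v)) x :=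
  (h.contDiffAt_field hx).adField (h.contDiffAt_bracket hx)

/-- Pairing v p + w q = 0 with v q leaves only g(q, q) by isotropy, so q = 0 by definiteness. Then v
p = 0, and g(p, p) = 0 gives p = 0. Equality of dimensions does the rest. -/
theorem isInvertible_triv [FiniteDimensional ℝ E] [FiniteDimensional ℝ N]
    (h : IsLagrangeModel X B v s Ω) {x : E} (hx : x ∈ Ω) :
    (triv X v x).IsInvertible := by
  refine ContinuousLinearMap.isInvertible_of_injective h.finrank_eq ?_
  rw [injective_iff_map_eq_zero]
  rintro ⟨p, q⟩ hpq
  have hpq' : v x p + adField X v x q = 0 := hpq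
  have hq : q = 0 := by
    by_contra hq
    have h1 := h.definite x hx q hq
    have h2 : B x (v x p + adField X v x q) (v x q) = 0 := by rw [hpq']; simp
    rw [map_add, add_apply, h.isotropic x hx, zero_add] at h2
    rw [h2] at h1; simp at h1
  have hp : p = 0 := by
    by_contra hp
    have h1 := h.definite x hx p hp
    rw [hq, map_zero, add_zero] at hpq'
    rw [hpq', map_zero] at h1; simp at h1
  rw [hp, hq]; rfl

theorem contDiffAt_triv (h : IsLagrangeModel X B v s Ω) {x : E} (hx : x ∈ Ω) :
    ContDiffAt ℝ ∞ (triv X v) x := by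
  have h1 : triv X v = fun y => (v y).comp (ContinuousLinearMap.fst ℝ N N) +
      (adField X v y).comp (ContinuousLinearMap.snd ℝ N N) := by
    ext y c <;> simp [triv]
  rw [h1]
  exact ((h.contDiffAt_frame hx).clm_comp contDiffAt_const).add
    ((h.contDiffAt_bracket hx).clm_comp contDiffAt_const)

variable [FiniteDimensional ℝ E] [FiniteDimensional ℝ N]

theorem contDiffAt_inverse_triv (h : IsLagrangeModel X B v s Ω) {x : E} (hx : x ∈ Ω) :
    ContDiffAt ℝ ∞ (fun y => (triv X v y).inverse) x :=
  (h.isInvertible_triv hx).contDiffAt_inverse.comp (f := triv X v) x (h.contDiffAt_triv hx)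

theorem contDiffAt_coeffA (h : IsLagrangeModel X B v s Ω) {x : E} (hx : x ∈ Ω) :
    ContDiffAt ℝ ∞ (coeffA X v) x :=
  contDiffAt_const.clm_comp ((h.contDiffAt_inverse_triv hx).clm_comp
    (h.contDiffAt_bracket_bracket hx))

theorem contDiffAt_coeffB (h : IsLagrangeModel X B v s Ω) {x : E} (hx : x ∈ Ω) :
    ContDiffAt ℝ ∞ (coeffB X v) x :=
  contDiffAt_const.clm_comp ((h.contDiffAt_inverse_triv hx).clm_comp
    (h.contDiffAt_bracket_bracket hx))

theorem contDiffAt_curvatureMatrix (h : IsLagrangeModel X B v s Ω) {x : E} (hx : x ∈ Ω) :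
    ContDiffAt ℝ ∞ (curvatureMatrix X v) x := by
  have hB := h.contDiffAt_coeffB hx
  have h1 : ContDiffAt ℝ ∞ (fun y => fderiv ℝ (coeffB X v) y (X y)) x :=
    (hB.fderiv_right (m := ∞) (by simp)).clm_apply (h.contDiffAt_field hx)
  have h2 : ContDiffAt ℝ ∞ (fun y => (coeffB X v y).comp (coeffB X v y)) x := hB.clm_comp hB
  exact ((h.contDiffAt_coeffA hx).neg.add (h1.const_smul (2 : ℝ)⁻¹)).sub
    (h2.const_smul (4 : ℝ)⁻¹)

theorem contDiffAt_coordQ (h : IsLagrangeModel X B v s Ω) {x : E} (hx : x ∈ Ω) {Y : E → E}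
    (hY : ContDiffAt ℝ ∞ Y x) : ContDiffAt ℝ ∞ (fun y => coordQ X v y (Y y)) x :=
  ((h.contDiffAt_inverse_triv hx).clm_apply hY).snd

theorem contDiffAt_coordP (h : IsLagrangeModel X B v s Ω) {x : E} (hx : x ∈ Ω) {Y : E → E}
    (hY : ContDiffAt ℝ ∞ Y x) : ContDiffAt ℝ ∞ (fun y => coordP X v y (Y y)) x :=
  ((h.contDiffAt_inverse_triv hx).clm_apply hY).fst.add
    (contDiffAt_const.smul ((h.contDiffAt_coeffB hx).clm_apply (h.contDiffAt_coordQ hx hY)))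

theorem bracket_bracket_eq (h : IsLagrangeModel X B v s Ω) {x : E} (hx : x ∈ Ω) :
    adField X (adField X v) x =
      (v x).comp (coeffA X v x) + (adField X v x).comp (coeffB X v x) := by
  ext c
  exact ((h.isInvertible_triv hx).apply_inverse (adField X (adField X v) x c)).symm

/-- The complement is spanned by w − ½ v b rather than by w: this shift makes the bracket with `X` a
connection compatible with g, up to the curvature term. -/
theorem eq_coord (h : IsLagrangeModel X B v s Ω) {x : E} (hx : x ∈ Ω) (ξ : E) :
    ξ = v x (coordP X v x ξ) + adField X v x (coordQ X v x ξ) -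
      (2 : ℝ)⁻¹ • v x (coeffB X v x (coordQ X v x ξ)) := by
  have h1 : v x ((triv X v x).inverse ξ).1 + adField X v x ((triv X v x).inverse ξ).2 = ξ :=
    (h.isInvertible_triv hx).apply_inverse ξ
  conv_lhs => rw [← h1]
  simp only [coordP, map_add, map_smul]
  change _ + adField X v x (coordQ X v x ξ) = _
  abel

theorem coord_unique (h : IsLagrangeModel X B v s Ω) {x : E} (hx : x ∈ Ω) {ξ : E} {p q : N}
    (hξ : ξ = v x p + adField X v x q) :
    coordQ X v x ξ = q ∧ coordP X v x ξ = p + (2 : ℝ)⁻¹ • coeffB X v x q := by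
  have h1 : (triv X v x).inverse ξ = (p, q) := by
    rw [(h.isInvertible_triv hx).inverse_apply_eq, hξ]; rfl
  have h2 : coordQ X v x ξ = q := by rw [coordQ, h1]
  exact ⟨h2, by rw [coordP, h2, h1]⟩

omit [FiniteDimensional ℝ E] [FiniteDimensional ℝ N] in
/-- The derivative along `X` of a pairing of two fields. -/
theorem fderiv_pairing (h : IsLagrangeModel X B v s Ω) {x : E} (hx : x ∈ Ω)
    {V W : E → N →L[ℝ] E} (hV : DifferentiableAt ℝ V x) (hW : DifferentiableAt ℝ W x) (c d : N) :
    fderiv ℝ (fun y => B y (V y c) (W y d)) x (X x) =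
      B x (adField X V x c) (W x d) + B x (V x c) (adField X W x d) := by
  have hB : DifferentiableAt ℝ B x := (h.contDiffAt_form hx).differentiableAt (by simp)
  have h1 := (hB.hasFDerivAt.clm_apply (hV.hasFDerivAt.clm_apply (hasFDerivAt_const c x))).clm_apply
    (hW.hasFDerivAt.clm_apply (hasFDerivAt_const d x))
  rw [h1.fderiv]
  have h2 := h.invariant x hx (V x c) (W x d)
  simp [adField]
  linarith

-- Differentiating the isotropy relation along the field, which preserves the form, moves the
-- bracket from one argument to the other; skew-symmetry then restores the order.
omit [FiniteDimensional ℝ E] [FiniteDimensional ℝ N] in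
theorem gram_symm (h : IsLagrangeModel X B v s Ω) {x : E} (hx : x ∈ Ω) (c d : N) :
    gram X B v x c d = gram X B v x d c := by
  have hv : DifferentiableAt ℝ v x := (h.contDiffAt_frame hx).differentiableAt (by simp)
  have h1 := h.fderiv_pairing hx hv hv c d
  have h2 : (fun y => B y (v y c) (v y d)) =ᶠ[𝓝 x] fun _ => 0 := by
    filter_upwards [h.isOpen.mem_nhds hx] with y hy using h.isotropic y hy c d
  rw [h2.fderiv_eq] at h1
  simp only [fderiv_fun_const, Pi.zero_apply, zero_apply] at h1
  rw [h.skew x hx (v x c)] at h1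
  unfold gram
  linarith

/-- The product rule produces g(b c, d) and the skew term `B (w c) (w d)`. The latter disappears
after averaging over the exchange of `c` and `d`, whence the factor ½. Equivalently, g is parallel
for the derivative along `X` plus ½ b. -/
theorem fderiv_gram (h : IsLagrangeModel X B v s Ω) {x : E} (hx : x ∈ Ω) (c d : N) :
    fderiv ℝ (fun y => gram X B v y c d) x (X x) =
      2⁻¹ * (gram X B v x (coeffB X v x c) d + gram X B v x c (coeffB X v x d)) := by
  have hv : DifferentiableAt ℝ v x := (h.contDiffAt_frame hx).differentiableAt (by simp)
  have hw : DifferentiableAt ℝ (adField X v) x :=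
    (h.contDiffAt_bracket hx).differentiableAt (by simp)
  have h0 : ∀ c d, fderiv ℝ (fun y => gram X B v y c d) x (X x) =
      gram X B v x (coeffB X v x c) d + B x (adField X v x c) (adField X v x d) := fun c d => by
    have h1 := h.fderiv_pairing hx hw hv c d
    rw [h.bracket_bracket_eq hx] at h1
    simp only [add_apply, ContinuousLinearMap.coe_comp, Function.comp_apply, map_add,
      h.isotropic x hx, zero_add] at h1
    exact h1
  have h3 : fderiv ℝ (fun y => gram X B v y c d) x (X x) =
      fderiv ℝ (fun y => gram X B v y d c) x (X x) := by
    have : (fun y => gram X B v y c d) =ᶠ[𝓝 x] fun y => gram X B v y d c := by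
      filter_upwards [h.isOpen.mem_nhds hx] with y hy using h.gram_symm hy c d
    rw [this.fderiv_eq]
  have h4 := h0 c d
  have h5 := h0 d c
  have h6 := h.skew x hx (adField X v x c) (adField X v x d)
  have h7 := h.gram_symm hx (coeffB X v x d) c
  linarith

end IsLagrangeModel

end LagrangeModel

theorem DifferentiableAt.hasDerivAt_along {E F : Type*} [NormedAddCommGroup E] [NormedSpace ℝ E]
    [NormedAddCommGroup F] [NormedSpace ℝ F] {f : E → F} {x : E} (hf : DifferentiableAt ℝ f x)
    (ξ : E) : HasDerivAt (fun t : ℝ => f (x + t • ξ)) (fderiv ℝ f x ξ) 0 := by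
  have h1 : HasDerivAt (fun t : ℝ => x + t • ξ) ξ 0 := by
    simpa using ((hasDerivAt_id (0 : ℝ)).smul_const ξ).const_add x
  have h2 : HasFDerivAt f (fderiv ℝ f x) (x + (0 : ℝ) • ξ) := by simpa using hf.hasFDerivAt
  exact h2.comp_hasDerivAt (0 : ℝ) h1

/-- Positive definite quadratic expressions depending continuously on a parameter are locally
uniformly bounded from below. -/
theorem exists_pos_le_of_pos {E F : Type*} [TopologicalSpace E] [NormedAddCommGroup F]
    [NormedSpace ℝ F] [FiniteDimensional ℝ F] {b : E → F →L[ℝ] F →L[ℝ] ℝ} {x : E}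
    (hb : ContinuousAt b x) (hpos : ∀ c, c ≠ 0 → 0 < b x c c) :
    ∃ δ > 0, ∀ᶠ y in 𝓝 x, ∀ c, δ * ‖c‖ ^ 2 ≤ b y c c := by
  obtain ⟨δ, hδ, hδb⟩ : ∃ δ > 0, ∀ c : F, δ * ‖c‖ ^ 2 ≤ b x c c := by
    rcases (Metric.sphere (0 : F) 1).eq_empty_or_nonempty with he | hne
    · refine ⟨1, one_pos, fun c => ?_⟩
      have hc : c = 0 := by
        by_contra hc
        have : (‖c‖⁻¹ • c) ∈ Metric.sphere (0 : F) 1 := by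
          simp [norm_smul, hc]
        rw [he] at this; exact this
      simp [hc]
    · obtain ⟨c₀, hc₀, hmin⟩ := (isCompact_sphere (0 : F) 1).exists_isMinOn hne
        (f := fun c => b x c c) (by fun_prop)
      have hc₀' : c₀ ≠ 0 := fun h => by simp [h] at hc₀
      refine ⟨b x c₀ c₀, hpos c₀ hc₀', fun c => ?_⟩
      by_cases hc : c = 0
      · simp [hc]
      have hmem : (‖c‖⁻¹ • c) ∈ Metric.sphere (0 : F) 1 := by
        simp [norm_smul, hc]
      have h1 : b x c₀ c₀ ≤ b x (‖c‖⁻¹ • c) (‖c‖⁻¹ • c) := hmin hmem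
      have hn : 0 < ‖c‖ := norm_pos_iff.2 hc
      simp only [map_smul, smul_apply, smul_eq_mul] at h1
      calc b x c₀ c₀ * ‖c‖ ^ 2 ≤ (‖c‖⁻¹ * (‖c‖⁻¹ * b x c c)) * ‖c‖ ^ 2 :=
            mul_le_mul_of_nonneg_right h1 (by positivity)
        _ = b x c c := by field_simp
  -- Half of the bound at `x` is given up to absorb the variation of the form near `x`.
  refine ⟨δ / 2, by linarith, ?_⟩
  have hnear : ∀ᶠ y in 𝓝 x, ‖b y - b x‖ < δ / 2 := by
    filter_upwards [hb.eventually (Metric.ball_mem_nhds (b x) (half_pos hδ))] with y hy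
    have h0 := Metric.mem_ball.1 hy
    exact (dist_eq_norm (b y) (b x)).symm.trans_lt h0
  filter_upwards [hnear] with y hy c
  have h1 : ‖(b y - b x) c c‖ ≤ ‖b y - b x‖ * ‖c‖ * ‖c‖ := (b y - b x).le_opNorm₂ c c
  have h2 : |b y c c - b x c c| ≤ ‖b y - b x‖ * ‖c‖ * ‖c‖ := by simpa using h1
  have h3 := (abs_le.1 h2).1
  have h4 := hδb c
  have h5 : ‖b y - b x‖ * ‖c‖ * ‖c‖ ≤ δ / 2 * ‖c‖ ^ 2 := by
    rw [mul_assoc, pow_two]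
    exact mul_le_mul_of_nonneg_right hy.le (by positivity)
  linarith

/-! ### The bracket in canonical coordinates and the dissipation form. -/

section LagrangeModel

variable {E N : Type*} [NormedAddCommGroup E] [NormedSpace ℝ E] [NormedAddCommGroup N]
  [NormedSpace ℝ N] [FiniteDimensional ℝ E] [FiniteDimensional ℝ N]

namespace IsLagrangeModel

variable {X : E → E} {B : E → E →L[ℝ] E →L[ℝ] ℝ} {v : E → N →L[ℝ] E} {s : ℝ} {Ω : Set E}

/-- The coordinates of the Lie bracket of `X` with a field `Y`. -/
theorem coord_bracket (h : IsLagrangeModel X B v s Ω) {x : E} (hx : x ∈ Ω) {Y : E → E}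
    (hY : ContDiffAt ℝ ∞ Y x) :
    coordQ X v x (fderiv ℝ Y x (X x) - fderiv ℝ X x (Y x)) =
      fderiv ℝ (fun y => coordQ X v y (Y y)) x (X x) + coordP X v x (Y x) +
        (2 : ℝ)⁻¹ • coeffB X v x (coordQ X v x (Y x)) ∧
    coordP X v x (fderiv ℝ Y x (X x) - fderiv ℝ X x (Y x)) =
      fderiv ℝ (fun y => coordP X v y (Y y)) x (X x) +
        (2 : ℝ)⁻¹ • coeffB X v x (coordP X v x (Y x)) -
        curvatureMatrix X v x (coordQ X v x (Y x)) := by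
  have hne : (∞ : WithTop ℕ∞) ≠ 0 := by simp
  have dY := (hY.differentiableAt hne).hasDerivAt_along (X x)
  have dv := ((h.contDiffAt_frame hx).differentiableAt hne).hasDerivAt_along (X x)
  have dw := ((h.contDiffAt_bracket hx).differentiableAt hne).hasDerivAt_along (X x)
  have db := ((h.contDiffAt_coeffB hx).differentiableAt hne).hasDerivAt_along (X x)
  have dq := ((h.contDiffAt_coordQ hx hY).differentiableAt hne).hasDerivAt_along (X x)
  have dp := ((h.contDiffAt_coordP hx hY).differentiableAt hne).hasDerivAt_along (X x)
  have hrhs := ((dv.clm_apply dp).fun_add (dw.clm_apply dq)).fun_sub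
    ((dv.clm_apply (db.clm_apply dq)).fun_const_smul (2 : ℝ)⁻¹)
  have hev : ∀ᶠ t : ℝ in 𝓝 0, x + t • X x ∈ Ω := by
    have hc : ContinuousAt (fun t : ℝ => x + t • X x) 0 := by fun_prop
    exact hc.eventually (by simpa using h.isOpen.mem_nhds hx)
  have heq := dY.unique (hrhs.congr_of_eventuallyEq (by
    filter_upwards [hev] with t ht
    exact h.eq_coord ht _))
  simp only [zero_smul, add_zero] at heq
  have hYx := h.eq_coord hx (Y x)
  have hu := h.bracket_bracket_eq hx
  have hvx : ∀ c, fderiv ℝ v x (X x) c = adField X v x c + fderiv ℝ X x (v x c) := fun c => by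
    simp [adField]
  have hwx : ∀ c, fderiv ℝ (adField X v) x (X x) c =
      v x (coeffA X v x c) + adField X v x (coeffB X v x c) + fderiv ℝ X x (adField X v x c) :=
    fun c => by
      have : adField X (adField X v) x c = v x (coeffA X v x c) +
          adField X v x (coeffB X v x c) := by rw [hu]; rfl
      rw [← this, adField]; simp
  set q := coordQ X v x (Y x)
  set p := coordP X v x (Y x)
  set q' := fderiv ℝ (fun y => coordQ X v y (Y y)) x (X x)
  set p' := fderiv ℝ (fun y => coordP X v y (Y y)) x (X x)
  set b := coeffB X v x
  set a := coeffA X v x with ha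
  set b' := fderiv ℝ (coeffB X v) x (X x) with hb'
  -- Differentiating the decomposition of `Y` makes the terms containing the derivative of `X`
  -- cancel; what remains involves only v, w, a, b and derivatives of the coordinates.
  have key : fderiv ℝ Y x (X x) - fderiv ℝ X x (Y x) =
      v x (p' + a q - (2 : ℝ)⁻¹ • b' q - (2 : ℝ)⁻¹ • b q') +
      adField X v x (q' + p + (2 : ℝ)⁻¹ • b q) := by
    rw [heq, hYx]
    simp only [hvx, hwx, map_add, map_sub, map_smul, smul_add]
    module
  obtain ⟨h1, h2⟩ := h.coord_unique hx key
  refine ⟨h1, ?_⟩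
  rw [h2]
  simp only [curvatureMatrix, ← ha, ← hb', map_add, map_smul, add_apply, sub_apply, neg_apply,
    smul_apply, ContinuousLinearMap.coe_comp, Function.comp_apply]
  change _ = p' + (2 : ℝ)⁻¹ • b p - (-a q + (2 : ℝ)⁻¹ • b' q - (4 : ℝ)⁻¹ • b (b q))
  module

omit [FiniteDimensional ℝ E] [FiniteDimensional ℝ N] in
theorem gram_add_left (x : E) (c c' d : N) :
    gram X B v x (c + c') d = gram X B v x c d + gram X B v x c' d := by simp [gram]

omit [FiniteDimensional ℝ E] [FiniteDimensional ℝ N] in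
theorem gram_add_right (x : E) (c d d' : N) :
    gram X B v x c (d + d') = gram X B v x c d + gram X B v x c d' := by simp [gram]

omit [FiniteDimensional ℝ E] [FiniteDimensional ℝ N] in
theorem gram_sub_right (x : E) (c d d' : N) :
    gram X B v x c (d - d') = gram X B v x c d - gram X B v x c d' := by simp [gram]

omit [FiniteDimensional ℝ E] [FiniteDimensional ℝ N] in
theorem gram_smul_left (x : E) (r : ℝ) (c d : N) :
    gram X B v x (r • c) d = r * gram X B v x c d := by simp [gram]

omit [FiniteDimensional ℝ E] [FiniteDimensional ℝ N] in
theorem gram_smul_right (x : E) (r : ℝ) (c d : N) :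
    gram X B v x c (r • d) = r * gram X B v x c d := by simp [gram]

/-- The derivative along `X` of the Lyapunov quadratic form of a field `Y`. -/
theorem fderiv_lyapunov (h : IsLagrangeModel X B v s Ω) {x : E} (hx : x ∈ Ω) {Y : E → E}
    (hY : ContDiffAt ℝ ∞ Y x) :
    fderiv ℝ (fun y => gram X B v y (coordQ X v y (Y y)) (coordP X v y (Y y))) x (X x) =
      gram X B v x (coordQ X v x (fderiv ℝ Y x (X x) - fderiv ℝ X x (Y x)))
        (coordP X v x (Y x)) +
      gram X B v x (coordQ X v x (Y x))
        (coordP X v x (fderiv ℝ Y x (X x) - fderiv ℝ X x (Y x))) +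
      gram X B v x (coordQ X v x (Y x)) (curvatureMatrix X v x (coordQ X v x (Y x))) -
      gram X B v x (coordP X v x (Y x)) (coordP X v x (Y x)) := by
  have hne : (∞ : WithTop ℕ∞) ≠ 0 := by simp
  have cB := h.contDiffAt_form hx
  have cv := h.contDiffAt_frame hx
  have cw := h.contDiffAt_bracket hx
  have cq := h.contDiffAt_coordQ hx hY
  have cp := h.contDiffAt_coordP hx hY
  have dB := (cB.differentiableAt hne).hasDerivAt_along (X x)
  have dv := (cv.differentiableAt hne).hasDerivAt_along (X x)
  have dw := (cw.differentiableAt hne).hasDerivAt_along (X x)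
  have dq := (cq.differentiableAt hne).hasDerivAt_along (X x)
  have dp := (cp.differentiableAt hne).hasDerivAt_along (X x)
  have cgram : ContDiffAt ℝ ∞
      (fun y => gram X B v y (coordQ X v y (Y y)) (coordP X v y (Y y))) x :=
    (cB.clm_apply (cw.clm_apply cq)).clm_apply (cv.clm_apply cp)
  have d1 := (cgram.differentiableAt hne).hasDerivAt_along (X x)
  have d2 := (dB.clm_apply (dw.clm_apply dq)).clm_apply (dv.clm_apply dp)
  have e1 := d1.unique d2
  set q := coordQ X v x (Y x) with hq
  set p := coordP X v x (Y x) with hp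
  -- With the arguments frozen at their values at `x`, `fderiv_gram` applies. Comparison with the
  -- full product rule isolates the derivatives of the coordinates; all terms with b then cancel and
  -- only ρ and g(p, p) survive.
  have cgram0 : ContDiffAt ℝ ∞ (fun y => gram X B v y q p) x :=
    (cB.clm_apply (cw.clm_apply contDiffAt_const)).clm_apply (cv.clm_apply contDiffAt_const)
  have d3 := (cgram0.differentiableAt hne).hasDerivAt_along (X x)
  have d4 := (dB.clm_apply (dw.clm_apply (hasDerivAt_const _ q))).clm_apply
    (dv.clm_apply (hasDerivAt_const _ p))
  have e2 := d3.unique d4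
  rw [h.fderiv_gram hx] at e2
  obtain ⟨c1, c2⟩ := h.coord_bracket hx hY
  rw [e1, c1, c2, gram_add_left, gram_add_left, gram_sub_right, gram_add_right, gram_smul_left,
    gram_smul_right]
  simp only [zero_smul, add_zero, map_zero, map_add, add_apply] at e2 ⊢
  simp only [← hq, ← hp]
  simp only [gram] at e2 ⊢
  linarith

/-- The matrix of the form `g`, as a continuous bilinear form. -/
noncomputable def gramL (X : E → E) (B : E → E →L[ℝ] E →L[ℝ] ℝ) (v : E → N →L[ℝ] E) (x : E) :
    N →L[ℝ] N →L[ℝ] ℝ :=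
  ((ContinuousLinearMap.compL ℝ N E ℝ).flip (v x)).comp ((B x).comp (adField X v x))

omit [FiniteDimensional ℝ E] [FiniteDimensional ℝ N] in
theorem contDiffAt_gramL (h : IsLagrangeModel X B v s Ω) {x : E} (hx : x ∈ Ω) :
    ContDiffAt ℝ ∞ (gramL X B v) x := by
  have h1 : ContDiffAt ℝ ∞ (fun y => (ContinuousLinearMap.compL ℝ N E ℝ).flip (v y)) x :=
    contDiffAt_const.clm_apply (h.contDiffAt_frame hx)
  have h2 : ContDiffAt ℝ ∞ (fun y => (B y).comp (adField X v y)) x :=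
    (h.contDiffAt_form hx).clm_comp (h.contDiffAt_bracket hx)
  exact h1.clm_comp h2

/-- Minus the derivative of the Lyapunov quadratic form, as a bilinear form in the coordinates. -/
noncomputable def dissipation (X : E → E) (B : E → E →L[ℝ] E →L[ℝ] ℝ) (v : E → N →L[ℝ] E) (s : ℝ)
    (x : E) : N × N →L[ℝ] N × N →L[ℝ] ℝ :=
  s • (((ContinuousLinearMap.compL ℝ (N × N) N ℝ).flip (ContinuousLinearMap.fst ℝ N N)).comp
      ((gramL X B v x).comp (ContinuousLinearMap.fst ℝ N N)) -
    ((ContinuousLinearMap.compL ℝ (N × N) N ℝ).flip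
        ((curvatureMatrix X v x).comp (ContinuousLinearMap.snd ℝ N N))).comp
      ((gramL X B v x).comp (ContinuousLinearMap.snd ℝ N N)))

omit [FiniteDimensional ℝ E] [FiniteDimensional ℝ N] in
theorem dissipation_apply (x : E) (c d : N × N) : dissipation X B v s x c d =
    s * (gram X B v x c.1 d.1 - gram X B v x c.2 (curvatureMatrix X v x d.2)) := rfl

theorem contDiffAt_dissipation (h : IsLagrangeModel X B v s Ω) {x : E} (hx : x ∈ Ω) :
    ContDiffAt ℝ ∞ (dissipation X B v s) x := by
  have hg := h.contDiffAt_gramL hx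
  have hc := h.contDiffAt_curvatureMatrix hx
  have h1 : ContDiffAt ℝ ∞ (fun y => ((ContinuousLinearMap.compL ℝ (N × N) N ℝ).flip
      (ContinuousLinearMap.fst ℝ N N)).comp
      ((gramL X B v y).comp (ContinuousLinearMap.fst ℝ N N))) x :=
    contDiffAt_const.clm_comp (hg.clm_comp contDiffAt_const)
  have h2 : ContDiffAt ℝ ∞ (fun y => (ContinuousLinearMap.compL ℝ (N × N) N ℝ).flip
        ((curvatureMatrix X v y).comp (ContinuousLinearMap.snd ℝ N N))) x :=
    contDiffAt_const.clm_apply (hc.clm_comp contDiffAt_const)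
  have h3 : ContDiffAt ℝ ∞ (fun y => ((ContinuousLinearMap.compL ℝ (N × N) N ℝ).flip
        ((curvatureMatrix X v y).comp (ContinuousLinearMap.snd ℝ N N))).comp
      ((gramL X B v y).comp (ContinuousLinearMap.snd ℝ N N))) x :=
    h2.clm_comp (hg.clm_comp contDiffAt_const)
  exact (h1.sub h3).const_smul s

omit [FiniteDimensional ℝ E] [FiniteDimensional ℝ N] in
theorem dissipation_pos (h : IsLagrangeModel X B v s Ω) {x : E} (hx : x ∈ Ω)
    (hneg : ∀ c, c ≠ 0 → s * gram X B v x (curvatureMatrix X v x c) c < 0) (c : N × N)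
    (hc : c ≠ 0) : 0 < dissipation X B v s x c c := by
  rw [dissipation_apply, mul_sub]
  have h1 : 0 ≤ s * gram X B v x c.1 c.1 := by
    by_cases hc1 : c.1 = 0
    · simp [hc1, gram]
    · exact (h.definite x hx _ hc1).le
  have h2 : s * gram X B v x c.2 (curvatureMatrix X v x c.2) ≤ 0 := by
    by_cases hc2 : c.2 = 0
    · simp [hc2, gram]
    · rw [h.gram_symm hx]; exact (hneg _ hc2).le
  by_cases hc1 : c.1 = 0
  · have hc2 : c.2 ≠ 0 := fun h2 => hc (Prod.ext hc1 h2)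
    have := hneg _ hc2
    rw [h.gram_symm hx] at this
    linarith
  · have : 0 < s * gram X B v x c.1 c.1 := h.definite x hx _ hc1
    linarith

end IsLagrangeModel

end LagrangeModel

/-! ### Imaginary eigenvalues in real terms. -/

section Complexification

open TensorProduct

theorem exists_eq_one_tmul_add_I_tmul {E : Type*} [AddCommGroup E] [Module ℝ E]
    (z : ℂ ⊗[ℝ] E) : ∃ a b : E, z = (1 : ℂ) ⊗ₜ[ℝ] a + Complex.I ⊗ₜ[ℝ] b := by
  induction z with
  | zero => exact ⟨0, 0, by simp⟩
  | tmul c ξ =>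
    refine ⟨c.re • ξ, c.im • ξ, ?_⟩
    rw [← TensorProduct.smul_tmul, ← TensorProduct.smul_tmul, ← TensorProduct.add_tmul]
    congr 1
    apply Complex.ext <;> simp
  | add z w hz hw =>
    obtain ⟨a, b, rfl⟩ := hz
    obtain ⟨c, d, rfl⟩ := hw
    exact ⟨a + c, b + d, by simp only [TensorProduct.tmul_add]; abel⟩

theorem one_tmul_add_I_tmul_inj {E : Type*} [AddCommGroup E] [Module ℝ E] {a b c d : E}
    (h : (1 : ℂ) ⊗ₜ[ℝ] a + Complex.I ⊗ₜ[ℝ] b = (1 : ℂ) ⊗ₜ[ℝ] c + Complex.I ⊗ₜ[ℝ] d) :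
    a = c ∧ b = d := by
  constructor
  · have := congrArg (fun z => TensorProduct.lid ℝ E (LinearMap.rTensor E Complex.reLm z)) h
    simpa using this
  · have := congrArg (fun z => TensorProduct.lid ℝ E (LinearMap.rTensor E Complex.imLm z)) h
    simpa using this

/-- Hyperbolicity in terms of the real and imaginary parts of an eigenvector. -/
theorem isHyperbolic_of_forall {E : Type*} [NormedAddCommGroup E] [NormedSpace ℝ E] {A : E →L[ℝ] E}
    (hA : ∀ (r : ℝ) (a b : E), A a = -(r • b) → A b = r • a → a = 0 ∧ b = 0) :
    IsHyperbolic A := by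
  intro μ hμ hre
  obtain ⟨z, hz⟩ := hμ.exists_hasEigenvector
  obtain ⟨a, b, rfl⟩ := exists_eq_one_tmul_add_I_tmul z
  have h1 := hz.apply_eq_smul
  have hμI : μ = (μ.im : ℂ) * Complex.I := by apply Complex.ext <;> simp [hre]
  have h2 : μ • ((1 : ℂ) ⊗ₜ[ℝ] a + Complex.I ⊗ₜ[ℝ] b) =
      (1 : ℂ) ⊗ₜ[ℝ] (-(μ.im • b)) + Complex.I ⊗ₜ[ℝ] (μ.im • a) := by
    rw [smul_add, TensorProduct.smul_tmul', TensorProduct.smul_tmul', ← neg_smul,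
      ← TensorProduct.smul_tmul, ← TensorProduct.smul_tmul, add_comm]
    congr 1
    · congr 1
      conv_lhs => rw [hμI]
      apply Complex.ext <;> simp
    · congr 1
      conv_lhs => rw [hμI]
      apply Complex.ext <;> simp
  rw [h2] at h1
  simp only [map_add, LinearMap.baseChange_tmul, ContinuousLinearMap.coe_coe] at h1
  obtain ⟨h3, h4⟩ := one_tmul_add_I_tmul_inj h1
  obtain ⟨ha, hb⟩ := hA μ.im a b h3 h4
  exact hz.2 (by simp [ha, hb])

end Complexification

theorem eventually_eq_of_hasDerivAt_zero {f : ℝ → ℝ} {r : ℝ}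
    (hf : ∀ t ∈ Metric.ball (0 : ℝ) r, HasDerivAt f 0 t) :
    ∀ t ∈ Metric.ball (0 : ℝ) r, f t = f 0 := by
  intro t ht
  have hr : 0 < r := dist_nonneg.trans_lt ht
  exact Metric.isOpen_ball.is_const_of_deriv_eq_zero
    (convex_ball (0 : ℝ) r).isPreconnected
    (fun s hs => (hf s hs).differentiableAt.differentiableWithinAt)
    (fun s hs => (hf s hs).deriv) ht (Metric.mem_ball_self hr)

/-! ### Estimates for the Lyapunov function and hyperbolicity of equilibria. -/

section LagrangeModel

variable {E N : Type*} [NormedAddCommGroup E] [NormedSpace ℝ E] [NormedAddCommGroup N]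
  [NormedSpace ℝ N] [FiniteDimensional ℝ E] [FiniteDimensional ℝ N]

namespace IsLagrangeModel

variable {X : E → E} {B : E → E →L[ℝ] E →L[ℝ] ℝ} {v : E → N →L[ℝ] E} {s : ℝ} {Ω : Set E}

/-- The Lyapunov function of the field `X`. -/
noncomputable def lyapunov (X : E → E) (B : E → E →L[ℝ] E →L[ℝ] ℝ) (v : E → N →L[ℝ] E) (y : E) :
    ℝ :=
  gram X B v y (coordQ X v y (X y)) (coordP X v y (X y))

theorem contDiffAt_lyapunov (h : IsLagrangeModel X B v s Ω) {x : E} (hx : x ∈ Ω) :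
    ContDiffAt ℝ ∞ (lyapunov X B v) x :=
  ((h.contDiffAt_form hx).clm_apply ((h.contDiffAt_bracket hx).clm_apply
    (h.contDiffAt_coordQ hx (h.contDiffAt_field hx)))).clm_apply
    ((h.contDiffAt_frame hx).clm_apply (h.contDiffAt_coordP hx (h.contDiffAt_field hx)))

/-- The pair of components of a vector. -/
noncomputable def coord (X : E → E) (v : E → N →L[ℝ] E) (x ξ : E) : N × N :=
  (coordP X v x ξ, coordQ X v x ξ)

omit [FiniteDimensional ℝ E] [FiniteDimensional ℝ N] in
theorem sign_mul_self (h : IsLagrangeModel X B v s Ω) : s * s = 1 := by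
  rcases h.sign_eq with h | h <;> rw [h] <;> norm_num

/-- For the field itself both bracket terms vanish, since [X, X] = 0, and only the dissipation is
left. -/
theorem fderiv_lyapunov_field (h : IsLagrangeModel X B v s Ω) {x : E} (hx : x ∈ Ω) :
    s * fderiv ℝ (lyapunov X B v) x (X x) =
      -dissipation X B v s x (coord X v x (X x)) (coord X v x (X x)) := by
  have h1 := h.fderiv_lyapunov hx (h.contDiffAt_field hx)
  have hQ : coordQ X v x 0 = 0 := by simp [coordQ]
  have hP : coordP X v x 0 = 0 := by simp [coordP, hQ]
  have hg : ∀ d, gram X B v x 0 d = 0 := fun d => by simp [gram]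
  have hg' : ∀ d, gram X B v x d 0 = 0 := fun d => by simp [gram]
  rw [sub_self, hQ, hP, hg, hg', zero_add, zero_add] at h1
  change fderiv ℝ (lyapunov X B v) x (X x) = _ at h1
  rw [h1, dissipation_apply, coord]
  ring

/-- The coordinate map and its inverse are linear with norms continuous in the base point, hence
locally bounded. This translates definiteness in (p, q) into bounds by the speed. -/
theorem norm_coord_le (h : IsLagrangeModel X B v s Ω) {x : E} (hx : x ∈ Ω) :
    ∃ C > 0, ∀ᶠ y in 𝓝 x, ∀ ξ, ‖coord X v y ξ‖ ≤ C * ‖ξ‖ ∧ ‖ξ‖ ≤ C * ‖coord X v y ξ‖ := by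
  let L : E → E →L[ℝ] N × N := fun y =>
    ((ContinuousLinearMap.fst ℝ N N).comp (triv X v y).inverse + (2 : ℝ)⁻¹ •
      (coeffB X v y).comp ((ContinuousLinearMap.snd ℝ N N).comp (triv X v y).inverse)).prod
    ((ContinuousLinearMap.snd ℝ N N).comp (triv X v y).inverse)
  let K : E → N × N →L[ℝ] E := fun y =>
    (v y).coprod (adField X v y - (2 : ℝ)⁻¹ • (v y).comp (coeffB X v y))
  have hL : ∀ y ξ, L y ξ = coord X v y ξ := fun y ξ => rfl
  have hK : ∀ᶠ y in 𝓝 x, ∀ ξ, K y (coord X v y ξ) = ξ := by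
    filter_upwards [h.isOpen.mem_nhds hx] with y hy ξ
    conv_rhs => rw [h.eq_coord hy ξ]
    simp only [K, coord, ContinuousLinearMap.coprod_apply, sub_apply, smul_apply,
      ContinuousLinearMap.coe_comp, Function.comp_apply]
    abel
  have ci := (h.contDiffAt_inverse_triv hx).continuousAt
  have cb := (h.contDiffAt_coeffB hx).continuousAt
  have cv := (h.contDiffAt_frame hx).continuousAt
  have cw := (h.contDiffAt_bracket hx).continuousAt
  have cs : ContinuousAt (fun y => (ContinuousLinearMap.snd ℝ N N).comp (triv X v y).inverse) x :=
    continuousAt_const.clm_comp ci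
  have cf : ContinuousAt (fun y => (ContinuousLinearMap.fst ℝ N N).comp (triv X v y).inverse) x :=
    continuousAt_const.clm_comp ci
  have cL : ContinuousAt (fun y => ‖L y‖) x := by
    have e : L = fun y => (ContinuousLinearMap.inl ℝ N N).comp
        ((ContinuousLinearMap.fst ℝ N N).comp (triv X v y).inverse + (2 : ℝ)⁻¹ •
      (coeffB X v y).comp ((ContinuousLinearMap.snd ℝ N N).comp (triv X v y).inverse)) +
      (ContinuousLinearMap.inr ℝ N N).comp
        ((ContinuousLinearMap.snd ℝ N N).comp (triv X v y).inverse) := by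
      ext y ξ <;> simp [L]
    rw [e]
    exact ((continuousAt_const.clm_comp (cf.add ((cb.clm_comp cs).const_smul (2 : ℝ)⁻¹))).add
      (continuousAt_const.clm_comp cs)).norm
  have cK : ContinuousAt (fun y => ‖K y‖) x := by
    have e : K = fun y => (v y).comp (ContinuousLinearMap.fst ℝ N N) +
        (adField X v y - (2 : ℝ)⁻¹ • (v y).comp (coeffB X v y)).comp
          (ContinuousLinearMap.snd ℝ N N) := by
      ext y ξ <;> simp [K]
    rw [e]
    exact ((cv.clm_comp continuousAt_const).add
      ((cw.sub ((cv.clm_comp cb).const_smul (2 : ℝ)⁻¹)).clm_comp continuousAt_const)).norm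
  refine ⟨‖L x‖ + ‖K x‖ + 1, by positivity, ?_⟩
  filter_upwards [hK, cL.eventually_lt continuousAt_const (lt_add_one _),
    cK.eventually_lt continuousAt_const (lt_add_one _)] with y hKy h1 h2 ξ
  constructor
  · rw [← hL]
    refine ((L y).le_opNorm ξ).trans (mul_le_mul_of_nonneg_right ?_ (norm_nonneg _))
    have := norm_nonneg (K x); linarith
  · conv_lhs => rw [← hKy ξ]
    refine ((K y).le_opNorm _).trans (mul_le_mul_of_nonneg_right ?_ (norm_nonneg _))
    have := norm_nonneg (L x); linarith

/-- Near a point of negative curvature the Lyapunov function is dominated by the square of the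
velocity, which in turn is dominated by its rate of decrease. -/
theorem exists_lyapunov_estimate (h : IsLagrangeModel X B v s Ω) {x : E} (hx : x ∈ Ω)
    (hneg : ∀ c, c ≠ 0 → s * gram X B v x (curvatureMatrix X v x c) c < 0) :
    ∃ c > 0, ∃ C > 0, ∀ᶠ y in 𝓝 x, |s * lyapunov X B v y| ≤ C * ‖X y‖ ^ 2 ∧
      s * fderiv ℝ (lyapunov X B v) y (X y) ≤ -(c * ‖X y‖ ^ 2) := by
  obtain ⟨C, hC, hCb⟩ := h.norm_coord_le hx
  obtain ⟨δ, hδ, hδb⟩ := exists_pos_le_of_pos (h.contDiffAt_dissipation hx).continuousAt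
    (h.dissipation_pos hx hneg)
  have cg : ContinuousAt (fun y => ‖gramL X B v y‖) x :=
    (continuous_norm (E := N →L[ℝ] N →L[ℝ] ℝ)).continuousAt.comp
      (h.contDiffAt_gramL hx).continuousAt
  refine ⟨δ / C ^ 2, by positivity, (‖gramL X B v x‖ + 1) * C ^ 2, by positivity, ?_⟩
  filter_upwards [hCb, hδb, h.isOpen.mem_nhds hx,
    cg.eventually_lt continuousAt_const (lt_add_one _)] with y h1 h2 h3 h4
  obtain ⟨h5, h6⟩ := h1 (X y)
  constructor
  · have hs : |s| = 1 := by rcases h.sign_eq with h | h <;> simp [h]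
    rw [abs_mul, hs, one_mul]
    have h7 : |lyapunov X B v y| ≤ ‖gramL X B v y‖ * ‖coordQ X v y (X y)‖ *
        ‖coordP X v y (X y)‖ := (gramL X B v y).le_opNorm₂ _ _
    have hq : ‖coordQ X v y (X y)‖ ≤ C * ‖X y‖ := (norm_snd_le (coord X v y (X y))).trans h5
    have hp : ‖coordP X v y (X y)‖ ≤ C * ‖X y‖ := (norm_fst_le (coord X v y (X y))).trans h5
    calc |lyapunov X B v y| ≤ _ := h7
      _ ≤ (‖gramL X B v x‖ + 1) * (C * ‖X y‖) * (C * ‖X y‖) := by gcongr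
      _ = _ := by ring
  · rw [h.fderiv_lyapunov_field h3]
    have h7 := h2 (coord X v y (X y))
    have h8 : ‖X y‖ ^ 2 ≤ C ^ 2 * ‖coord X v y (X y)‖ ^ 2 := by
      rw [← mul_pow]; gcongr
    have h9 : δ / C ^ 2 * ‖X y‖ ^ 2 ≤ δ / C ^ 2 * (C ^ 2 * ‖coord X v y (X y)‖ ^ 2) := by gcongr
    have h10 : δ / C ^ 2 * (C ^ 2 * ‖coord X v y (X y)‖ ^ 2) = δ * ‖coord X v y (X y)‖ ^ 2 := by
      field_simp
    linarith

/-- At an equilibrium of negative curvature the linearization is hyperbolic. -/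
theorem isHyperbolic_fderiv (h : IsLagrangeModel X B v s Ω) {x : E} (hx : x ∈ Ω)
    (hneg : ∀ c, c ≠ 0 → s * gram X B v x (curvatureMatrix X v x c) c < 0) (hX : X x = 0) :
    IsHyperbolic (fderiv ℝ X x) := by
  let b : E → E → ℝ := fun ξ η => gram X B v x (coordQ X v x ξ) (coordP X v x η) +
    gram X B v x (coordQ X v x η) (coordP X v x ξ)
  have hQs : ∀ (r : ℝ) ξ, coordQ X v x (r • ξ) = r • coordQ X v x ξ := fun r ξ => by simp [coordQ]
  have hPs : ∀ (r : ℝ) ξ, coordP X v x (r • ξ) = r • coordP X v x ξ := fun r ξ => by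
    simp [coordP, hQs, smul_comm r]
  have hbs : ∀ (r : ℝ) ξ η, b ξ (r • η) = r * b ξ η := fun r ξ η => by
    simp only [b, hQs, hPs, gram_smul_left, gram_smul_right]; ring
  -- For the constant field `ξ` at a zero of `X` the derivative along `X` is zero and the bracket is
  -- minus the linearization applied to `ξ`, so the Lie derivative formula becomes a Lyapunov
  -- identity.
  have hb : ∀ ξ, b ξ (fderiv ℝ X x ξ) =
      -(s * dissipation X B v s x (coord X v x ξ) (coord X v x ξ)) := fun ξ => by
    have h1 := h.fderiv_lyapunov hx (Y := fun _ => ξ) contDiffAt_const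
    rw [hX, map_zero] at h1
    simp only [map_zero, zero_sub] at h1
    rw [← neg_one_smul ℝ (fderiv ℝ X x ξ), hQs, hPs, gram_smul_left, gram_smul_right] at h1
    rw [dissipation_apply, ← mul_assoc, h.sign_mul_self]
    simp only [b, coord]
    linarith
  have hpos : ∀ ξ, 0 ≤ dissipation X B v s x (coord X v x ξ) (coord X v x ξ) ∧
      (dissipation X B v s x (coord X v x ξ) (coord X v x ξ) = 0 → ξ = 0) := fun ξ => by
    by_cases hc : coord X v x ξ = 0
    · refine ⟨by simp [hc], fun _ => ?_⟩
      obtain ⟨C, -, hC⟩ := h.norm_coord_le hx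
      have := (hC.self_of_nhds ξ).2
      rw [hc, norm_zero, mul_zero] at this
      exact norm_le_zero_iff.1 this
    · have := h.dissipation_pos hx hneg _ hc
      exact ⟨this.le, fun h0 => absurd h0 this.ne'⟩
  refine isHyperbolic_of_forall fun r ξ η h1 h2 => ?_
  have e1 := hb ξ
  have e2 := hb η
  rw [h1, ← neg_smul, hbs] at e1
  rw [h2, hbs] at e2
  have hsymm : b ξ η = b η ξ := add_comm _ _
  have hs : s ≠ 0 := fun h0 => by have := h.sign_mul_self; rw [h0] at this; simp at this
  -- The two identities have the left sides −r b(ξ, η) and r b(η, ξ), whose sum vanishes because b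
  -- is symmetric.
  have e3 : s * (dissipation X B v s x (coord X v x ξ) (coord X v x ξ) +
      dissipation X B v s x (coord X v x η) (coord X v x η)) = 0 := by
    rw [hsymm] at e1; linarith
  have e4 := (mul_eq_zero.1 e3).resolve_left hs
  have p1 := (hpos ξ).1
  have p2 := (hpos η).1
  exact ⟨(hpos ξ).2 (by linarith), (hpos η).2 (by linarith)⟩

end IsLagrangeModel

end LagrangeModel

/-! ### The form g computed from an arbitrary section. -/

section Pairing

variable {E N : Type*} [NormedAddCommGroup E] [NormedSpace ℝ E] [NormedAddCommGroup N]
  [NormedSpace ℝ N]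

/-- The form `B([X, Y], v)` for a section `Y` of the isotropic distribution spanned by `v`. -/
theorem bracket_pairing_eq {X : E → E} {B : E → E →L[ℝ] E →L[ℝ] ℝ} {v : E → N →L[ℝ] E} {x : E}
    (hB : DifferentiableAt ℝ B x) (hv : DifferentiableAt ℝ v x) {Y : E → E}
    (hY : DifferentiableAt ℝ Y x) (skew : ∀ ξ η, B x ξ η = -B x η ξ)
    (invariant : ∀ ξ η, fderiv ℝ B x (X x) ξ η + B x (fderiv ℝ X x ξ) η +
      B x ξ (fderiv ℝ X x η) = 0)
    (isotropic : ∀ᶠ z in 𝓝 x, ∀ c d, B z (v z c) (v z d) = 0)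
    (hYv : ∀ᶠ z in 𝓝 x, Y z ∈ (v z).range) (d : N) :
    B x (fderiv ℝ Y x (X x) - fderiv ℝ X x (Y x)) (v x d) = B x (adField X v x d) (Y x) := by
  have h1 := ((hB.hasFDerivAt.clm_apply hY.hasFDerivAt).clm_apply
    (hv.hasFDerivAt.clm_apply (hasFDerivAt_const d x))).fderiv
  -- Isotropy makes this pairing vanish identically. Its derivative along the invariant field moves
  -- the bracket from `Y` to `v`, so `Y` need not be expanded with smooth coefficients.
  have h2 : (fun z => B z (Y z) (v z d)) =ᶠ[𝓝 x] fun _ => 0 := by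
    filter_upwards [isotropic, hYv] with z hz hYz
    obtain ⟨c, hc⟩ := hYz
    have hc' : v z c = Y z := hc
    rw [← hc', hz]
  rw [h2.fderiv_eq] at h1
  have h3 := DFunLike.congr_fun h1 (X x)
  have h4 := invariant (Y x) (v x d)
  have h5 := skew (adField X v x d) (Y x)
  rw [h5]
  simp only [adField, sub_apply, ContinuousLinearMap.coe_comp, Function.comp_apply, map_sub]
  simp at h3
  linarith

end Pairing

/-! ### Jacobi curves of a local model: isotropy, curvature and adapted sections. -/

section ModelCurve

variable {E N V : Type*} [NormedAddCommGroup E] [NormedSpace ℝ E] [NormedAddCommGroup N]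
  [NormedSpace ℝ N] [FiniteDimensional ℝ E] [FiniteDimensional ℝ N]
  [NormedAddCommGroup V] [NormedSpace ℝ V]

/-- A curve of subspaces of `V` obtained from the distribution spanned by `v` by pulling it back
along an integral curve of `X` and applying the linear isomorphism `S`. -/
structure IsModelCurve (X : E → E) (v : E → N →L[ℝ] E) (x : E) (β : V →L[ℝ] V →L[ℝ] ℝ)
    (B : E → E →L[ℝ] E →L[ℝ] ℝ) (S : E →L[ℝ] V) (J : ℝ → Submodule ℝ V) (y : ℝ → E)
    (A A' : ℝ → E →L[ℝ] E) : Prop where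
  pair : IsVariationalPair X y A'
  curve_zero : y 0 = x
  fundamental_zero : A 0 = 1
  inverse_zero : A' 0 = 1
  hasDerivAt_fundamental : ∀ᶠ t in 𝓝 0, HasDerivAt A ((fderiv ℝ X (y t)).comp (A t)) t
  mul_inverse : ∀ᶠ t in 𝓝 0, (A t).comp (A' t) = 1
  isInvertible : S.IsInvertible
  form_eq : ∀ ξ η, β (S ξ) (S η) = B x ξ η
  eventually_range : ∀ᶠ t in 𝓝 0, J t = (S.comp (transport A' y v t)).range

namespace IsModelCurve

open IsLagrangeModel

variable {X : E → E} {B : E → E →L[ℝ] E →L[ℝ] ℝ} {v : E → N →L[ℝ] E} {s : ℝ} {Ω : Set E}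
  {x : E} {β : V →L[ℝ] V →L[ℝ] ℝ} {S : E →L[ℝ] V} {J : ℝ → Submodule ℝ V} {y : ℝ → E}
  {A A' : ℝ → E →L[ℝ] E}

/-- The frame of the curve of subspaces. -/
noncomputable def frame (v : E → N →L[ℝ] E) (S : E →L[ℝ] V) (y : ℝ → E) (A' : ℝ → E →L[ℝ] E)
    (t : ℝ) : N →L[ℝ] V := S.comp (transport A' y v t)

omit [FiniteDimensional ℝ E] [FiniteDimensional ℝ N] in
theorem contDiffAt_frame (m : IsModelCurve X v x β B S J y A A') (hX : ContDiffAt ℝ ∞ X x)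
    {W : E → N →L[ℝ] E} (hW : ContDiffAt ℝ ∞ W x) : ContDiffAt ℝ ∞ (frame W S y A') 0 :=
  contDiffAt_const.clm_comp
    (m.pair.contDiffAt_transport (by rwa [m.curve_zero]) (by rwa [m.curve_zero]))

omit [FiniteDimensional ℝ E] [FiniteDimensional ℝ N] in
theorem frame_zero (m : IsModelCurve X v x β B S J y A A') (W : E → N →L[ℝ] E) :
    frame W S y A' 0 = S.comp (W x) := by
  simp only [frame, transport, m.curve_zero, m.inverse_zero]; rfl

omit [FiniteDimensional ℝ E] [FiniteDimensional ℝ N] in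
theorem deriv_frame (m : IsModelCurve X v x β B S J y A A')
    {W : E → N →L[ℝ] E} (hW : ContDiffAt ℝ ∞ W x) :
    deriv (frame W S y A') =ᶠ[𝓝 0] frame (adField X W) S y A' := by
  filter_upwards [m.pair.hasDerivAt_transport (V := W)
    (by rw [m.curve_zero]; exact hW.eventually_differentiableAt)] with t ht
  exact ((hasDerivAt_const t S).clm_comp ht).deriv.trans (by simp [frame])

-- The fundamental solution carries the form at `x` to the form at `y t`, since the field preserves
-- it. Pulling the fibers back therefore keeps them isotropic.
omit [FiniteDimensional ℝ E] [FiniteDimensional ℝ N] in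
theorem isIsotropicCurve (m : IsModelCurve X v x β B S J y A A')
    (h : IsLagrangeModel X B v s Ω) (hx : x ∈ Ω) : IsIsotropicCurve β J := by
  have hΩ : ∀ᶠ t in 𝓝 (0 : ℝ), y t ∈ Ω :=
    m.pair.continuousAt.eventually (by rw [m.curve_zero]; exact h.isOpen.mem_nhds hx)
  obtain ⟨r, hr, hball⟩ := Metric.eventually_nhds_iff_ball.1
    (hΩ.and (m.pair.hasDerivAt_curve.and m.hasDerivAt_fundamental))
  have hconst : ∀ ξ η, ∀ t ∈ Metric.ball (0 : ℝ) r, B (y t) (A t ξ) (A t η) = B x ξ η := by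
    intro ξ η t ht
    have h1 := eventually_eq_of_hasDerivAt_zero (f := fun t => B (y t) (A t ξ) (A t η)) (r := r)
      (fun t ht => by
        obtain ⟨h1, h2, h3⟩ := hball t ht
        have dB := ((h.contDiffAt_form h1).differentiableAt (by simp)).hasFDerivAt.comp_hasDerivAt
          t h2
        have d1 := (dB.clm_apply (h3.clm_apply (hasDerivAt_const t ξ))).clm_apply
          (h3.clm_apply (hasDerivAt_const t η))
        have h4 := h.invariant _ h1 (A t ξ) (A t η)
        refine d1.congr_deriv ?_
        simp only [map_zero, add_zero, add_apply, Function.comp_apply,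
          ContinuousLinearMap.coe_comp]
        exact h4) t ht
    rw [h1, m.curve_zero, m.fundamental_zero]; rfl
  filter_upwards [m.eventually_range, m.mul_inverse, Metric.ball_mem_nhds (0 : ℝ) hr]
    with t hJ hA ht ξ hξ η hη
  rw [hJ] at hξ hη
  obtain ⟨c, rfl⟩ := hξ
  obtain ⟨d, rfl⟩ := hη
  have hA' : ∀ ζ, A t (A' t ζ) = ζ := fun ζ => DFunLike.congr_fun hA ζ
  change β (S (A' t (v (y t) c))) (S (A' t (v (y t) d))) = 0
  rw [m.form_eq, ← hconst _ _ t ht, hA', hA']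
  exact h.isotropic _ (hball t ht).1 c d

theorem isJacobiFrame (m : IsModelCurve X v x β B S J y A A')
    (h : IsLagrangeModel X B v s Ω) (hx : x ∈ Ω) : IsJacobiFrame J (frame v S y A') where
  contDiffAt := m.contDiffAt_frame (h.contDiffAt_field hx) (h.contDiffAt_frame hx)
  eventually_range := m.eventually_range
  isInvertible := by
    rw [(m.deriv_frame (h.contDiffAt_frame hx)).self_of_nhds, m.frame_zero, m.frame_zero]
    have : (S.comp (v x)).coprod (S.comp (adField X v x)) = S.comp (triv X v x) := by
      ext z <;> simp [triv]
    rw [this]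
    exact m.isInvertible.comp (h.isInvertible_triv hx)

/-- The expansion of the mixed derivative of the projectors in terms of the curvature matrix. -/
theorem isBigO_mixedDeriv (m : IsModelCurve X v x β B S J y A A')
    (h : IsLagrangeModel X B v s Ω) (hx : x ∈ Ω) (c : N) :
    (fun t => deriv (fun s => deriv (fun τ => projector (J τ) (J s) (S (v x c))) 0) t -
      ((t ^ 2)⁻¹ • S (v x c) + (3 : ℝ)⁻¹ • S (v x (curvatureMatrix X v x c))))
      =O[𝓝[≠] 0] fun t : ℝ => t := by
  have cv := h.contDiffAt_frame hx
  have cw := h.contDiffAt_bracket hx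
  have cu := h.contDiffAt_bracket_bracket hx
  have d1 := m.deriv_frame cv
  have d2 := d1.deriv.trans (m.deriv_frame cw)
  have d3 := d2.deriv.trans (m.deriv_frame cu)
  set a := coeffA X v x with ha
  set b := coeffB X v x with hb
  set a' := fderiv ℝ (coeffA X v) x (X x) with ha'
  set b' := fderiv ℝ (coeffB X v) x (X x) with hb'
  have hu := h.bracket_bracket_eq hx
  have hne : (∞ : WithTop ℕ∞) ≠ 0 := by simp
  -- The bracket of `X` with the structure equation [X, w] = v a + w b, in which a and b are
  -- differentiated along `X` and [X, w] is substituted once more.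
  have hadu : adField X (adField X (adField X v)) x =
      (v x).comp (a' + a.comp b) + (adField X v x).comp (a + b.comp b + b') := by
    have dv := (cv.differentiableAt hne).hasFDerivAt
    have dw := (cw.differentiableAt hne).hasFDerivAt
    have da := ((h.contDiffAt_coeffA hx).differentiableAt hne).hasFDerivAt
    have db := ((h.contDiffAt_coeffB hx).differentiableAt hne).hasFDerivAt
    have e1 : adField X (adField X v) =ᶠ[𝓝 x] fun z =>
        (v z).comp (coeffA X v z) + (adField X v z).comp (coeffB X v z) := by
      filter_upwards [h.isOpen.mem_nhds hx] with z hz using h.bracket_bracket_eq hz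
    have e2 := ((dv.clm_comp da).fun_add (dw.clm_comp db)).fderiv
    rw [← e1.fderiv_eq] at e2
    ext c
    have hvx : ∀ c, fderiv ℝ v x (X x) c = adField X v x c + fderiv ℝ X x (v x c) := fun c => by
      simp [adField]
    have hwx : ∀ c, fderiv ℝ (adField X v) x (X x) c =
        v x (a c) + adField X v x (b c) + fderiv ℝ X x (adField X v x c) := fun c => by
      have : adField X (adField X v) x c = v x (a c) + adField X v x (b c) := by rw [hu]; rfl
      rw [← this, adField]; simp
    have hux : ∀ c, adField X (adField X v) x c = v x (a c) + adField X v x (b c) :=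
      fun c => by rw [hu]; rfl
    have e3 : adField X (adField X (adField X v)) x c =
        fderiv ℝ (adField X (adField X v)) x (X x) c -
          fderiv ℝ X x (adField X (adField X v) x c) := rfl
    rw [e3, e2, hux]
    simp only [add_apply, ContinuousLinearMap.coe_comp, Function.comp_apply,
      ContinuousLinearMap.compL_apply, ContinuousLinearMap.flip_apply, ← ha, ← hb, ← ha', ← hb',
      hvx, hwx, map_add]
    abel
  have key := (m.isJacobiFrame h hx).isBigO_mixedDeriv (a := a) (b := b) (c := a' + a.comp b)
    (g := a + b.comp b + b')
    (by rw [d2.self_of_nhds, d1.self_of_nhds, m.frame_zero, m.frame_zero, m.frame_zero, hu]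
        ext c; simp [ha, hb])
    (by rw [d3.self_of_nhds, d1.self_of_nhds, m.frame_zero, m.frame_zero, m.frame_zero, hadu]
        ext c; simp) c
  -- The coefficients collect to −a/3 + b'/6 − b²/12, one third of the curvature matrix.
  have hρ : ((6 : ℝ)⁻¹ • (a + b.comp b + b') - (4 : ℝ)⁻¹ • (b * b) - (2 : ℝ)⁻¹ • a) =
      (3 : ℝ)⁻¹ • curvatureMatrix X v x := by
    have hbb : b.comp b = b * b := rfl
    simp only [curvatureMatrix, ← ha, ← hb, ← hb', hbb]
    module
  rw [hρ, m.frame_zero] at key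
  simpa using key

/-- The section of the curve of subspaces that computes the Lyapunov function. -/
theorem exists_adapted_section (m : IsModelCurve X v x β B S J y A A')
    (h : IsLagrangeModel X B v s Ω) (hx : x ∈ Ω) :
    ∃ e, IsCurveSection J e ∧ S (X x) - deriv e 0 ∈ J 0 ∧
      lyapunovValue β (S (X x)) e = s * lyapunov X B v x := by
  have cv := h.contDiffAt_frame hx
  have cw := h.contDiffAt_bracket hx
  have cf := m.contDiffAt_frame (h.contDiffAt_field hx) cv
  have cf1 := m.contDiffAt_frame (h.contDiffAt_field hx) cw
  set q := coordQ X v x (X x) with hq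
  set p := coordP X v x (X x) with hp
  have hev : ∀ {W : E → N →L[ℝ] E}, ContDiffAt ℝ ∞ W x →
      deriv (fun t => frame W S y A' t q) =ᶠ[𝓝 0] fun t => frame (adField X W) S y A' t q := by
    intro W hW
    have c1 := m.contDiffAt_frame (h.contDiffAt_field hx) hW
    filter_upwards [m.deriv_frame hW, c1.eventually_hasDerivAt] with t ht ht'
    rw [← ht]
    have := ht'.clm_apply (hasDerivAt_const t q)
    simpa using this.deriv
  have d1 := hev cv
  have d2 := d1.deriv.trans (hev cw)
  have hXx := h.eq_coord hx (X x)
  rw [← hq, ← hp] at hXx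
  -- Transporting v with the constant coefficient `q` gives a section whose derivative at 0 is w q,
  -- so its difference from `X` is v (p − ½ b q), which lies in the fiber.
  refine ⟨fun t => frame v S y A' t q, ⟨cf.clm_apply contDiffAt_const, ?_⟩, ?_, ?_⟩
  · filter_upwards [m.eventually_range] with t ht
    rw [ht]; exact ⟨q, rfl⟩
  · rw [d1.self_of_nhds, m.eventually_range.self_of_nhds]
    beta_reduce
    rw [m.frame_zero]
    have h0 : S.comp (transport A' y v 0) = S.comp (v x) := m.frame_zero v
    rw [h0]
    refine ⟨p - (2 : ℝ)⁻¹ • coeffB X v x q, ?_⟩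
    conv_rhs => rw [hXx]
    change S (v x _) = S _ - S (adField X v x q)
    rw [← map_sub, map_sub, map_smul]
    congr 1
    abel
  · unfold lyapunovValue
    rw [d2.self_of_nhds, d1.self_of_nhds]
    simp only [m.frame_zero, ContinuousLinearMap.coe_comp, Function.comp_apply, m.form_eq]
    have hsk : B x (adField X v x q) (adField X v x q) = 0 := by
      have := h.skew x hx (adField X v x q) (adField X v x q)
      linarith
    -- The correction ½ v b in the complement contributes −½ g(q, b q), which half of the second
    -- derivative term compensates.
    have hval : B x (adField X v x q) (X x) + 2⁻¹ * B x (adField X (adField X v) x q) (v x q) =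
        gram X B v x q p := by
      have hu : adField X (adField X v) x q = v x (coeffA X v x q) +
          adField X v x (coeffB X v x q) := by rw [h.bracket_bracket_eq hx]; rfl
      have hsymm := h.gram_symm hx q (coeffB X v x q)
      rw [hu]
      conv_lhs => rw [hXx]
      simp only [map_add, map_sub, map_smul, add_apply, h.isotropic x hx, hsk, smul_eq_mul]
      simp only [gram] at hsymm ⊢
      linarith
    rw [hval]
    change Real.sign (gram X B v x q q) * _ = s * gram X B v x q p
    -- For `q = 0` the sign function returns 0 instead of `s`, but then the Lyapunov value is 0 as
    -- well.
    by_cases hq0 : q = 0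
    · have : gram X B v x q p = 0 := by rw [hq0]; simp [gram]
      rw [this]; simp
    · have hd : 0 < s * gram X B v x q q := h.definite x hx q hq0
      congr 1
      rcases h.sign_eq with hs | hs
      · rw [hs] at hd ⊢; exact Real.sign_of_pos (by linarith)
      · rw [hs] at hd ⊢; exact Real.sign_of_neg (by linarith)

-- The pairing depends only on the value of the section at 0, so it may be computed with a constant
-- coefficient in the frame, where it equals g(c, c).
omit [FiniteDimensional ℝ E] [FiniteDimensional ℝ N] in
theorem eq_zero_of_deriv_pairing_eq_zero (m : IsModelCurve X v x β B S J y A A')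
    (h : IsLagrangeModel X B v s Ω) (hx : x ∈ Ω) {e : ℝ → V} (he : IsCurveSection J e)
    (h0 : β (deriv e 0) (e 0) = 0) : e 0 = 0 := by
  have cv := h.contDiffAt_frame hx
  have cf := m.contDiffAt_frame (h.contDiffAt_field hx) cv
  have hmem := he.eventually_mem.self_of_nhds
  have hz : S.comp (transport A' y v 0) = S.comp (v x) := m.frame_zero v
  rw [m.eventually_range.self_of_nhds, hz] at hmem
  obtain ⟨c, hc⟩ := hmem
  have hc' : S (v x c) = e 0 := hc
  have hs : IsCurveSection J (fun t => frame v S y A' t c) :=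
    ⟨cf.clm_apply contDiffAt_const, by
      filter_upwards [m.eventually_range] with t ht
      rw [ht]; exact ⟨c, rfl⟩⟩
  have h1 : e 0 = frame v S y A' 0 c := by rw [m.frame_zero]; exact hc'.symm
  have h2 := he.deriv_pairing_congr (m.isIsotropicCurve h hx) hs hs h1 h1
  have h3 : deriv (fun t => frame v S y A' t c) 0 = S (adField X v x c) := by
    have := cf.hasDerivAt_deriv.clm_apply (hasDerivAt_const (0 : ℝ) c)
    rw [(m.deriv_frame cv).self_of_nhds, m.frame_zero, m.frame_zero] at this
    simpa using this.deriv
  rw [h0, h3, m.frame_zero] at h2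
  change 0 = β (S (adField X v x c)) (S (v x c)) at h2
  rw [m.form_eq] at h2
  have hc0 : c = 0 := by
    by_contra hc0
    have := h.definite x hx c hc0
    rw [← h2] at this
    simp at this
  rw [← hc', hc0]; simp

end IsModelCurve

end ModelCurve

set_option maxSynthPendingDepth 3

/-! ### Alternating forms as bilinear maps, and closedness. -/

section BilinearForms

variable {E : Type*} [NormedAddCommGroup E] [NormedSpace ℝ E]

variable (E) in
/-- Alternating 2-forms as bilinear forms, as a continuous linear map. -/
noncomputable def ContinuousAlternatingMap.bilinear :
    (E [⋀^Fin 2]→L[ℝ] ℝ) →L[ℝ] E →L[ℝ] E →L[ℝ] ℝ :=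
  (ContinuousLinearMap.compL ℝ E (E [⋀^Fin 1]→L[ℝ] ℝ) (E →L[ℝ] ℝ)
    (ContinuousAlternatingMap.ofSubsingletonLIE (𝕜 := ℝ) (E := E) (F := ℝ)
      (0 : Fin 1)).symm.toContinuousLinearEquiv.toContinuousLinearMap).comp
    (ContinuousAlternatingMap.curryLeftLI (𝕜 := ℝ) (E := E) (F := ℝ)
      (n := 1)).toContinuousLinearMap

theorem ContinuousAlternatingMap.bilinear_apply (α : E [⋀^Fin 2]→L[ℝ] ℝ) (ξ η : E) :
    ContinuousAlternatingMap.bilinear E α ξ η = α ![ξ, η] := by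
  change α (Matrix.vecCons ξ fun _ => η) = α ![ξ, η]
  congr 1
  ext i
  fin_cases i <;> rfl

theorem ContinuousAlternatingMap.bilinear_skew (α : E [⋀^Fin 2]→L[ℝ] ℝ) (ξ η : E) :
    ContinuousAlternatingMap.bilinear E α ξ η = -ContinuousAlternatingMap.bilinear E α η ξ := by
  rw [bilinear_apply, bilinear_apply]
  have h := α.toAlternatingMap.map_swap ![η, ξ] (i := 0) (j := 1) (by decide)
  change α (![η, ξ] ∘ Equiv.swap 0 1) = -α ![η, ξ] at h
  rw [← h]
  congr 1
  ext i
  fin_cases i <;> rfl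

/-- The exterior derivative of a 2-form in terms of bilinear forms. -/
theorem extDeriv_apply_three {ω' : E → E [⋀^Fin 2]→L[ℝ] ℝ} {x : E}
    (hω : DifferentiableAt ℝ ω' x) (ξ η ζ : E) :
    extDeriv ω' x ![ξ, η, ζ] =
      fderiv ℝ (fun y => ContinuousAlternatingMap.bilinear E (ω' y)) x ξ η ζ -
      fderiv ℝ (fun y => ContinuousAlternatingMap.bilinear E (ω' y)) x η ξ ζ +
      fderiv ℝ (fun y => ContinuousAlternatingMap.bilinear E (ω' y)) x ζ ξ η := by
  have h1 : fderiv ℝ (fun y => ContinuousAlternatingMap.bilinear E (ω' y)) x =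
      (ContinuousAlternatingMap.bilinear E).comp (fderiv ℝ ω' x) := by
    rw [((hasFDerivAt_const (ContinuousAlternatingMap.bilinear E) x).clm_apply
      hω.hasFDerivAt).fderiv]
    ext; simp
  have e0 : (0 : Fin 3).removeNth ![ξ, η, ζ] = ![η, ζ] := by ext i; fin_cases i <;> rfl
  have e1 : (1 : Fin 3).removeNth ![ξ, η, ζ] = ![ξ, ζ] := by ext i; fin_cases i <;> rfl
  have e2 : (2 : Fin 3).removeNth ![ξ, η, ζ] = ![ξ, η] := by ext i; fin_cases i <;> rfl
  rw [h1, extDeriv, ContinuousAlternatingMap.alternatizeUncurryFin_apply, Fin.sum_univ_three,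
    e0, e1, e2]
  simp only [ContinuousLinearMap.coe_comp, Function.comp_apply,
    ContinuousAlternatingMap.bilinear_apply]
  simp
  ring

end BilinearForms

/-! ### Hamiltonian fields in a vector space: smoothness and invariance of the form. -/

section HamiltonianFieldInSpace

variable {E : Type*} [NormedAddCommGroup E] [NormedSpace ℝ E]
  {X : E → E} {B : E → E →L[ℝ] E →L[ℝ] ℝ} {f : E → ℝ} {Ω : Set E}

/-- A Hamiltonian field of a smooth function is smooth. -/
theorem contDiffAt_of_form_eq [FiniteDimensional ℝ E] {x : E} (hB : ContDiffAt ℝ ∞ B x)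
    (hf : ContDiffAt ℝ ∞ f x) (hX : ∀ᶠ y in 𝓝 x, ∀ ξ, B y ξ (X y) = fderiv ℝ f y ξ)
    (hnd : ∀ᶠ y in 𝓝 x, ∀ η, (∀ ξ, B y ξ η = 0) → η = 0) : ContDiffAt ℝ ∞ X x := by
  have hfin : Module.finrank ℝ E = Module.finrank ℝ (E →L[ℝ] ℝ) := by
    rw [← LinearEquiv.finrank_eq (LinearMap.toContinuousLinearMap (𝕜 := ℝ) (E := E) (F' := ℝ))]
    exact Subspace.dual_finrank_eq.symm
  have hi : ∀ᶠ y in 𝓝 x, ((B y).flip).IsInvertible := by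
    filter_upwards [hnd] with y hy
    refine ContinuousLinearMap.isInvertible_of_injective hfin ?_
    rw [injective_iff_map_eq_zero]
    exact fun η hη => hy η fun ξ => DFunLike.congr_fun hη ξ
  have h1 : ContDiffAt ℝ ∞ (fun y => (B y).flip) x :=
    (ContinuousLinearMap.flipₗᵢ ℝ E E ℝ).contDiff.contDiffAt.comp x hB
  have h2 : ContDiffAt ℝ ∞ (fun y => ((B y).flip).inverse) x :=
    hi.self_of_nhds.contDiffAt_inverse.comp (f := fun y => (B y).flip) x h1
  have h3 := h2.clm_apply (hf.fderiv_right (m := ∞) (by simp))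
  refine h3.congr_of_eventuallyEq ?_
  filter_upwards [hi, hX] with y hy hXy
  symm
  rw [hy.inverse_apply_eq]
  ext ξ
  exact (hXy ξ).symm

/-- The flow of a Hamiltonian field preserves a closed form. -/
theorem invariant_of_form_eq {x : E} (hB : DifferentiableAt ℝ B x) (hXd : DifferentiableAt ℝ X x)
    (hf : ContDiffAt ℝ ∞ f x) (hX : ∀ᶠ y in 𝓝 x, ∀ ξ, B y ξ (X y) = fderiv ℝ f y ξ)
    (hskew : ∀ᶠ y in 𝓝 x, ∀ ξ η, B y ξ η = -B y η ξ)
    (hclosed : ∀ ξ η ζ, fderiv ℝ B x ξ η ζ - fderiv ℝ B x η ξ ζ + fderiv ℝ B x ζ ξ η = 0)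
    (ξ η : E) :
    fderiv ℝ B x (X x) ξ η + B x (fderiv ℝ X x ξ) η + B x ξ (fderiv ℝ X x η) = 0 := by
  have hdf : DifferentiableAt ℝ (fderiv ℝ f) x :=
    (hf.fderiv_right (m := ∞) (by simp)).differentiableAt (by simp)
  have h1 : ∀ ξ η, fderiv ℝ B x η ξ (X x) + B x ξ (fderiv ℝ X x η) =
      fderiv ℝ (fderiv ℝ f) x η ξ := fun ξ η => by
    have e1 := ((hB.hasFDerivAt.clm_apply (hasFDerivAt_const ξ x)).clm_apply
      hXd.hasFDerivAt).fderiv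
    have e2 : (fun y => B y ξ (X y)) =ᶠ[𝓝 x] fun y => fderiv ℝ f y ξ := by
      filter_upwards [hX] with y hy using hy ξ
    have e3 := (hdf.hasFDerivAt.clm_apply (hasFDerivAt_const ξ x)).fderiv
    rw [e2.fderiv_eq, e3] at e1
    have e4 := DFunLike.congr_fun e1 η
    simp at e4
    linarith
  have h2 : ∀ ζ ξ η, fderiv ℝ B x ζ ξ η = -fderiv ℝ B x ζ η ξ := fun ζ ξ η => by
    have e1 := fun ξ η => ((hB.hasFDerivAt.clm_apply (hasFDerivAt_const ξ x)).clm_apply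
      (hasFDerivAt_const η x)).fderiv
    have e2 : (fun y => B y ξ η) =ᶠ[𝓝 x] fun y => -B y η ξ := by
      filter_upwards [hskew] with y hy using hy ξ η
    have e3 := e1 ξ η
    rw [e2.fderiv_eq, fderiv_fun_neg, e1 η ξ] at e3
    have e4 := DFunLike.congr_fun e3 ζ
    simp at e4
    linarith
  -- Antisymmetrizing `h1` eliminates the Hessian. Closedness on the triple `X x`, `ξ`, `η` turns
  -- the remaining derivatives of `B` into the one along `X`: this is Cartan's formula.
  have hsymm : fderiv ℝ (fderiv ℝ f) x η ξ = fderiv ℝ (fderiv ℝ f) x ξ η :=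
    (hf.isSymmSndFDerivAt (by simp; exact WithTop.coe_le_coe.2 le_top)) η ξ
  have h3 := h1 ξ η
  have h4 := h1 η ξ
  have h5 := hclosed (X x) ξ η
  have h6 := hskew.self_of_nhds (fderiv ℝ X x ξ) η
  have h7 := h2 η (X x) ξ
  have h8 := h2 ξ (X x) η
  linarith

end HamiltonianFieldInSpace

/-! ### Symplectic forms and vector fields read in a chart. -/

section ChartExpressions

variable {E : Type*} [NormedAddCommGroup E] [NormedSpace ℝ E]
  {M : Type*} [TopologicalSpace M] [ChartedSpace E M]

/-- The value of a symplectic form at a point as a bilinear form on the model space. -/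
noncomputable def formAt (σ : SymplecticForm E M) (z : M) : E →L[ℝ] E →L[ℝ] ℝ :=
  ContinuousAlternatingMap.bilinear E (σ.toForm z)

theorem formAt_apply (σ : SymplecticForm E M) (z : M) (ξ η : E) :
    formAt σ z ξ η = σ.pair z ξ η :=
  ContinuousAlternatingMap.bilinear_apply (E := E) (σ.toForm z) ξ η

theorem formAt_skew (σ : SymplecticForm E M) (z : M) (ξ η : E) :
    formAt σ z ξ η = -formAt σ z η ξ :=
  ContinuousAlternatingMap.bilinear_skew (E := E) (σ.toForm z) ξ η

/-- The derivative of the inverse of the chart at `y₀`. -/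
noncomputable def chartSymmDeriv (y₀ : M) (x : E) : E →L[ℝ] E :=
  mfderiv 𝓘(ℝ, E) 𝓘(ℝ, E) (extChartAt 𝓘(ℝ, E) y₀).symm x

/-- The derivative of the chart at `y₀`. -/
noncomputable def chartDeriv (y₀ z : M) : E →L[ℝ] E :=
  mfderiv 𝓘(ℝ, E) 𝓘(ℝ, E) (extChartAt 𝓘(ℝ, E) y₀) z

/-- The expression of a vector field in the chart at `y₀`. -/
noncomputable def chartField (y₀ : M) (X : (x : M) → TangentSpace 𝓘(ℝ, E) x) (x : E) : E :=
  VectorField.mpullback 𝓘(ℝ, E) 𝓘(ℝ, E) (extChartAt 𝓘(ℝ, E) y₀).symm X x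

theorem chartField_eq_inverse (y₀ : M) (X : (x : M) → TangentSpace 𝓘(ℝ, E) x) (x : E) :
    chartField y₀ X x =
      (chartSymmDeriv y₀ x).inverse (toModel (X ((extChartAt 𝓘(ℝ, E) y₀).symm x))) := rfl

/-- The expression of a symplectic form in the chart at `y₀`. -/
noncomputable def chartForm (σ : SymplecticForm E M) (y₀ : M) (x : E) : E →L[ℝ] E →L[ℝ] ℝ :=
  ContinuousAlternatingMap.bilinear E (formInChart σ.toForm y₀ x)

theorem chartForm_apply (σ : SymplecticForm E M) (y₀ : M) (x ξ η : E) :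
    chartForm σ y₀ x ξ η = formAt σ ((extChartAt 𝓘(ℝ, E) y₀).symm x)
      (chartSymmDeriv y₀ x ξ) (chartSymmDeriv y₀ x η) := by
  rw [chartForm, ContinuousAlternatingMap.bilinear_apply, formAt_apply]
  change (σ.toForm _) _ = (σ.toForm _) _
  congr 1
  ext i
  fin_cases i <;> rfl

variable [IsManifold 𝓘(ℝ, E) ∞ M]

theorem chartDeriv_comp_chartSymmDeriv {y₀ : M} {x : E}
    (hx : x ∈ (extChartAt 𝓘(ℝ, E) y₀).target) :
    (chartDeriv y₀ ((extChartAt 𝓘(ℝ, E) y₀).symm x)).comp (chartSymmDeriv y₀ x) =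
      ContinuousLinearMap.id ℝ E := by
  have : IsManifold 𝓘(ℝ, E) 1 M := IsManifold.of_le (n := ∞) (by simp)
  have h := mfderiv_extChartAt_comp_mfderivWithin_extChartAt_symm (I := 𝓘(ℝ, E)) hx
  rw [ModelWithCorners.range_eq_univ, mfderivWithin_univ] at h
  exact h

theorem chartSymmDeriv_comp_chartDeriv {y₀ : M} {x : E}
    (hx : x ∈ (extChartAt 𝓘(ℝ, E) y₀).target) :
    (chartSymmDeriv y₀ x).comp (chartDeriv y₀ ((extChartAt 𝓘(ℝ, E) y₀).symm x)) =
      ContinuousLinearMap.id ℝ E := by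
  have : IsManifold 𝓘(ℝ, E) 1 M := IsManifold.of_le (n := ∞) (by simp)
  have h := mfderivWithin_extChartAt_symm_comp_mfderiv_extChartAt (I := 𝓘(ℝ, E)) hx
  rw [ModelWithCorners.range_eq_univ, mfderivWithin_univ] at h
  exact h

theorem isInvertible_chartSymmDeriv {y₀ : M} {x : E}
    (hx : x ∈ (extChartAt 𝓘(ℝ, E) y₀).target) : (chartSymmDeriv y₀ x).IsInvertible :=
  ContinuousLinearMap.IsInvertible.of_inverse (chartSymmDeriv_comp_chartDeriv hx)
    (chartDeriv_comp_chartSymmDeriv hx)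

theorem chartSymmDeriv_chartField {y₀ : M} {x : E}
    (hx : x ∈ (extChartAt 𝓘(ℝ, E) y₀).target) (X : (x : M) → TangentSpace 𝓘(ℝ, E) x) :
    chartSymmDeriv y₀ x (chartField y₀ X x) = toModel (X ((extChartAt 𝓘(ℝ, E) y₀).symm x)) :=
  (isInvertible_chartSymmDeriv hx).apply_inverse _

theorem chartField_eq {y₀ : M} {x : E}
    (hx : x ∈ (extChartAt 𝓘(ℝ, E) y₀).target) (X : (x : M) → TangentSpace 𝓘(ℝ, E) x) :
    chartField y₀ X x = chartDeriv y₀ ((extChartAt 𝓘(ℝ, E) y₀).symm x)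
      (toModel (X ((extChartAt 𝓘(ℝ, E) y₀).symm x))) := by
  rw [chartField_eq_inverse, (isInvertible_chartSymmDeriv hx).inverse_apply_eq]
  exact (DFunLike.congr_fun (chartSymmDeriv_comp_chartDeriv hx) _).symm

theorem chartSymmDeriv_self (y₀ : M) :
    chartSymmDeriv y₀ (extChartAt 𝓘(ℝ, E) y₀ y₀) = ContinuousLinearMap.id ℝ E := by
  have : IsManifold 𝓘(ℝ, E) 1 M := IsManifold.of_le (n := ∞) (by simp)
  have h := mfderivWithin_range_extChartAt_symm (I := 𝓘(ℝ, E)) (x := y₀)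
  rw [ModelWithCorners.range_eq_univ, mfderivWithin_univ] at h
  exact h

theorem chartDeriv_self (y₀ : M) : chartDeriv y₀ y₀ = ContinuousLinearMap.id ℝ E := by
  have : IsManifold 𝓘(ℝ, E) 1 M := IsManifold.of_le (n := ∞) (by simp)
  exact mfderiv_extChartAt_self (I := 𝓘(ℝ, E)) (x := y₀)

omit [IsManifold 𝓘(ℝ, E) ∞ M] in
theorem contDiffAt_chartForm (σ : SymplecticForm E M) {y₀ : M} {x : E}
    (hx : x ∈ (extChartAt 𝓘(ℝ, E) y₀).target) : ContDiffAt ℝ ∞ (chartForm σ y₀) x :=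
  contDiffAt_const.clm_apply
    ((σ.smooth y₀).contDiffAt ((isOpen_extChartAt_target y₀).mem_nhds hx))

theorem chartForm_nondegenerate (σ : SymplecticForm E M) {y₀ : M} {x : E}
    (hx : x ∈ (extChartAt 𝓘(ℝ, E) y₀).target) {η : E} (h : ∀ ξ, chartForm σ y₀ x ξ η = 0) :
    η = 0 := by
  have hS := chartDeriv_comp_chartSymmDeriv hx
  have hS' := chartSymmDeriv_comp_chartDeriv hx
  have h0 : chartSymmDeriv y₀ x η = 0 := by
    refine σ.nondegenerate ((extChartAt 𝓘(ℝ, E) y₀).symm x) (chartSymmDeriv y₀ x η) fun ζ => ?_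
    have h1 := h (chartDeriv y₀ ((extChartAt 𝓘(ℝ, E) y₀).symm x) (toModel ζ))
    have h2 : chartSymmDeriv y₀ x (chartDeriv y₀ ((extChartAt 𝓘(ℝ, E) y₀).symm x)
        (toModel ζ)) = toModel ζ := DFunLike.congr_fun hS' (toModel ζ)
    rw [chartForm_apply, h2, formAt_skew, neg_eq_zero, formAt_apply] at h1
    exact h1
  have h3 := DFunLike.congr_fun hS η
  simpa [h0] using h3.symm

variable [FiniteDimensional ℝ E]

theorem chartForm_hamiltonianField (σ : SymplecticForm E M) {h : M → ℝ}
    (hh : ContMDiff 𝓘(ℝ, E) 𝓘(ℝ, ℝ) ∞ h) {y₀ : M} {x : E}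
    (hx : x ∈ (extChartAt 𝓘(ℝ, E) y₀).target) (ξ : E) :
    chartForm σ y₀ x ξ (chartField y₀ (hamiltonianField σ h) x) =
      fderiv ℝ (fun z => h ((extChartAt 𝓘(ℝ, E) y₀).symm z)) x ξ := by
  have : IsManifold 𝓘(ℝ, E) 1 M := IsManifold.of_le (n := ∞) (by simp)
  rw [chartForm_apply, chartSymmDeriv_chartField hx, formAt_apply]
  have h1 : MDifferentiableAt 𝓘(ℝ, E) 𝓘(ℝ, E) (extChartAt 𝓘(ℝ, E) y₀).symm x := by
    have := mdifferentiableWithinAt_extChartAt_symm (I := 𝓘(ℝ, E)) hx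
    rwa [ModelWithCorners.range_eq_univ, mdifferentiableWithinAt_univ] at this
  have h2 : MDifferentiableAt 𝓘(ℝ, E) 𝓘(ℝ, ℝ) h ((extChartAt 𝓘(ℝ, E) y₀).symm x) :=
    hh.mdifferentiableAt (by simp)
  have h3 := mfderiv_comp x h2 h1
  rw [mfderiv_eq_fderiv] at h3
  have h4 := hamiltonianField_spec σ h ((extChartAt 𝓘(ℝ, E) y₀).symm x) (chartSymmDeriv y₀ x ξ)
  refine h4.symm.trans ?_
  exact (DFunLike.congr_fun h3 ξ).symm

omit [FiniteDimensional ℝ E] in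
theorem contDiffAt_comp_chart_symm {h : M → ℝ}
    (hh : ContMDiff 𝓘(ℝ, E) 𝓘(ℝ, ℝ) ∞ h) {y₀ : M} {x : E}
    (hx : x ∈ (extChartAt 𝓘(ℝ, E) y₀).target) :
    ContDiffAt ℝ ∞ (fun z => h ((extChartAt 𝓘(ℝ, E) y₀).symm z)) x := by
  rw [← contMDiffAt_iff_contDiffAt]
  exact hh.contMDiffAt.comp x ((contMDiffOn_extChartAt_symm y₀).contMDiffAt
    ((isOpen_extChartAt_target y₀).mem_nhds hx))

/-- The Hamiltonian field is chosen point by point, so its smoothness has to be recovered: it solves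
a linear equation whose coefficients are smooth and, by nondegeneracy, invertible. -/
theorem contDiffAt_chartField (σ : SymplecticForm E M) {h : M → ℝ}
    (hh : ContMDiff 𝓘(ℝ, E) 𝓘(ℝ, ℝ) ∞ h) {y₀ : M} {x : E}
    (hx : x ∈ (extChartAt 𝓘(ℝ, E) y₀).target) :
    ContDiffAt ℝ ∞ (chartField y₀ (hamiltonianField σ h)) x := by
  have ht := (isOpen_extChartAt_target (I := 𝓘(ℝ, E)) y₀).mem_nhds hx
  refine contDiffAt_of_form_eq (contDiffAt_chartForm σ hx) (contDiffAt_comp_chart_symm hh hx) ?_ ?_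
  · filter_upwards [ht] with z hz ξ using chartForm_hamiltonianField σ hh hz ξ
  · filter_upwards [ht] with z hz η hη using chartForm_nondegenerate σ hz hη

theorem chartForm_invariant (σ : SymplecticForm E M) {h : M → ℝ}
    (hh : ContMDiff 𝓘(ℝ, E) 𝓘(ℝ, ℝ) ∞ h) {y₀ : M} {x : E}
    (hx : x ∈ (extChartAt 𝓘(ℝ, E) y₀).target) (ξ η : E) :
    fderiv ℝ (chartForm σ y₀) x (chartField y₀ (hamiltonianField σ h) x) ξ η +
      chartForm σ y₀ x (fderiv ℝ (chartField y₀ (hamiltonianField σ h)) x ξ) η +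
      chartForm σ y₀ x ξ (fderiv ℝ (chartField y₀ (hamiltonianField σ h)) x η) = 0 := by
  have ht := (isOpen_extChartAt_target (I := 𝓘(ℝ, E)) y₀).mem_nhds hx
  have hne : (∞ : WithTop ℕ∞) ≠ 0 := by simp
  refine invariant_of_form_eq ((contDiffAt_chartForm σ hx).differentiableAt hne)
    ((contDiffAt_chartField σ hh hx).differentiableAt hne) (contDiffAt_comp_chart_symm hh hx)
    ?_ ?_ ?_ ξ η
  · filter_upwards [ht] with z hz ξ using chartForm_hamiltonianField σ hh hz ξ
  · exact Eventually.of_forall fun z ξ η => ContinuousAlternatingMap.bilinear_skew _ ξ η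
  · intro ξ η ζ
    have h1 := extDeriv_apply_three (((σ.smooth y₀).contDiffAt ht).differentiableAt hne) ξ η ζ
    rw [σ.closed y₀ x hx] at h1
    exact h1.symm

/-- The Hamiltonian field of a smooth function is a smooth section of the tangent bundle. -/
theorem isSmoothField_hamiltonianField (σ : SymplecticForm E M) {h : M → ℝ}
    (hh : ContMDiff 𝓘(ℝ, E) 𝓘(ℝ, ℝ) ∞ h) : IsSmoothField (hamiltonianField σ h) := by
  have : IsManifold 𝓘(ℝ, E) 1 M := IsManifold.of_le (n := ∞) (by simp)
  intro y₀
  have hx := mem_extChartAt_target (I := 𝓘(ℝ, E)) y₀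
  let V : (x : E) → TangentSpace 𝓘(ℝ, E) x := chartField y₀ (hamiltonianField σ h)
  have h1 : ContMDiffAt 𝓘(ℝ, E) (𝓘(ℝ, E)).tangent ∞
      (fun x => (⟨x, V x⟩ : TangentBundle 𝓘(ℝ, E) E)) (extChartAt 𝓘(ℝ, E) y₀ y₀) :=
    contMDiffAt_vectorSpace_iff_contDiffAt.2 (contDiffAt_chartField σ hh hx)
  have h2 := ContMDiffAt.mpullback_vectorField_preimage (m := ∞) (n := ∞) (V := V)
    h1 (contMDiffAt_extChartAt (I := 𝓘(ℝ, E)) (n := ∞) (x := y₀))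
    (isInvertible_mfderiv_extChartAt (mem_extChartAt_source y₀)) (by simp)
  refine h2.congr_of_eventuallyEq ?_
  have h3 := VectorField.eventuallyEq_mpullback_mpullbackWithin_extChartAt (I := 𝓘(ℝ, E)) (s := univ)
    (x := y₀) (hamiltonianField σ h)
  rw [ModelWithCorners.range_eq_univ, VectorField.mpullbackWithin_univ, nhdsWithin_univ] at h3
  filter_upwards [h3] with z hz
  rw [hz]
  rfl

end ChartExpressions

/-! ### A Lagrange model around every point of the manifold. -/

section ModelAtPoint

variable {E : Type*} [NormedAddCommGroup E] [NormedSpace ℝ E]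
  {M : Type*} [TopologicalSpace M] [ChartedSpace E M] [IsManifold 𝓘(ℝ, E) ∞ M]

theorem contDiffAt_chartField_of_contMDiffAt [CompleteSpace E] {y₀ : M} {x : E}
    (hx : x ∈ (extChartAt 𝓘(ℝ, E) y₀).target) {V : (x : M) → TangentSpace 𝓘(ℝ, E) x}
    (hV : ContMDiffAt 𝓘(ℝ, E) (𝓘(ℝ, E)).tangent ∞
      (fun x => (⟨x, V x⟩ : TangentBundle 𝓘(ℝ, E) M)) ((extChartAt 𝓘(ℝ, E) y₀).symm x)) :
    ContDiffAt ℝ ∞ (chartField y₀ V) x := by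
  let W : (x : E) → TangentSpace 𝓘(ℝ, E) x := chartField y₀ V
  have hW : ContMDiffAt 𝓘(ℝ, E) (𝓘(ℝ, E)).tangent ∞
      (fun x => (⟨x, W x⟩ : TangentBundle 𝓘(ℝ, E) E)) x :=
    ContMDiffAt.mpullback_vectorField_preimage (m := ∞) (n := ∞) (V := V) hV
      ((contMDiffOn_extChartAt_symm y₀).contMDiffAt ((isOpen_extChartAt_target y₀).mem_nhds hx))
      (isInvertible_chartSymmDeriv (E := E) (M := M) hx) (by simp)
  exact (contMDiffAt_vectorSpace_iff_contDiffAt (V := W)).1 hW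

/-- The Lie bracket at the center of a chart. -/
theorem toModel_mlieBracket (y₀ : M) (X V : (x : M) → TangentSpace 𝓘(ℝ, E) x) :
    toModel (VectorField.mlieBracket 𝓘(ℝ, E) X V y₀) =
      fderiv ℝ (chartField y₀ V) (extChartAt 𝓘(ℝ, E) y₀ y₀)
        (chartField y₀ X (extChartAt 𝓘(ℝ, E) y₀ y₀)) -
      fderiv ℝ (chartField y₀ X) (extChartAt 𝓘(ℝ, E) y₀ y₀)
        (chartField y₀ V (extChartAt 𝓘(ℝ, E) y₀ y₀)) := by
  rw [← VectorField.mlieBracketWithin_univ, VectorField.mlieBracketWithin_apply]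
  rw [ModelWithCorners.range_eq_univ, VectorField.mpullbackWithin_univ,
    VectorField.mpullbackWithin_univ, preimage_univ, univ_inter]
  change (chartDeriv y₀ y₀).inverse (VectorField.lieBracketWithin ℝ (chartField y₀ X)
    (chartField y₀ V) univ (extChartAt 𝓘(ℝ, E) y₀ y₀)) = _
  rw [VectorField.lieBracketWithin_univ, chartDeriv_self, ContinuousLinearMap.inverse_id]
  rfl

variable {n : ℕ} {σ : SymplecticForm E M}

/-- The expression in the chart of a finite family of vector fields, as a frame. -/
noncomputable def chartFrame (y₀ : M) (v : Fin n → (y : M) → TangentSpace 𝓘(ℝ, E) y) (x : E) :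
    (Fin n → ℝ) →L[ℝ] E :=
  ∑ i, (ContinuousLinearMap.proj (R := ℝ) (φ := fun _ : Fin n => ℝ) i).smulRight
    (chartField y₀ (v i) x)

omit [IsManifold 𝓘(ℝ, E) ∞ M] in
theorem chartFrame_apply (y₀ : M) (v : Fin n → (y : M) → TangentSpace 𝓘(ℝ, E) y) (x : E)
    (c : Fin n → ℝ) : chartFrame y₀ v x c = ∑ i, c i • chartField y₀ (v i) x := by
  simp [chartFrame]

theorem mem_range_chartFrame {y₀ : M} {x : E} (hx : x ∈ (extChartAt 𝓘(ℝ, E) y₀).target)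
    (v : Fin n → (y : M) → TangentSpace 𝓘(ℝ, E) y)
    {F : Submodule ℝ (TangentSpace 𝓘(ℝ, E) ((extChartAt 𝓘(ℝ, E) y₀).symm x))}
    (hF : Submodule.span ℝ (range fun i => v i ((extChartAt 𝓘(ℝ, E) y₀).symm x)) = F) (ξ : E) :
    ξ ∈ (chartFrame y₀ v x).range ↔ chartSymmDeriv y₀ x ξ ∈ F := by
  have hS : ∀ c, chartSymmDeriv y₀ x (chartFrame y₀ v x c) =
      toModel (∑ i, c i • v i ((extChartAt 𝓘(ℝ, E) y₀).symm x)) := fun c => by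
    rw [chartFrame_apply, map_sum]
    simp only [map_smul, chartSymmDeriv_chartField hx]
    rfl
  rw [← hF]
  constructor
  · rintro ⟨c, rfl⟩
    exact (Submodule.mem_span_range_iff_exists_fun ℝ
      (M := TangentSpace 𝓘(ℝ, E) ((extChartAt 𝓘(ℝ, E) y₀).symm x))).2 ⟨c, (hS c).symm⟩
  · intro h
    obtain ⟨c, hc⟩ := (Submodule.mem_span_range_iff_exists_fun ℝ
      (M := TangentSpace 𝓘(ℝ, E) ((extChartAt 𝓘(ℝ, E) y₀).symm x))).1 h
    refine ⟨c, ?_⟩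
    obtain ⟨e, he⟩ := isInvertible_chartSymmDeriv hx
    have h1 : chartSymmDeriv y₀ x (chartFrame y₀ v x c) = chartSymmDeriv y₀ x ξ :=
      (hS c).trans hc
    rw [← he] at h1
    exact e.injective h1

/-- The data of a Lagrange model of the Hamiltonian system near a point of the manifold. -/
structure IsModelAt [FiniteDimensional ℝ E] [T2Space M] (Δ : LagrangeDistribution n σ)
    (X : (x : M) → TangentSpace 𝓘(ℝ, E) x)
    (y₀ : M) (v : E → (Fin n → ℝ) →L[ℝ] E) (s : ℝ) (Ω : Set E) : Prop where
  model : IsLagrangeModel (chartField y₀ X) (chartForm σ y₀) v s Ω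
  mem : extChartAt 𝓘(ℝ, E) y₀ y₀ ∈ Ω
  subset : Ω ⊆ (extChartAt 𝓘(ℝ, E) y₀).target
  mem_range_iff : ∀ x ∈ Ω, ∀ ξ, ξ ∈ (v x).range ↔
    chartSymmDeriv y₀ x ξ ∈ Δ.fiber ((extChartAt 𝓘(ℝ, E) y₀).symm x)
  fiberForm_eq : ∀ (ξ₁ ξ₂ : Δ.fiber y₀) (c₁ c₂ : Fin n → ℝ),
    toModel (ξ₁ : TangentSpace 𝓘(ℝ, E) y₀) = v (extChartAt 𝓘(ℝ, E) y₀ y₀) c₁ →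
    toModel (ξ₂ : TangentSpace 𝓘(ℝ, E) y₀) = v (extChartAt 𝓘(ℝ, E) y₀ y₀) c₂ →
    fiberForm Δ X y₀ ξ₁ ξ₂ = IsLagrangeModel.gram (chartField y₀ X) (chartForm σ y₀) v
      (extChartAt 𝓘(ℝ, E) y₀ y₀) c₂ c₁

/-- Isotropy and invariance hold wherever the chart and the frame are defined. Definiteness is read
off from g at `y₀` and persists nearby by continuity, with the same sign `s`. -/
theorem exists_isModelAt [FiniteDimensional ℝ E] [T2Space M] (hn : Module.finrank ℝ E = 2 * n)
    (Δ : LagrangeDistribution n σ) {h : M → ℝ} (hh : ContMDiff 𝓘(ℝ, E) 𝓘(ℝ, ℝ) ∞ h) (y₀ : M)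
    (hmono : IsMonotoneAt Δ (hamiltonianField σ h) y₀) :
    ∃ v s Ω, IsModelAt Δ (hamiltonianField σ h) y₀ v s Ω := by
  obtain ⟨U, hU, hyU, v, hv, hspan⟩ := Δ.exists_frame y₀
  set X := hamiltonianField σ h with hX
  set κ := extChartAt 𝓘(ℝ, E) y₀ with hκ
  set Ω₀ : Set E := κ.target ∩ κ.symm ⁻¹' U with hΩ₀
  have hΩ₀o : IsOpen Ω₀ :=
    (continuousOn_extChartAt_symm y₀).isOpen_inter_preimage (isOpen_extChartAt_target y₀) hU
  have hsymm : κ.symm (κ y₀) = y₀ := extChartAt_to_inv (I := 𝓘(ℝ, E)) y₀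
  have hx₀ : κ y₀ ∈ Ω₀ := ⟨mem_extChartAt_target y₀, by rw [mem_preimage, hsymm]; exact hyU⟩
  set f := chartFrame y₀ v with hf
  have hne : (∞ : WithTop ℕ∞) ≠ 0 := by simp
  have hfs : ∀ x ∈ Ω₀, ContDiffAt ℝ ∞ f x := by
    intro x hx
    refine ContDiffAt.sum fun i _ => ?_
    exact contDiffAt_const.smulRight (contDiffAt_chartField_of_contMDiffAt hx.1
      ((hv i).contMDiffAt (hU.mem_nhds hx.2)))
  have hrange : ∀ x ∈ Ω₀, ∀ ξ, ξ ∈ (f x).range ↔ chartSymmDeriv y₀ x ξ ∈ Δ.fiber (κ.symm x) :=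
    fun x hx ξ => mem_range_chartFrame hx.1 v (hspan _ hx.2) ξ
  have hiso : ∀ x ∈ Ω₀, ∀ c d, chartForm σ y₀ x (f x c) (f x d) = 0 := by
    intro x hx c d
    rw [chartForm_apply, formAt_apply]
    exact Δ.isotropic _ _ ((hrange x hx _).1 ⟨c, rfl⟩) _ ((hrange x hx _).1 ⟨d, rfl⟩)
  have hform : ∀ (ξ₁ ξ₂ : Δ.fiber y₀) (c₁ c₂ : Fin n → ℝ),
      toModel (ξ₁ : TangentSpace 𝓘(ℝ, E) y₀) = f (κ y₀) c₁ →
      toModel (ξ₂ : TangentSpace 𝓘(ℝ, E) y₀) = f (κ y₀) c₂ →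
      fiberForm Δ X y₀ ξ₁ ξ₂ =
        IsLagrangeModel.gram (chartField y₀ X) (chartForm σ y₀) f (κ y₀) c₂ c₁ := by
    intro ξ₁ ξ₂ c₁ c₂ h₁ h₂
    have hV := (Δ.exists_section y₀ ξ₁).choose_spec
    have hW := (Δ.exists_section y₀ ξ₂).choose_spec
    set V := (Δ.exists_section y₀ ξ₁).choose
    set W := (Δ.exists_section y₀ ξ₂).choose
    have hcf : ∀ Y : (x : M) → TangentSpace 𝓘(ℝ, E) x, chartField y₀ Y (κ y₀) = toModel (Y y₀) := by
      intro Y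
      rw [chartField_eq hx₀.1, hsymm, chartDeriv_self]; rfl
    -- The sections in `fiberForm` are arbitrary choices; this identity shows that only their values
    -- at `y₀` matter, at the price of exchanging the two arguments.
    have e1 := bracket_pairing_eq (X := chartField y₀ X) (B := chartForm σ y₀) (v := f) (x := κ y₀)
      ((contDiffAt_chartForm σ hx₀.1).differentiableAt hne) ((hfs _ hx₀).differentiableAt hne)
      (Y := chartField y₀ V)
      ((contDiffAt_chartField_of_contMDiffAt hx₀.1 hV.1.1.contMDiffAt).differentiableAt hne)
      (fun ξ η => ContinuousAlternatingMap.bilinear_skew _ ξ η)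
      (chartForm_invariant σ hh hx₀.1)
      (by filter_upwards [hΩ₀o.mem_nhds hx₀] with z hz using hiso z hz)
      (by
        filter_upwards [hΩ₀o.mem_nhds hx₀] with z hz
        rw [hrange z hz, chartSymmDeriv_chartField hz.1]
        exact hV.1.2 _) c₂
    rw [← toModel_mlieBracket, hcf V, hV.2] at e1
    rw [IsLagrangeModel.gram, ← h₁]
    refine Eq.trans ?_ e1
    rw [← h₂, chartForm_apply, chartSymmDeriv_self, formAt_apply, hsymm]
    change σ.pair y₀ _ (W y₀) = _
    rw [hW.2]
    rfl
  have hinj : ∀ c, c ≠ 0 → f (κ y₀) c ≠ 0 := by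
    intro c hc h0
    have hli : LinearIndependent ℝ (fun i => v i y₀) := by
      rw [linearIndependent_iff_card_eq_finrank_span, Fintype.card_fin, Set.finrank,
        hspan y₀ hyU, Δ.finrank_fiber]
    refine hc (funext fun i => Fintype.linearIndependent_iff.1 hli c ?_ i)
    have h1 : f (κ y₀) c = toModel (∑ i, c i • v i y₀) := by
      rw [hf, chartFrame_apply]
      refine Finset.sum_congr rfl fun i _ => ?_
      rw [chartField_eq hx₀.1, hsymm, chartDeriv_self]; rfl
    exact h1.symm.trans h0
  obtain ⟨s, hs, hdef⟩ : ∃ s : ℝ, (s = 1 ∨ s = -1) ∧ ∀ c, c ≠ 0 →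
      0 < s * IsLagrangeModel.gram (chartField y₀ X) (chartForm σ y₀) f (κ y₀) c c := by
    have hmem : ∀ c, (f (κ y₀) c : TangentSpace 𝓘(ℝ, E) y₀) ∈ Δ.fiber y₀ := fun c => by
      have := (hrange _ hx₀ (f (κ y₀) c)).1 ⟨c, rfl⟩
      rw [chartSymmDeriv_self, hsymm] at this
      exact this
    rcases hmono.2 with hp | hp
    · refine ⟨1, Or.inl rfl, fun c hc => ?_⟩
      have := hp ⟨f (κ y₀) c, hmem c⟩ (fun h0 => hinj c hc (congrArg Subtype.val h0))
      rw [hform _ _ c c rfl rfl] at this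
      linarith
    · refine ⟨-1, Or.inr rfl, fun c hc => ?_⟩
      have := hp ⟨f (κ y₀) c, hmem c⟩ (fun h0 => hinj c hc (congrArg Subtype.val h0))
      rw [hform _ _ c c rfl rfl] at this
      linarith
  have hXs : ∀ x ∈ Ω₀, ContDiffAt ℝ ∞ (chartField y₀ X) x := fun x hx =>
    contDiffAt_chartField σ hh hx.1
  have hgc : ContinuousAt (fun x => s • IsLagrangeModel.gramL (chartField y₀ X) (chartForm σ y₀) f x)
      (κ y₀) := by
    have h1 : ContDiffAt ℝ ∞ (fun y =>
        (ContinuousLinearMap.compL ℝ (Fin n → ℝ) E ℝ).flip (f y)) (κ y₀) :=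
      contDiffAt_const.clm_apply (hfs _ hx₀)
    have h2 : ContDiffAt ℝ ∞ (fun y => (chartForm σ y₀ y).comp (adField (chartField y₀ X) f y))
        (κ y₀) :=
      (contDiffAt_chartForm σ hx₀.1).clm_comp ((hXs _ hx₀).adField (hfs _ hx₀))
    exact ((h1.clm_comp h2).const_smul s).continuousAt
  obtain ⟨δ, hδ, hev⟩ := exists_pos_le_of_pos hgc (fun c hc => hdef c hc)
  obtain ⟨Ω, hΩ, hΩo, hxΩ⟩ := _root_.mem_nhds_iff.1
    (Filter.inter_mem (hΩ₀o.mem_nhds hx₀) hev)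
  have hsub : ∀ x ∈ Ω, x ∈ Ω₀ := fun x hx => (hΩ hx).1
  refine ⟨f, s, Ω, ⟨⟨hΩo, fun x hx => (hXs x (hsub x hx)).contDiffWithinAt,
    fun x hx => (contDiffAt_chartForm σ (hsub x hx).1).contDiffWithinAt,
    fun x hx => (hfs x (hsub x hx)).contDiffWithinAt,
    fun x _ ξ η => ContinuousAlternatingMap.bilinear_skew _ ξ η,
    fun x hx => chartForm_invariant σ hh (hsub x hx).1, fun x hx => hiso x (hsub x hx), ?_, hs, ?_⟩,
    hxΩ, fun x hx => (hsub x hx).1, fun x hx => hrange x (hsub x hx), hform⟩⟩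
  · rw [Module.finrank_prod, Module.finrank_fin_fun, hn]; ring
  · intro x hx c hc
    have h1 : δ * ‖c‖ ^ 2 ≤ s * IsLagrangeModel.gram (chartField y₀ X) (chartForm σ y₀) f x c c :=
      (hΩ hx).2 c
    have h2 : 0 < ‖c‖ := norm_pos_iff.2 hc
    exact lt_of_lt_of_le (by positivity) h1

end ModelAtPoint

/-! ### The flow and the Jacobi curve in a chart. -/

section FlowInChart

variable {E : Type*} [NormedAddCommGroup E] [NormedSpace ℝ E]
  {M : Type*} [TopologicalSpace M] [ChartedSpace E M] [IsManifold 𝓘(ℝ, E) ∞ M]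

theorem mdifferentiableAt_chart_symm {y₀ : M} {x : E}
    (hx : x ∈ (extChartAt 𝓘(ℝ, E) y₀).target) :
    MDifferentiableAt 𝓘(ℝ, E) 𝓘(ℝ, E) (extChartAt 𝓘(ℝ, E) y₀).symm x := by
  have : IsManifold 𝓘(ℝ, E) 1 M := IsManifold.of_le (n := ∞) (by simp)
  have := mdifferentiableWithinAt_extChartAt_symm (I := 𝓘(ℝ, E)) hx
  rwa [ModelWithCorners.range_eq_univ, mdifferentiableWithinAt_univ] at this

/-- The inverse of a chart maps solutions of the equation in the chart to integral curves. -/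
theorem hasMFDerivAt_chart_symm_comp {y₀ : M} {X : (x : M) → TangentSpace 𝓘(ℝ, E) x} {γ : ℝ → E}
    {t : ℝ} (ht : γ t ∈ (extChartAt 𝓘(ℝ, E) y₀).target)
    (hγ : HasDerivAt γ (chartField y₀ X (γ t)) t) :
    HasMFDerivAt 𝓘(ℝ, ℝ) 𝓘(ℝ, E) (fun s => (extChartAt 𝓘(ℝ, E) y₀).symm (γ s)) t
      ((1 : ℝ →L[ℝ] ℝ).smulRight (X ((extChartAt 𝓘(ℝ, E) y₀).symm (γ t)))) := by
  have h1 := (mdifferentiableAt_chart_symm ht).hasMFDerivAt.comp t hγ.hasFDerivAt.hasMFDerivAt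
  refine h1.congr_mfderiv ?_
  refine ContinuousLinearMap.ext_ring ?_
  have h2 := chartSymmDeriv_chartField ht X
  refine Eq.trans (b := chartSymmDeriv y₀ (γ t) ((1 : ℝ) • chartField y₀ X (γ t))) rfl ?_
  rw [one_smul, h2]
  exact (one_smul ℝ (toModel (X ((extChartAt 𝓘(ℝ, E) y₀).symm (γ t))))).symm

/-- In a chart the flow is the local flow of the expression of the field in the chart. -/
theorem exists_localFlow_chart [CompleteSpace E] [T2Space M]
    {X : (x : M) → TangentSpace 𝓘(ℝ, E) x}
    (hX : IsSmoothField X) {φ : ℝ → M → M} (hφ : IsFlow X φ) {y₀ : M} {Ω : Set E} (hΩ : IsOpen Ω)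
    (hsub : Ω ⊆ (extChartAt 𝓘(ℝ, E) y₀).target) {x₀ : E} (hx₀ : x₀ ∈ Ω)
    (hXc : ContDiffAt ℝ ∞ (chartField y₀ X) x₀) :
    ∃ (Ψ : ℝ → E → E) (ε r : ℝ), 0 < ε ∧ 0 < r ∧
      ContinuousAt (fun p : ℝ × E => Ψ p.1 p.2) (0, x₀) ∧
      ∀ x ∈ Metric.ball x₀ r, Ψ 0 x = x ∧ ∀ t ∈ Ioo (-ε) ε,
        HasDerivAt (fun s => Ψ s x) (chartField y₀ X (Ψ t x)) t ∧ Ψ t x ∈ Ω ∧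
        φ t ((extChartAt 𝓘(ℝ, E) y₀).symm x) = (extChartAt 𝓘(ℝ, E) y₀).symm (Ψ t x) := by
  obtain ⟨Ψ, ε, r, hε, hr, hc, hΨ⟩ := exists_localFlow (hXc.of_le (by simp)) (hΩ.mem_nhds hx₀)
  refine ⟨Ψ, ε, r, hε, hr, hc, fun x hx => ⟨(hΨ x hx).1, fun t ht =>
    ⟨((hΨ x hx).2 t ht).1, ((hΨ x hx).2 t ht).2, ?_⟩⟩⟩
  have : IsManifold 𝓘(ℝ, E) 1 M := IsManifold.of_le (n := ∞) (by simp)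
  refine isMIntegralCurveOn_Ioo_eqOn_of_contMDiff_boundaryless (I := 𝓘(ℝ, E)) (v := X)
    (γ' := fun t => (extChartAt 𝓘(ℝ, E) y₀).symm (Ψ t x))
    (t₀ := 0) (a := -ε) (b := ε)
    ⟨by linarith, hε⟩ (hX.of_le (by simp)) ((hφ _).2.isMIntegralCurveOn _) ?_ ?_ ht
  · intro s hs
    obtain ⟨h1, h2⟩ := (hΨ x hx).2 s hs
    exact (hasMFDerivAt_chart_symm_comp (hsub h2) h1).hasMFDerivWithinAt
  · rw [(hφ _).1, (hΨ x hx).1]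

/-- The derivative of the time-`t` map of the flow at `z`. -/
noncomputable def flowDeriv (φ : ℝ → M → M) (t : ℝ) (z : M) : E →L[ℝ] E :=
  mfderiv 𝓘(ℝ, E) 𝓘(ℝ, E) (φ t) z

theorem flowDeriv_eq {φ : ℝ → M → M} {y₀ : M} {x₀ : E} {f : E → E} {A : E →L[ℝ] E} {t : ℝ}
    (hx₀ : x₀ ∈ (extChartAt 𝓘(ℝ, E) y₀).target)
    (hfx₀ : f x₀ ∈ (extChartAt 𝓘(ℝ, E) y₀).target)
    (hf : HasFDerivAt f A x₀)
    (hφ : ∀ᶠ x in 𝓝 x₀, φ t ((extChartAt 𝓘(ℝ, E) y₀).symm x) =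
      (extChartAt 𝓘(ℝ, E) y₀).symm (f x)) :
    flowDeriv φ t ((extChartAt 𝓘(ℝ, E) y₀).symm x₀) = ((chartSymmDeriv y₀ (f x₀)).comp A).comp
      (chartDeriv y₀ ((extChartAt 𝓘(ℝ, E) y₀).symm x₀)) := by
  have : IsManifold 𝓘(ℝ, E) 1 M := IsManifold.of_le (n := ∞) (by simp)
  set κ := extChartAt 𝓘(ℝ, E) y₀ with hκ
  have hs : κ.symm x₀ ∈ κ.source := κ.map_target hx₀
  have hκx : κ (κ.symm x₀) = x₀ := κ.right_inv hx₀
  have h1 : HasMFDerivAt 𝓘(ℝ, E) 𝓘(ℝ, E) κ (κ.symm x₀)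
      (chartDeriv (E := E) y₀ (κ.symm x₀)) :=
    (mdifferentiableAt_extChartAt (by rwa [hκ, extChartAt_source] at hs)).hasMFDerivAt
  have h2 : HasMFDerivAt 𝓘(ℝ, E) 𝓘(ℝ, E) f (κ (κ.symm x₀)) A := by
    rw [hκx]; exact HasFDerivAt.hasMFDerivAt (E := E) (E' := E) hf
  have h3 : HasMFDerivAt 𝓘(ℝ, E) 𝓘(ℝ, E) κ.symm (f (κ (κ.symm x₀)))
      (chartSymmDeriv (E := E) y₀ (f x₀)) := by
    have h0 := (mdifferentiableAt_chart_symm hfx₀).hasMFDerivAt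
    rw [hκx]; exact h0
  have h4 := HasMFDerivAt.comp (κ.symm x₀) h3 (HasMFDerivAt.comp (κ.symm x₀) h2 h1)
  have h5 : φ t =ᶠ[𝓝 (κ.symm x₀)] κ.symm ∘ f ∘ κ := by
    have hc : ContinuousAt κ (κ.symm x₀) := continuousAt_extChartAt' hs
    have h6 := hc.eventually (by rw [hκx]; exact hφ)
    filter_upwards [h6, (isOpen_extChartAt_source (I := 𝓘(ℝ, E)) y₀).mem_nhds hs] with z hz hzs
    rw [κ.left_inv hzs] at hz
    exact hz
  exact (h4.congr_of_eventuallyEq h5).mfderiv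

variable {n : ℕ} {σ : SymplecticForm E M}

/-- The fiber of the distribution, as a subspace of the model space. -/
def fiberAt (Δ : LagrangeDistribution n σ) (z : M) : Submodule ℝ E := Δ.fiber z

/-- The Jacobi curve, as a curve of subspaces of the model space. -/
noncomputable def jacobiCurveAt (Δ : LagrangeDistribution n σ) (φ : ℝ → M → M) (z : M) (t : ℝ) :
    Submodule ℝ E := jacobiCurve Δ φ z t

theorem mem_jacobiCurveAt {Δ : LagrangeDistribution n σ} {φ : ℝ → M → M} {z : M} {t : ℝ} {ξ : E} :
    ξ ∈ jacobiCurveAt Δ φ z t ↔ flowDeriv φ t z ξ ∈ fiberAt Δ (φ t z) := Iff.rfl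

variable [FiniteDimensional ℝ E] [T2Space M]

/-- In the chart the differential of the flow is the fundamental solution, conjugated by derivatives
of the chart, so membership in the Jacobi curve means lying in the transported range of the frame.
The base point may be any point of `Ω`, since the Lyapunov function is to be compared with its local
formula on an open set. -/
theorem IsModelAt.exists_isModelCurve {Δ : LagrangeDistribution n σ}
    {X : (x : M) → TangentSpace 𝓘(ℝ, E) x} (hX : IsSmoothField X)
    {φ : ℝ → M → M} (hφ : IsFlow X φ) {y₀ : M}
    {v : E → (Fin n → ℝ) →L[ℝ] E} {s : ℝ} {Ω : Set E} (m : IsModelAt Δ X y₀ v s Ω) {x₀ : E}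
    (hx₀ : x₀ ∈ Ω) :
    ∃ y A A', IsModelCurve (chartField y₀ X) v x₀
      (formAt σ ((extChartAt 𝓘(ℝ, E) y₀).symm x₀)) (chartForm σ y₀) (chartSymmDeriv y₀ x₀)
      (jacobiCurveAt Δ φ ((extChartAt 𝓘(ℝ, E) y₀).symm x₀)) y A A' := by
  have : CompleteSpace E := FiniteDimensional.complete ℝ E
  have hXc := m.model.contDiffAt_field hx₀
  have ht₀ := m.subset hx₀
  obtain ⟨Ψ, ε, r, hε, hr, hc, hΨ⟩ :=
    exists_localFlow_chart hX hφ m.model.isOpen m.subset hx₀ hXc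
  have hball : x₀ ∈ Metric.ball x₀ r := Metric.mem_ball_self hr
  have hI : Ioo (-ε) ε ∈ 𝓝 (0 : ℝ) := Ioo_mem_nhds (by linarith) hε
  obtain ⟨A, hA0, hA⟩ := exists_hasFDerivAt_flow hXc hε hr hc
    (fun x hx => ⟨(hΨ x hx).1, fun t ht => ((hΨ x hx).2 t ht).1⟩)
  obtain ⟨A', hpair, hA'0, hinv⟩ := exists_isVariationalPair (X := chartField y₀ X)
    (y := fun t => Ψ t x₀) (A := A)
    (by filter_upwards [hI] with t ht using ((hΨ x₀ hball).2 t ht).1) hA0 (hA.mono fun t ht => ht.1)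
  refine ⟨fun t => Ψ t x₀, A, A', hpair, (hΨ x₀ hball).1, hA0, hA'0, hA.mono fun t ht => ht.1,
    hinv.mono fun t ht => ht.1, isInvertible_chartSymmDeriv ht₀,
    fun ξ η => (chartForm_apply σ y₀ x₀ ξ η).symm, ?_⟩
  filter_upwards [hI, hA, hinv] with t ht hAt hinvt
  obtain ⟨-, hΨΩ, hφt⟩ := (hΨ x₀ hball).2 t ht
  have hfd := flowDeriv_eq (φ := φ) ht₀ (m.subset hΨΩ) hAt.2
    (by filter_upwards [Metric.ball_mem_nhds x₀ hr] with x hx using ((hΨ x hx).2 t ht).2.2)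
  have hTS : ∀ ξ, chartDeriv y₀ ((extChartAt 𝓘(ℝ, E) y₀).symm x₀) (chartSymmDeriv y₀ x₀ ξ) = ξ :=
    fun ξ => DFunLike.congr_fun (chartDeriv_comp_chartSymmDeriv ht₀) ξ
  have hST : ∀ ξ, chartSymmDeriv y₀ x₀ (chartDeriv y₀ ((extChartAt 𝓘(ℝ, E) y₀).symm x₀) ξ) = ξ :=
    fun ξ => DFunLike.congr_fun (chartSymmDeriv_comp_chartDeriv ht₀) ξ
  have hAA : ∀ ξ, A t (A' t ξ) = ξ := fun ξ => DFunLike.congr_fun hinvt.1 ξ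
  have hA'A : ∀ ξ, A' t (A t ξ) = ξ := fun ξ => DFunLike.congr_fun hinvt.2 ξ
  ext ξ
  rw [mem_jacobiCurveAt, hφt, hfd]
  have hmem := m.mem_range_iff _ hΨΩ
    (A t (chartDeriv y₀ ((extChartAt 𝓘(ℝ, E) y₀).symm x₀) ξ))
  refine hmem.symm.trans ?_
  constructor
  · rintro ⟨c, hcξ⟩
    refine ⟨c, ?_⟩
    have hcξ' : v (Ψ t x₀) c = A t (chartDeriv y₀ ((extChartAt 𝓘(ℝ, E) y₀).symm x₀) ξ) := hcξ
    change chartSymmDeriv y₀ x₀ (A' t (v (Ψ t x₀) c)) = ξ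
    rw [hcξ', hA'A, hST]
  · rintro ⟨c, rfl⟩
    refine ⟨c, ?_⟩
    change v (Ψ t x₀) c = A t (chartDeriv y₀ ((extChartAt 𝓘(ℝ, E) y₀).symm x₀)
      (chartSymmDeriv y₀ x₀ (A' t (v (Ψ t x₀) c))))
    rw [hTS, hAA]

/-- The curvature operator at the center of a chart, in terms of the curvature matrix. -/
theorem IsModelAt.curvatureMatrix_neg {Δ : LagrangeDistribution n σ}
    {X : (x : M) → TangentSpace 𝓘(ℝ, E) x} (hX : IsSmoothField X)
    {φ : ℝ → M → M} (hφ : IsFlow X φ) {y₀ : M}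
    {v : E → (Fin n → ℝ) →L[ℝ] E} {s : ℝ} {Ω : Set E} (m : IsModelAt Δ X y₀ v s Ω)
    (hneg : HasNegativeCurvatureAt Δ X φ y₀) (c : Fin n → ℝ) (hc : c ≠ 0) :
    s * IsLagrangeModel.gram (chartField y₀ X) (chartForm σ y₀) v (extChartAt 𝓘(ℝ, E) y₀ y₀)
      (IsLagrangeModel.curvatureMatrix (chartField y₀ X) v (extChartAt 𝓘(ℝ, E) y₀ y₀) c) c < 0 := by
  obtain ⟨y, A, A', hm⟩ := m.exists_isModelCurve hX hφ m.mem
  set x₀ := extChartAt 𝓘(ℝ, E) y₀ y₀ with hx₀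
  have hsymm : (extChartAt 𝓘(ℝ, E) y₀).symm x₀ = y₀ := extChartAt_to_inv (I := 𝓘(ℝ, E)) y₀
  set ρ := IsLagrangeModel.curvatureMatrix (chartField y₀ X) v x₀ with hρ
  have hO := fun c => hm.isBigO_mixedDeriv m.model m.mem c
  rw [hsymm, chartSymmDeriv_self] at hO
  have hmem : ∀ ξ, ξ ∈ (v x₀).range ↔ ξ ∈ fiberAt Δ y₀ := fun ξ => by
    have := m.mem_range_iff x₀ m.mem ξ
    rw [chartSymmDeriv_self, hsymm] at this
    exact this
  have hinj : Function.Injective (v x₀) := by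
    rw [injective_iff_map_eq_zero]
    intro c hc0
    by_contra hne
    have := m.model.definite x₀ m.mem c hne
    rw [hc0, map_zero, mul_zero] at this
    exact lt_irrefl _ this
  have hrange : ∀ c, v x₀ c ∈ Δ.fiber y₀ := fun c => (hmem _).1 ⟨c, rfl⟩
  let e : (Fin n → ℝ) ≃ₗ[ℝ] Δ.fiber y₀ := LinearEquiv.ofBijective
    (LinearMap.codRestrict (fiberAt Δ y₀) (v x₀ : (Fin n → ℝ) →ₗ[ℝ] E) hrange)
    ⟨fun a b hab => hinj (congrArg Subtype.val hab), fun ξ => by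
      obtain ⟨c, hc⟩ := (hmem ξ.1).2 ξ.2
      exact ⟨c, Subtype.ext hc⟩⟩
  have he : ∀ c, toModel ((e c : Δ.fiber y₀) : TangentSpace 𝓘(ℝ, E) y₀) = v x₀ c := fun c => rfl
  let R₀ : Δ.fiber y₀ →ₗ[ℝ] Δ.fiber y₀ := e.toLinearMap ∘ₗ (ρ : (Fin n → ℝ) →ₗ[ℝ] _) ∘ₗ
    e.symm.toLinearMap
  -- An operator with the required expansion exists, so `curvatureOperator` satisfies the expansion
  -- too instead of being an arbitrary default.
  have hR₀ : IsCurvatureOperator Δ φ y₀ R₀ := by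
    intro ξ
    obtain ⟨c, rfl⟩ := e.surjective ξ
    have h1 := hO c
    have h2 : R₀ (e c) = e (ρ c) := by simp [R₀]
    rw [h2]
    exact h1
  have hspec : IsCurvatureOperator Δ φ y₀ (curvatureOperator Δ φ y₀) :=
    Classical.epsilon_spec (p := IsCurvatureOperator Δ φ y₀) ⟨R₀, hR₀⟩
  -- Two expansions differ by a vector independent of `t` that is O(t), hence zero.
  have huniq : ∀ ξ, curvatureOperator Δ φ y₀ ξ = R₀ ξ := by
    intro ξ
    have h1 := (hR₀ ξ).sub (hspec ξ)
    have h2 : Tendsto (fun _ : ℝ => (3 : ℝ)⁻¹ • (toModel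
        ((curvatureOperator Δ φ y₀ ξ : Δ.fiber y₀) : TangentSpace 𝓘(ℝ, E) y₀) -
        toModel ((R₀ ξ : Δ.fiber y₀) : TangentSpace 𝓘(ℝ, E) y₀))) (𝓝[≠] 0) (𝓝 0) := by
      refine (h1.congr_left (f₂ := fun _ : ℝ => _) fun t => ?_).trans_tendsto
        (tendsto_nhdsWithin_of_tendsto_nhds tendsto_id)
      have h3 : ∀ ζ : Δ.fiber y₀, toModel ((t ^ 2)⁻¹ • (ξ : TangentSpace 𝓘(ℝ, E) y₀) +
          (3 : ℝ)⁻¹ • (ζ : TangentSpace 𝓘(ℝ, E) y₀)) =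
          (t ^ 2)⁻¹ • toModel (ξ : TangentSpace 𝓘(ℝ, E) y₀) +
          (3 : ℝ)⁻¹ • toModel (ζ : TangentSpace 𝓘(ℝ, E) y₀) := fun ζ => rfl
      rw [h3, h3, smul_sub]
      abel
    have h4 := tendsto_nhds_unique h2 tendsto_const_nhds
    have h5 := (smul_eq_zero.1 h4.symm).resolve_left (by norm_num)
    exact Subtype.ext (sub_eq_zero.1 h5)
  have hec : e c ≠ 0 := fun h0 => hc (e.map_eq_zero_iff.1 h0)
  have h1 := hneg (e c) hec
  rw [huniq] at h1
  have h2 : R₀ (e c) = e (ρ c) := by simp [R₀]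
  rw [h2, m.fiberForm_eq _ _ (ρ c) c (he _) (he _), m.fiberForm_eq _ _ c c (he _) (he _)] at h1
  rw [m.model.gram_symm m.mem (ρ c) c]
  have h3 : 0 < s * IsLagrangeModel.gram (chartField y₀ X) (chartForm σ y₀) v x₀ c c :=
    m.model.definite x₀ m.mem c hc
  rcases m.model.sign_eq with hs | hs
  · rw [hs, one_mul] at h3 ⊢
    by_contra hcon
    have := mul_nonneg (not_lt.1 hcon) h3.le
    linarith
  · rw [hs] at h3 ⊢
    by_contra hcon
    have h4 := not_lt.1 hcon
    have := mul_nonneg h4 h3.le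
    linarith

end FlowInChart

/-! ### The Lyapunov function on the manifold and its decay along the flow. -/

section LyapunovFunction

variable {E : Type*} [NormedAddCommGroup E] [NormedSpace ℝ E]
  {M : Type*} [TopologicalSpace M] [ChartedSpace E M] [IsManifold 𝓘(ℝ, E) ∞ M]
  {n : ℕ} {σ : SymplecticForm E M}

/-- The value at `z` of the Lyapunov quadratic form on the field `X`. -/
noncomputable def lyapunovAt (Δ : LagrangeDistribution n σ)
    (X : (x : M) → TangentSpace 𝓘(ℝ, E) x) (φ : ℝ → M → M) (z : M) : ℝ :=
  Classical.epsilon fun r => ∃ e, IsCurveSection (jacobiCurveAt Δ φ z) e ∧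
    toModel (X z) - deriv e 0 ∈ jacobiCurveAt Δ φ z 0 ∧
    lyapunovValue (formAt σ z) (toModel (X z)) e = r

variable [FiniteDimensional ℝ E] [T2Space M] {Δ : LagrangeDistribution n σ}
  {X : (x : M) → TangentSpace 𝓘(ℝ, E) x} {φ : ℝ → M → M} {y₀ : M}
  {v : E → (Fin n → ℝ) →L[ℝ] E} {s : ℝ} {Ω : Set E}

/-- The set of admissible values is a singleton: the adapted section provides one value and
`lyapunovValue_congr` excludes others. The definition mentions no chart, so the formulas of
different models agree on overlaps. -/
theorem IsModelAt.lyapunovAt_eq (m : IsModelAt Δ X y₀ v s Ω) (hX : IsSmoothField X)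
    (hφ : IsFlow X φ) {x : E} (hx : x ∈ Ω) :
    lyapunovAt Δ X φ ((extChartAt 𝓘(ℝ, E) y₀).symm x) =
      s * IsLagrangeModel.lyapunov (chartField y₀ X) (chartForm σ y₀) v x := by
  obtain ⟨y, A, A', hm⟩ := m.exists_isModelCurve hX hφ hx
  obtain ⟨e, he, heX, hval⟩ := hm.exists_adapted_section m.model hx
  rw [chartSymmDeriv_chartField (m.subset hx)] at heX hval
  obtain ⟨e', he', heX', hval'⟩ := Classical.epsilon_spec
    (p := fun r => ∃ e, IsCurveSection
      (jacobiCurveAt Δ φ ((extChartAt 𝓘(ℝ, E) y₀).symm x)) e ∧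
      toModel (X ((extChartAt 𝓘(ℝ, E) y₀).symm x)) - deriv e 0 ∈
        jacobiCurveAt Δ φ ((extChartAt 𝓘(ℝ, E) y₀).symm x) 0 ∧
      lyapunovValue (formAt σ ((extChartAt 𝓘(ℝ, E) y₀).symm x))
        (toModel (X ((extChartAt 𝓘(ℝ, E) y₀).symm x))) e = r) ⟨_, e, he, heX, hval⟩
  refine hval'.symm.trans (Eq.trans ?_ hval)
  exact lyapunovValue_congr (formAt_skew σ _) (hm.isIsotropicCurve m.model hx)
    (fun e he h0 => hm.eq_zero_of_deriv_pairing_eq_zero m.model hx he h0) he' he heX' heX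

theorem IsModelAt.continuousAt_lyapunovAt (m : IsModelAt Δ X y₀ v s Ω) (hX : IsSmoothField X)
    (hφ : IsFlow X φ) : ContinuousAt (lyapunovAt Δ X φ) y₀ := by
  have h1 : ContinuousAt (fun z => s * IsLagrangeModel.lyapunov (chartField y₀ X) (chartForm σ y₀) v
      (extChartAt 𝓘(ℝ, E) y₀ z)) y₀ :=
    continuousAt_const.mul (ContinuousAt.comp (f := extChartAt 𝓘(ℝ, E) y₀)
      (m.model.contDiffAt_lyapunov m.mem).continuousAt (continuousAt_extChartAt y₀))
  refine h1.congr ?_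
  filter_upwards [extChartAt_source_mem_nhds (I := 𝓘(ℝ, E)) y₀,
    (continuousAt_extChartAt (I := 𝓘(ℝ, E)) y₀).eventually (m.model.isOpen.mem_nhds m.mem)]
    with z hz hzΩ
  rw [← m.lyapunovAt_eq hX hφ hzΩ, (extChartAt 𝓘(ℝ, E) y₀).left_inv hz]

omit [FiniteDimensional ℝ E] [T2Space M] in
/-- The flow in a chart. -/
theorem HamiltonianCurvature.IsFlow.hasDerivAt_chart (hφ : IsFlow X φ) {z : M} {t : ℝ}
    (ht : φ t z ∈ (extChartAt 𝓘(ℝ, E) y₀).source) :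
    HasDerivAt (fun t => extChartAt 𝓘(ℝ, E) y₀ (φ t z))
      (chartField y₀ X (extChartAt 𝓘(ℝ, E) y₀ (φ t z))) t := by
  have : IsManifold 𝓘(ℝ, E) 1 M := IsManifold.of_le (n := ∞) (by simp)
  have h1 := (hφ z).2 t
  have h2 : HasMFDerivAt 𝓘(ℝ, E) 𝓘(ℝ, E) (extChartAt 𝓘(ℝ, E) y₀) (φ t z)
      (chartDeriv (E := E) y₀ (φ t z)) :=
    (mdifferentiableAt_extChartAt (by rwa [extChartAt_source] at ht)).hasMFDerivAt
  have h3 : HasFDerivAt (fun t => extChartAt 𝓘(ℝ, E) y₀ (φ t z))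
      ((chartDeriv (E := E) y₀ (φ t z)).comp ((1 : ℝ →L[ℝ] ℝ).smulRight (toModel (X (φ t z))))) t :=
    hasMFDerivAt_iff_hasFDerivAt.1 (HasMFDerivAt.comp t h2 h1)
  replace h3 := h3.hasDerivAt
  refine h3.congr_deriv ?_
  rw [chartField_eq ((extChartAt 𝓘(ℝ, E) y₀).map_source ht),
    (extChartAt 𝓘(ℝ, E) y₀).left_inv ht]
  change chartDeriv y₀ (φ t z) ((1 : ℝ) • toModel (X (φ t z))) = _
  rw [one_smul]

/-- The constants depend on `y₀` only and serve all trajectories through one ball. Negative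
curvature is needed just at the center, because definiteness of the dissipation is an open
condition. -/
theorem IsModelAt.exists_lyapunovAt_estimate (m : IsModelAt Δ X y₀ v s Ω) (hX : IsSmoothField X)
    (hφ : IsFlow X φ) (hneg : HasNegativeCurvatureAt Δ X φ y₀) :
    ∃ c > 0, ∃ C > 0, ∃ r > 0,
      Metric.ball (extChartAt 𝓘(ℝ, E) y₀ y₀) r ⊆ (extChartAt 𝓘(ℝ, E) y₀).target ∧
      ∀ z t, φ t z ∈ (extChartAt 𝓘(ℝ, E) y₀).source →
        extChartAt 𝓘(ℝ, E) y₀ (φ t z) ∈ Metric.ball (extChartAt 𝓘(ℝ, E) y₀ y₀) r →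
        |lyapunovAt Δ X φ (φ t z)| ≤
          C * ‖chartField y₀ X (extChartAt 𝓘(ℝ, E) y₀ (φ t z))‖ ^ 2 ∧
        ∃ g, HasDerivAt (fun t => lyapunovAt Δ X φ (φ t z)) g t ∧
          g ≤ -(c * ‖chartField y₀ X (extChartAt 𝓘(ℝ, E) y₀ (φ t z))‖ ^ 2) := by
  obtain ⟨c, hc, C, hC, hev⟩ := m.model.exists_lyapunov_estimate m.mem
    (m.curvatureMatrix_neg hX hφ hneg)
  obtain ⟨r, hr, hball⟩ := Metric.eventually_nhds_iff_ball.1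
    (hev.and (m.model.isOpen.mem_nhds m.mem))
  refine ⟨c, hc, C, hC, r, hr, fun x hx => m.subset (hball x hx).2, fun z t hs hb => ?_⟩
  obtain ⟨⟨h1, h2⟩, hΩ⟩ := hball _ hb
  have hF : ∀ z', z' ∈ (extChartAt 𝓘(ℝ, E) y₀).source → extChartAt 𝓘(ℝ, E) y₀ z' ∈ Ω →
      lyapunovAt Δ X φ z' = s * IsLagrangeModel.lyapunov (chartField y₀ X) (chartForm σ y₀) v
        (extChartAt 𝓘(ℝ, E) y₀ z') := fun z' h h' => by
    rw [← m.lyapunovAt_eq hX hφ h', (extChartAt 𝓘(ℝ, E) y₀).left_inv h]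
  refine ⟨by rw [hF _ hs hΩ]; exact h1, _, ?_, h2⟩
  have hd := hφ.hasDerivAt_chart hs
  have hL := (((m.model.contDiffAt_lyapunov hΩ).differentiableAt (by simp)).hasFDerivAt.comp_hasDerivAt
    t hd).const_mul s
  refine hL.congr_of_eventuallyEq ?_
  have hct : ContinuousAt (fun t => φ t z) t := ((hφ z).2 t).continuousAt
  filter_upwards [hct.eventually ((isOpen_extChartAt_source (I := 𝓘(ℝ, E)) y₀).mem_nhds hs),
    hd.continuousAt.eventually (m.model.isOpen.mem_nhds hΩ)] with t' h3 h4
  exact hF _ h3 h4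

omit [FiniteDimensional ℝ E] [T2Space M] in
theorem chartField_self (X : (x : M) → TangentSpace 𝓘(ℝ, E) x) (y₀ : M) :
    chartField y₀ X (extChartAt 𝓘(ℝ, E) y₀ y₀) = toModel (X y₀) := by
  rw [chartField_eq (mem_extChartAt_target y₀), extChartAt_to_inv, chartDeriv_self]; rfl

theorem IsModelAt.isHyperbolic_linearization (m : IsModelAt Δ X y₀ v s Ω) (hX : IsSmoothField X)
    (hφ : IsFlow X φ) (hneg : HasNegativeCurvatureAt Δ X φ y₀) (h0 : X y₀ = 0) :
    IsHyperbolic (linearization X y₀) :=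
  m.model.isHyperbolic_fderiv m.mem (m.curvatureMatrix_neg hX hφ hneg)
    ((chartField_self X y₀).trans h0)

omit [FiniteDimensional ℝ E] in
theorem HamiltonianCurvature.IsFlow.eq_of_smooth [CompleteSpace E] (hX : IsSmoothField X) (hφ : IsFlow X φ) {γ : ℝ → M}
    (hγ : IsMIntegralCurve γ X) {t₀ : ℝ} {z : M} (h : γ t₀ = φ t₀ z) : γ = fun t => φ t z := by
  have : IsManifold 𝓘(ℝ, E) 1 M := IsManifold.of_le (n := ∞) (by simp)
  exact isMIntegralCurve_Ioo_eq_of_contMDiff_boundaryless (t₀ := t₀) (hX.of_le (by simp)) hγ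
    (hφ z).2 h

omit [FiniteDimensional ℝ E] in
theorem HamiltonianCurvature.IsFlow.add [CompleteSpace E] (hX : IsSmoothField X)
    (hφ : IsFlow X φ) (s t : ℝ) (z : M) :
    φ (s + t) z = φ s (φ t z) := by
  have h := hφ.eq_of_smooth hX (γ := fun s => φ (s + t) z) (z := φ t z) (t₀ := 0)
    ((hφ z).2.comp_add t) (by rw [zero_add, (hφ _).1])
  exact congrFun h s

/-- Small times suffice: the purpose is that the points near `y₀` on its own orbit are cluster
points of a trajectory whenever `y₀` is one. -/
theorem IsModelAt.eventually_continuousAt_flow (m : IsModelAt Δ X y₀ v s Ω) (hX : IsSmoothField X)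
    (hφ : IsFlow X φ) : ∀ᶠ t in 𝓝 0, ContinuousAt (φ t) y₀ := by
  have : CompleteSpace E := FiniteDimensional.complete ℝ E
  have hXc := m.model.contDiffAt_field m.mem
  obtain ⟨Ψ, ε, r, hε, hr, hc, hΨ⟩ :=
    exists_localFlow_chart hX hφ m.model.isOpen m.subset m.mem hXc
  obtain ⟨A, -, hA⟩ := exists_hasFDerivAt_flow hXc hε hr hc
    (fun x hx => ⟨(hΨ x hx).1, fun t ht => ((hΨ x hx).2 t ht).1⟩)
  filter_upwards [hA, Ioo_mem_nhds (show -ε < 0 by linarith) hε] with t hAt ht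
  have hx₀ : extChartAt 𝓘(ℝ, E) y₀ y₀ ∈ Metric.ball (extChartAt 𝓘(ℝ, E) y₀ y₀) r :=
    Metric.mem_ball_self hr
  have h1 : ContinuousAt (fun z => Ψ t (extChartAt 𝓘(ℝ, E) y₀ z)) y₀ :=
    ContinuousAt.comp (f := extChartAt 𝓘(ℝ, E) y₀) hAt.2.continuousAt (continuousAt_extChartAt y₀)
  have h2 : ContinuousAt (fun z => (extChartAt 𝓘(ℝ, E) y₀).symm (Ψ t (extChartAt 𝓘(ℝ, E) y₀ z)))
      y₀ := ContinuousAt.comp (f := fun z => Ψ t (extChartAt 𝓘(ℝ, E) y₀ z))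
    (continuousAt_extChartAt_symm'' (m.subset ((hΨ _ hx₀).2 t ht).2.1)) h1
  refine h2.congr ?_
  filter_upwards [extChartAt_source_mem_nhds (I := 𝓘(ℝ, E)) y₀,
    (continuousAt_extChartAt (I := 𝓘(ℝ, E)) y₀).eventually (Metric.ball_mem_nhds _ hr)] with z hz hzb
  rw [← ((hΨ _ hzb).2 t ht).2.2, (extChartAt 𝓘(ℝ, E) y₀).left_inv hz]

end LyapunovFunction

/-! ### Length estimates and monotone limits. -/

section Trapping

/-- The displacement of a curve whose speed is controlled by the rate of decrease of a positive
function `f` is bounded by a multiple of the square root of `f`. -/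
theorem norm_sub_le_mul_sqrt {G : Type*} [NormedAddCommGroup G] [NormedSpace ℝ G] {γ w : ℝ → G}
    {f g : ℝ → ℝ} {a b c C : ℝ} (hc : 0 < c) (hC : 0 < C)
    (hγ : ∀ t ∈ Icc a b, HasDerivAt γ (w t) t) (hf : ∀ t ∈ Icc a b, HasDerivAt f (g t) t)
    (hpos : ∀ t ∈ Icc a b, 0 < f t) (hle : ∀ t ∈ Icc a b, f t ≤ C * ‖w t‖ ^ 2)
    (hg : ∀ t ∈ Icc a b, g t ≤ -(c * ‖w t‖ ^ 2)) (t : ℝ) (ht : t ∈ Icc a b) :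
    ‖γ t - γ a‖ ≤ 2 * √C / c * √(f a) := by
  -- From f ≤ C‖w‖² and g ≤ −c‖w‖² it follows that −(√f)' = −g/(2√f) ≥ c‖w‖/(2√C) = ‖w‖/D. Hence D
  -- times the decrease of √f bounds the displacement.
  set D := 2 * √C / c with hD
  have hD0 : 0 < D := by positivity
  have hB : ∀ t ∈ Icc a b, HasDerivAt (fun t => D * (√(f a) - √(f t)))
      (D * -(g t / (2 * √(f t)))) t := fun t ht => by
    have h1 := ((hf t ht).sqrt (hpos t ht).ne').const_sub (√(f a))
    exact h1.const_mul D
  have key := image_norm_le_of_norm_deriv_right_le_deriv_boundary' (a := a) (b := b)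
    (f := fun t => γ t - γ a) (f' := w) (B := fun t => D * (√(f a) - √(f t)))
    (B' := fun t => D * -(g t / (2 * √(f t))))
    (fun t ht => ((hγ t ht).continuousAt.sub continuousAt_const).continuousWithinAt)
    (fun t ht => ((hγ t (Ico_subset_Icc_self ht)).sub_const _).hasDerivWithinAt)
    (by simp) (fun t ht => (hB t ht).continuousAt.continuousWithinAt)
    (fun t ht => (hB t (Ico_subset_Icc_self ht)).hasDerivWithinAt)
    (fun t ht => by
      have ht' := Ico_subset_Icc_self ht
      have hp := Real.sqrt_pos.2 (hpos t ht')
      have h1 : √(f t) ≤ √C * ‖w t‖ := by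
        refine Real.sqrt_le_iff.2 ⟨by positivity, ?_⟩
        rw [mul_pow, Real.sq_sqrt hC.le]; exact hle t ht'
      have h2 : D * (c * ‖w t‖ ^ 2 / (2 * √(f t))) ≤ D * -(g t / (2 * √(f t))) := by
        rw [← neg_div]
        refine mul_le_mul_of_nonneg_left ?_ hD0.le
        refine div_le_div_of_nonneg_right ?_ (by positivity)
        linarith [hg t ht']
      refine le_trans ?_ h2
      have h3 : D * (c * ‖w t‖ ^ 2 / (2 * √(f t))) = (√C * ‖w t‖) * ‖w t‖ / √(f t) := by
        rw [hD]; field_simp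
      rw [h3, le_div_iff₀ hp, mul_comm]
      exact mul_le_mul_of_nonneg_right h1 (norm_nonneg _))
  refine (key ht).trans ?_
  have := Real.sqrt_nonneg (f t)
  exact mul_le_mul_of_nonneg_left (by linarith) hD0.le

theorem tendsto_of_mapClusterPt_of_antitoneOn {f : ℝ → ℝ} {a t₀ : ℝ} (hf : AntitoneOn f (Ici t₀))
    (ha : MapClusterPt a atTop f) : Tendsto f atTop (𝓝 a) := by
  have hge : ∀ t, t₀ ≤ t → a ≤ f t := by
    intro t ht
    by_contra hlt
    obtain ⟨t', h1, h2⟩ := ((ha.frequently (Ioi_mem_nhds (not_le.1 hlt))).and_eventually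
      (eventually_ge_atTop t)).exists
    have h3 := hf (mem_Ici.2 ht) (mem_Ici.2 (ht.trans h2)) h2
    exact absurd (mem_Ioi.1 h1) (not_lt.2 h3)
  refine tendsto_order.2 ⟨fun b hb => ?_, fun b hb => ?_⟩
  · filter_upwards [eventually_ge_atTop t₀] with t ht using hb.trans_le (hge t ht)
  · obtain ⟨t, h1, h2⟩ := ((ha.frequently (Iio_mem_nhds hb)).and_eventually
      (eventually_ge_atTop t₀)).exists
    filter_upwards [eventually_ge_atTop t] with t' ht'
    exact (hf (mem_Ici.2 h2) (mem_Ici.2 (h2.trans ht')) ht').trans_lt h1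

theorem MapClusterPt.eq_of_tendsto {Y α : Type*} [TopologicalSpace Y] [T2Space Y] {l : Filter α}
    {u : α → Y} {p q : Y} (hp : MapClusterPt p l u) (hq : Tendsto u l (𝓝 q)) : p = q :=
  have h : ClusterPt p (𝓝 q) := ClusterPt.mono hp hq
  have : NeBot (𝓝 p ⊓ 𝓝 q) := h
  eq_of_nhds_neBot this

end Trapping

/-! ### Convergence of the trajectory to its cluster point. -/

section Limit

variable {E : Type*} [NormedAddCommGroup E] [NormedSpace ℝ E] [FiniteDimensional ℝ E]
  {M : Type*} [TopologicalSpace M] [T2Space M] [ChartedSpace E M]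

/-- A curve that in a chart around its cluster point `p` has speed controlled by the rate of
decrease of a positive function converges to `p`. -/
theorem tendsto_of_mapClusterPt_of_estimate {u : ℝ → M} {p : M} (hu : Continuous u)
    (hp : MapClusterPt p atTop u) {f : ℝ → ℝ} {W : E → E} {c C r : ℝ} (hc : 0 < c) (hC : 0 < C)
    (hr : 0 < r)
    (hball : Metric.ball (extChartAt 𝓘(ℝ, E) p p) r ⊆ (extChartAt 𝓘(ℝ, E) p).target)
    (hf0 : Tendsto f atTop (𝓝 0)) (hfpos : ∀ t, 0 ≤ t → 0 < f t)
    (hest : ∀ t, u t ∈ (extChartAt 𝓘(ℝ, E) p).source →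
      extChartAt 𝓘(ℝ, E) p (u t) ∈ Metric.ball (extChartAt 𝓘(ℝ, E) p p) r →
      HasDerivAt (fun t => extChartAt 𝓘(ℝ, E) p (u t)) (W (extChartAt 𝓘(ℝ, E) p (u t))) t ∧
      f t ≤ C * ‖W (extChartAt 𝓘(ℝ, E) p (u t))‖ ^ 2 ∧
      ∃ g, HasDerivAt f g t ∧ g ≤ -(c * ‖W (extChartAt 𝓘(ℝ, E) p (u t))‖ ^ 2)) :
    Tendsto u atTop (𝓝 p) := by
  set κ := extChartAt 𝓘(ℝ, E) p with hκ
  set D := 2 * √C / c with hD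
  have hmain : ∀ ρ, 0 < ρ → ρ < r → ∀ᶠ t in atTop, u t ∈ κ.source ∧
      κ (u t) ∈ Metric.ball (κ p) ρ := by
    intro ρ hρ hρr
    have hD' : Tendsto (fun t => D * √(f t)) atTop (𝓝 0) := by
      have := (Real.continuous_sqrt.tendsto 0).comp hf0
      simpa using this.const_mul D
    have hsmall : ∀ᶠ t in atTop, D * √(f t) < ρ / 4 :=
      hD'.eventually (Iio_mem_nhds (by linarith))
    have hnear : ∀ᶠ z in 𝓝 p, z ∈ κ.source ∧ κ z ∈ Metric.ball (κ p) (ρ / 2) :=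
      Filter.Eventually.and (extChartAt_source_mem_nhds (I := 𝓘(ℝ, E)) p)
        ((continuousAt_extChartAt (I := 𝓘(ℝ, E)) p).eventually
          (Metric.ball_mem_nhds _ (half_pos hρ)))
    -- At this moment the curve is within ρ/2 of the center and can travel less than ρ/4 before
    -- leaving the chart ball, so it is confined to radius 3ρ/4.
    obtain ⟨t₁, ⟨hs₁, hb₁⟩, h4, h0⟩ := ((hp.frequently hnear).and_eventually
      (hsmall.and (eventually_ge_atTop 0))).exists
    have hZo : IsOpen (κ.source ∩ κ ⁻¹' Metric.ball (κ p) ρ) :=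
      (continuousOn_extChartAt p).isOpen_inter_preimage (isOpen_extChartAt_source p)
        Metric.isOpen_ball
    filter_upwards [eventually_ge_atTop t₁] with t ht
    by_contra hcon
    -- The set of times outside is closed, so a first exit time `T` would exist and belong to it.
    set A : Set ℝ := Ici t₁ ∩ u ⁻¹' (κ.source ∩ κ ⁻¹' Metric.ball (κ p) ρ)ᶜ with hA
    have hAc : IsClosed A := isClosed_Ici.inter (hZo.isClosed_compl.preimage hu)
    have hAne : A.Nonempty := ⟨t, ht, hcon⟩
    have hAb : BddBelow A := ⟨t₁, fun s hs => hs.1⟩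
    have hT := hAc.csInf_mem hAne hAb
    set T := sInf A with hTdef
    have hin : ∀ s, t₁ ≤ s → s < T → u s ∈ κ.source ∧ κ (u s) ∈ Metric.ball (κ p) ρ := by
      intro s h1 h2
      by_contra h3
      exact absurd (csInf_le hAb (show s ∈ A from ⟨h1, h3⟩)) (not_le.2 h2)
    have hT₁ : t₁ < T := by
      refine lt_of_le_of_ne hT.1 fun h => hT.2 ?_
      rw [← h]
      exact ⟨hs₁, Metric.ball_subset_ball (by linarith) hb₁⟩
    have hclose : ∀ s, t₁ ≤ s → s < T → κ (u s) ∈ Metric.closedBall (κ p) (3 / 4 * ρ) := by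
      intro s h1 h2
      have hI : ∀ s' ∈ Icc t₁ s, u s' ∈ κ.source ∧ κ (u s') ∈ Metric.ball (κ p) r := fun s' hs' =>
        ⟨(hin s' hs'.1 (hs'.2.trans_lt h2)).1,
          Metric.ball_subset_ball hρr.le (hin s' hs'.1 (hs'.2.trans_lt h2)).2⟩
      have hd : ∀ s' ∈ Icc t₁ s, HasDerivAt f (deriv f s') s' ∧
          deriv f s' ≤ -(c * ‖W (κ (u s'))‖ ^ 2) := fun s' hs' => by
        obtain ⟨-, -, g, hg, hgle⟩ := hest s' (hI s' hs').1 (hI s' hs').2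
        rw [hg.deriv]
        exact ⟨hg, hgle⟩
      have h5 := norm_sub_le_mul_sqrt (γ := fun t => κ (u t)) (w := fun t => W (κ (u t))) (f := f)
        (g := deriv f) (a := t₁) (b := s) hc hC
        (fun s' hs' => (hest s' (hI s' hs').1 (hI s' hs').2).1) (fun s' hs' => (hd s' hs').1)
        (fun s' hs' => hfpos s' (h0.trans hs'.1))
        (fun s' hs' => (hest s' (hI s' hs').1 (hI s' hs').2).2.1) (fun s' hs' => (hd s' hs').2)
        s ⟨h1, le_rfl⟩
      have h6 : dist (κ (u t₁)) (κ p) < ρ / 2 := hb₁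
      rw [← dist_eq_norm] at h5
      have h7 := dist_triangle (κ (u s)) (κ (u t₁)) (κ p)
      rw [Metric.mem_closedBall]
      linarith
    -- The estimates hold only before `T`, and `u T` might lie outside the chart domain. Compactness
    -- of the smaller ball and the Hausdorff property of the manifold keep the limit inside,
    -- contradicting the exit.
    have hZ' : IsClosed (κ.symm '' Metric.closedBall (κ p) (3 / 4 * ρ)) := by
      refine (IsCompact.image_of_continuousOn (isCompact_closedBall _ _) ?_).isClosed
      refine (continuousOn_extChartAt_symm p).mono fun x hx => hball ?_
      exact Metric.closedBall_subset_ball (by linarith) hx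
    have huT : u T ∈ κ.symm '' Metric.closedBall (κ p) (3 / 4 * ρ) := by
      have hcl : T ∈ closure (Ioo t₁ T) := by
        rw [closure_Ioo hT₁.ne]; exact ⟨hT₁.le, le_rfl⟩
      have hsub : Ioo t₁ T ⊆ u ⁻¹' (κ.symm '' Metric.closedBall (κ p) (3 / 4 * ρ)) :=
        fun s hs => ⟨κ (u s), hclose s hs.1.le hs.2, κ.left_inv (hin s hs.1.le hs.2).1⟩
      exact closure_minimal hsub (hZ'.preimage hu) hcl
    obtain ⟨x, hx, hxu⟩ := huT
    have hxt : x ∈ κ.target := hball (Metric.closedBall_subset_ball (by linarith) hx)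
    refine hT.2 ⟨?_, ?_⟩
    · rw [← hxu]; exact κ.map_target hxt
    · rw [mem_preimage, ← hxu, κ.right_inv hxt]
      exact Metric.closedBall_subset_ball (by linarith) hx
  intro U hU
  have hsymm : κ.symm (κ p) = p := extChartAt_to_inv (I := 𝓘(ℝ, E)) p
  have hc' : ContinuousAt κ.symm (κ p) := continuousAt_extChartAt_symm (I := 𝓘(ℝ, E)) p
  obtain ⟨ρ, hρ, hρU⟩ := Metric.mem_nhds_iff.1 (hc' (by rw [hsymm]; exact hU))
  rw [Filter.mem_map]
  filter_upwards [hmain (min ρ (r / 2)) (lt_min hρ (half_pos hr))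
    ((min_le_right _ _).trans_lt (half_lt_self hr))] with t ht
  have h1 := hρU (Metric.ball_subset_ball (min_le_left _ _) ht.2)
  rw [mem_preimage, κ.left_inv ht.1] at h1
  exact h1

end Limit

/-! ### The main theorem. -/

theorem theorem1 {E : Type*} [NormedAddCommGroup E] [NormedSpace ℝ E] [FiniteDimensional ℝ E]
    {M : Type*} [TopologicalSpace M] [T2Space M] [SecondCountableTopology M]
    [ChartedSpace E M] [IsManifold 𝓘(ℝ, E) ∞ M]
    (n : ℕ) (hn : Module.finrank ℝ E = 2 * n)
    (σ : SymplecticForm E M) (Δ : LagrangeDistribution n σ)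
    (h : M → ℝ) (hh : ContMDiff 𝓘(ℝ, E) 𝓘(ℝ, ℝ) ∞ h)
    (φ : ℝ → M → M) (hφ : IsFlow (hamiltonianField σ h) φ)
    (hmono : ∀ x : M, IsMonotoneAt Δ (hamiltonianField σ h) x)
    (x₀ : M)
    (hcompact : IsCompact (closure ((fun t : ℝ => φ t x₀) '' Ici 0)))
    (hneg : ∀ x ∈ closure ((fun t : ℝ => φ t x₀) '' Ici 0),
      HasNegativeCurvatureAt Δ (hamiltonianField σ h) φ x) :
    ∃ x_inf : M, Tendsto (fun t : ℝ => φ t x₀) atTop (𝓝 x_inf) ∧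
      hamiltonianField σ h x_inf = 0 ∧
      IsHyperbolic (linearization (hamiltonianField σ h) x_inf) := by
  have : CompleteSpace E := FiniteDimensional.complete ℝ E
  have hX : IsSmoothField (hamiltonianField σ h) := isSmoothField_hamiltonianField σ hh
  set X := hamiltonianField σ h
  have hmodel : ∀ y, ∃ v s Ω, IsModelAt Δ X y v s Ω := fun y =>
    exists_isModelAt hn Δ hh y (hmono y)
  set K := closure ((fun t : ℝ => φ t x₀) '' Ici 0) with hK
  have hmemK : ∀ t, 0 ≤ t → φ t x₀ ∈ K := fun t ht => subset_closure ⟨t, ht, rfl⟩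
  have hFc : Continuous (lyapunovAt Δ X φ) := continuous_iff_continuousAt.2 fun y => by
    obtain ⟨v, s, Ω, m⟩ := hmodel y
    exact m.continuousAt_lyapunovAt hX hφ
  suffices hsuff : ∃ p ∈ K, Tendsto (fun t : ℝ => φ t x₀) atTop (𝓝 p) ∧ X p = 0 by
    obtain ⟨p, hpK, hp, hXp⟩ := hsuff
    obtain ⟨v, s, Ω, m⟩ := hmodel p
    exact ⟨p, hp, hXp, m.isHyperbolic_linearization hX hφ (hneg p hpK) hXp⟩
  have hder : ∀ z t, φ t z ∈ K → ∃ g, HasDerivAt (fun t => lyapunovAt Δ X φ (φ t z)) g t ∧ g ≤ 0 ∧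
      (g = 0 → X (φ t z) = 0) ∧ (X (φ t z) = 0 → lyapunovAt Δ X φ (φ t z) = 0) := by
    intro z t hzK
    obtain ⟨v, s, Ω, m⟩ := hmodel (φ t z)
    obtain ⟨c, hc, C, hC, r, hr, hball, hest⟩ := m.exists_lyapunovAt_estimate hX hφ (hneg _ hzK)
    obtain ⟨h1, g, hg, hgle⟩ := hest z t (mem_extChartAt_source _) (Metric.mem_ball_self hr)
    rw [chartField_self] at h1 hgle
    refine ⟨g, hg, hgle.trans (by rw [neg_nonpos]; positivity), fun h0 => ?_, fun h0 => ?_⟩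
    · rw [h0] at hgle
      have h2 : c * ‖toModel (X (φ t z))‖ ^ 2 ≤ 0 := by linarith
      have h3 : ‖toModel (X (φ t z))‖ ^ 2 ≤ 0 := by
        by_contra hcon
        have := mul_pos hc (not_le.1 hcon)
        linarith
      exact norm_eq_zero.1 (pow_eq_zero_iff (two_ne_zero)|>.1 (le_antisymm h3 (sq_nonneg _)))
    · have h2 : ‖toModel (X (φ t z))‖ = 0 := norm_eq_zero.2 h0
      rw [h2] at h1
      simpa using h1
  set f : ℝ → ℝ := fun t => lyapunovAt Δ X φ (φ t x₀) with hf
  have hucont : Continuous fun t => φ t x₀ := (hφ x₀).2.continuous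
  have hfanti : AntitoneOn f (Ici 0) := by
    refine antitoneOn_of_deriv_nonpos (convex_Ici 0) (hFc.comp hucont).continuousOn ?_ ?_
    · intro t ht
      rw [interior_Ici] at ht
      obtain ⟨g, hg, -⟩ := hder x₀ t (hmemK t (mem_Ioi.1 ht).le)
      exact hg.differentiableAt.differentiableWithinAt
    · intro t ht
      rw [interior_Ici] at ht
      obtain ⟨g, hg, hg0, -⟩ := hder x₀ t (hmemK t (mem_Ioi.1 ht).le)
      rw [hg.deriv]; exact hg0
  obtain ⟨p, hpK, hp⟩ := hcompact.exists_mapClusterPt (f := atTop) (u := fun t => φ t x₀) (by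
    rw [le_principal_iff, mem_map]
    filter_upwards [eventually_ge_atTop 0] with t ht using hmemK t ht)
  have hcl : ∀ q, MapClusterPt q atTop (fun t => φ t x₀) →
      MapClusterPt (lyapunovAt Δ X φ q) atTop f := fun q hq =>
    hq.continuousAt_comp hFc.continuousAt
  have hflim : Tendsto f atTop (𝓝 (lyapunovAt Δ X φ p)) :=
    tendsto_of_mapClusterPt_of_antitoneOn hfanti (hcl p hp)
  obtain ⟨v, s, Ω, m⟩ := hmodel p
  have hXp : X p = 0 := by
    -- LaSalle's principle: `φ s p` is again a cluster point of the trajectory, and the Lyapunov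
    -- function takes its limiting value at every cluster point.
    have hconst : ∀ᶠ s in 𝓝 (0 : ℝ), lyapunovAt Δ X φ (φ s p) = lyapunovAt Δ X φ p := by
      filter_upwards [m.eventually_continuousAt_flow hX hφ] with s hs
      have h1 : MapClusterPt (φ s p) atTop (fun t => φ s (φ t x₀)) := hp.continuousAt_comp hs
      have h2 : (fun t => φ s (φ t x₀)) = (fun t => φ t x₀) ∘ fun t => s + t := by
        funext t
        exact (hφ.add hX s t x₀).symm
      rw [h2] at h1
      exact (hcl _ (h1.of_comp (tendsto_atTop_add_const_left _ s tendsto_id))).eq_of_tendsto hflim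
    have hφ0 : φ 0 p = p := (hφ p).1
    obtain ⟨g, hg, -, hg0, -⟩ := hder p 0 (by rw [hφ0]; exact hpK)
    have h1 := hg.unique ((hasDerivAt_const (0 : ℝ) (lyapunovAt Δ X φ p)).congr_of_eventuallyEq
      hconst)
    have h2 := hg0 h1
    rwa [hφ0] at h2
  have hFp : lyapunovAt Δ X φ p = 0 := by
    have hφ0 : φ 0 p = p := (hφ p).1
    obtain ⟨g, -, -, -, h0⟩ := hder p 0 (by rw [hφ0]; exact hpK)
    rw [hφ0] at h0
    exact h0 hXp
  rw [hFp] at hflim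
  have hfnonneg : ∀ t, 0 ≤ t → 0 ≤ f t := fun t ht =>
    le_of_tendsto hflim (by
      filter_upwards [eventually_ge_atTop t] with t' ht'
      exact hfanti (mem_Ici.2 ht) (mem_Ici.2 (ht.trans ht')) ht')
  -- The length estimate differentiates √f and needs `f` to be positive; otherwise the trajectory is
  -- stationary from some time on.
  by_cases hpos : ∀ t, 0 ≤ t → 0 < f t
  · refine ⟨p, hpK, ?_, hXp⟩
    obtain ⟨c, hc, C, hC, r, hr, hball, hest⟩ := m.exists_lyapunovAt_estimate hX hφ (hneg _ hpK)
    refine tendsto_of_mapClusterPt_of_estimate hucont hp (f := f) (W := chartField p X) hc hC hr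
      hball hflim hpos fun t hs hb => ?_
    obtain ⟨h1, h2⟩ := hest x₀ t hs hb
    exact ⟨hφ.hasDerivAt_chart hs, (le_abs_self _).trans h1, h2⟩
  · push Not at hpos
    obtain ⟨t₁, ht₁, hft₁⟩ := hpos
    have hzero : ∀ t, t₁ ≤ t → f t = 0 := fun t ht =>
      le_antisymm ((hfanti (mem_Ici.2 ht₁) (mem_Ici.2 (ht₁.trans ht)) ht).trans hft₁)
        (hfnonneg t (ht₁.trans ht))
    have ht₂ : 0 ≤ t₁ + 1 := by linarith
    -- At `t₁` itself `f` is known to vanish only to the right; one unit later it vanishes on a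
    -- neighborhood, so its derivative is zero and the field vanishes there.
    obtain ⟨g, hg, -, hg0, -⟩ := hder x₀ (t₁ + 1) (hmemK _ ht₂)
    have h1 := hg.unique ((hasDerivAt_const (t₁ + 1) (0 : ℝ)).congr_of_eventuallyEq (by
      filter_upwards [Ioi_mem_nhds (show t₁ < t₁ + 1 by linarith)] with t ht
      exact hzero t (mem_Ioi.1 ht).le))
    have hXq := hg0 h1
    have hcst : (fun _ : ℝ => φ (t₁ + 1) x₀) = fun t => φ t x₀ :=
      hφ.eq_of_smooth hX (isMIntegralCurve_const hXq) (t₀ := t₁ + 1) rfl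
    refine ⟨φ (t₁ + 1) x₀, hmemK _ ht₂, ?_, hXq⟩
    rw [← hcst]
    exact tendsto_const_nhds
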